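/- **Setting.** Let $d,n\ge 1$, let $A_1,\dots,A_d\in\mathbb R^{n\times n}$ be symmetric, $E\in\mathbb R^{n\times n}$ skew-symmetric, and let $T:\mathbb R^n\times\mathbb R^n\times\mathbb R^n\to\mathbb R^n$ be trilinear, extended trilinearly to $\mathbb C^n$. Put $A(\beta)=\sum_\ell\beta_\ell A_\ell$, $A(\partial)=\sum_\ell A_\ell\partial_\ell$ and $\mathcal L(\alpha,\beta)=-\alpha I+A(\beta)-\mathrm iE$. Let $\kappa\in\mathbb R^d\setminus\{0\}$ and $\omega\in\mathbb R$ be such that $\ker\mathcal L(\omega,\kappa)$ is one-dimensional and $\mathcal L(j\omega,j\kappa)$ is invertible for $j=3,5$. Assume that $\mathcal L(0,\beta)$ has a smooth eigendecomposition: real eigenvalues $\lambda_\ell(\beta)$ and an orthonormal basis of eigenvectors $\psi_\ell(\beta)$, $\ell=1,\dots,n$, $\beta\in\mathbb R^d$, which are $C^\infty$ on $\mathbb R^d\setminus\{0\}$, with every $\lambda_\ell$ globally Lipschitz continuous on $\mathbb R^d$. For $j\in\{1,3\}$ let $\mathcal L(j\omega,j\kappa+\theta)=\Psi_j(\theta)\Lambda_j(\theta)\Psi_j(\theta)^*$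 be the corresponding eigendecomposition, with columns $\psi_{j\ell}(\theta)$ of $\Psi_j(\theta)$ and eigenvalues $\lambda_{j\ell}(\theta)$, enumerated such that $\lambda_{11}(0)=0$. Let $\widehat f(k)=(2\pi)^{-d/2}\int_{\mathbb R^d} f(x)e^{-\mathrm ik\cdot x}\,dx$ be the Fourier transform, let $W$ be the Wiener algebra of all $f$ with $\widehat f\in L^1(\mathbb R^d)$, $\|f\|_W=\|\widehat f\|_{L^1}$, and let $W^s$ be the space of all $f$ with $\partial^\alpha f\in W$ for $|\alpha|\le s$, $\|f\|_{W^s}=\sum_{|\alpha|\le s}\|\partial^\alpha f\|_W$. Fix $t_{\rm end}>0$. For $\varepsilon\in(0,1]$ and $p:\mathbb R^d\to\mathbb C^n$ consider the system $$\partial_tu_j+\tfrac{\mathrm i}{\varepsilon}\mathcal L(j\omega,j\kappa)u_j+A(\partial)u_j=\varepsilon\sum_{j_1+j_2+j_3=j}T(u_{j_1},u_{j_2},u_{j_3}),\qquad j\in\{1,3\},$$ with $j_1,j_2,j_3\in\{\pm1,\pm3\}$, $u_{-j}=\overline{u_j}$, $u_1(0)=p$, $u_3(0)=0$. A classical solution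 on $[0,t_{\rm end}/\varepsilon]$ has $u_j\in C^1([0,t_{\rm end}/\varepsilon],W)\cap C([0,t_{\rm end}/\varepsilon],W^1)$. Given such a solution, let $$z_j(t,k)=\exp\!\big(\tfrac{\mathrm it}{\varepsilon}\Lambda_j(\varepsilon k)\big)\Psi_j(\varepsilon k)^*\,\widehat u_j(t,k),\qquad j\in\{1,3\}.$$ Let $P(w_1,\dots,w_n)=(w_1,0,\dots,0)$, $P^\perp=I-P$, $\mathcal P_\varepsilon(k)=\psi_{11}(\varepsilon k)\psi_{11}(\varepsilon k)^*$, $\mathcal P_\varepsilon^\perp=I-\mathcal P_\varepsilon$, $(D_\mu w)(k)=\mathrm ik_\mu w(k)$, and for $y=(y_1,y_3)$ $$|||y|||_\varepsilon=2\|Py_1\|_{L^1}+\tfrac2\varepsilon\|P^\perp y_1\|_{L^1}+\tfrac2\varepsilon\|y_3\|_{L^1}.$$ **Proposition 2.** Let $M\ge0$. All initial functions $p$ below are polarized, i.e. $p(x)\in\ker\mathcal L(\omega,\kappa)$ for all $x$. (a) For every sufficiently large $r>0$ (depending on $M$ and the data fixed above) there is $t_\star\in(0,t_{\rm end}]$ such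 that for all $p\in W^1$ with $\|p\|_{W^1}\le M$, all $\varepsilon\in(0,1]$ and all classical solutions $u$ on $[0,t_{\rm end}/\varepsilon]$, $$\sup_{t\in[0,t_\star/\varepsilon]}|||z(t)|||_\varepsilon\le r.\qquad(*)$$ (b) For every $r$ there is a constant $C$, depending only on $r$, $M$ and the data fixed above (including $t_{\rm end}$) but not on $\varepsilon$, such that the following holds for all $t_\star\in(0,t_{\rm end}]$, all $p\in W^2$ with $\|p\|_{W^2}\le M$, all $\varepsilon\in(0,1]$ and all classical solutions $u$ on $[0,t_{\rm end}/\varepsilon]$: if $(*)$ holds for this $\varepsilon$ and $u$, then for every $\mu\in\{1,\dots,d\}$ $$\sup_{t\in[0,t_\star/\varepsilon]}|||D_\mu z(t)|||_\varepsilon\le C,\qquad \sup_{t\in[0,t_\star/\varepsilon]}\|D_\mu\mathcal P_\varepsilon^\perp\widehat u_1(t)\|_{L^1}\le C\varepsilon,\qquad \sup_{t\in[0,t_\star/\varepsilon]}\|\partial_\mu u_3(t)\|_W\le C\varepsilon.$$ -/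

import Mathlib

open MeasureTheory Set
open scoped ENNReal

noncomputable section

namespace Envelope

/-- The physical space (and the frequency space) `ℝ^d`. -/
abbrev Space (d : ℕ) : Type := EuclideanSpace ℝ (Fin d)

/-- The state space `ℂ^n` with the Euclidean norm. -/
abbrev Vec (n : ℕ) : Type := EuclideanSpace ℂ (Fin n)

/-! ### Fourier transform and Wiener spaces -/

/-- The inverse Fourier transform `(2π)^{-d/2} ∫ g(k) e^{i k·x} dk` of an integrable function. -/
def invFourier {d n : ℕ} (g : Space d → Vec n) (x : Space d) : Vec n :=
  ((2 * Real.pi) ^ (-(d : ℝ) / 2) : ℝ) •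
    ∫ k : Space d, Complex.exp (Complex.I * ((inner ℝ k x : ℝ) : ℂ)) • g k

/-- `g` is an integrable Fourier transform of `f`. -/
def IsFourier {d n : ℕ} (f g : Space d → Vec n) : Prop :=
  Integrable g ∧ ∀ x, f x = invFourier g x

/-- Membership in the Wiener algebra `W`. A tempered distribution whose Fourier transform is
integrable is a continuous function, and is represented by that function. -/
def MemW {d n : ℕ} (f : Space d → Vec n) : Prop := ∃ g, IsFourier f g

open Classical in
/-- The Fourier transform of `f ∈ W` (unique up to null sets), and `0` if `f ∉ W`. -/
def hat {d n : ℕ} (f : Space d → Vec n) : Space d → Vec n :=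
  if h : MemW f then h.choose else 0

theorem integrable_hat {d n : ℕ} (f : Space d → Vec n) : Integrable (hat f) := by
  unfold hat
  split_ifs with h
  · exact h.choose_spec.1
  · exact integrable_zero _ _ _

/-- The Fourier transform of `f ∈ W` as an element of `L¹(ℝ^d, ℂ^n)`;
the map `hatL1` is an isometric isomorphism from `W` to `L¹`. -/
def hatL1 {d n : ℕ} (f : Space d → Vec n) : Lp (Vec n) 1 (volume : Measure (Space d)) :=
  (integrable_hat f).toL1 (hat f)

/-- The norm of `L¹(ℝ^d, ℂ^n)`, with values in `[0, ∞]`. -/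
def normL1 {d n : ℕ} (g : Space d → Vec n) : ℝ≥0∞ := ∫⁻ k, ‖g k‖ₑ

open Classical in
/-- The norm of `W`, equal to `∞` outside `W`. -/
def normW {d n : ℕ} (f : Space d → Vec n) : ℝ≥0∞ :=
  if MemW f then normL1 (hat f) else ∞

/-- The partial derivative `∂_ℓ f`. -/
def pderiv {d n : ℕ} (l : Fin d) (f : Space d → Vec n) (x : Space d) : Vec n :=
  fderiv ℝ f x (EuclideanSpace.single l 1)

/-- The derivative `∂^α f` for a multi-index `α`. -/
def mderiv {d n : ℕ} (α : Fin d → ℕ) (f : Space d → Vec n) : Space d → Vec n :=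
  (List.finRange d).foldr (fun l g => (pderiv l)^[α l] g) f

/-- Membership in `W^s`: all derivatives of order at most `s` belong to `W`. (If the distributional
derivatives up to order `s` belong to `W`, then `f` is of class `C^s`.) -/
def MemWs {d n : ℕ} (s : ℕ) (f : Space d → Vec n) : Prop :=
  ContDiff ℝ s f ∧ ∀ α : Fin d → ℕ, ∑ l, α l ≤ s → MemW (mderiv α f)

/-- The norm of `W^s`, the sum of `‖∂^α f‖_W` over all multi-indices with `|α| ≤ s`. -/
def normWs {d n : ℕ} (s : ℕ) (f : Space d → Vec n) : ℝ≥0∞ :=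
  ∑ m ∈ Finset.range (s + 1), ∑ α ∈ Finset.piAntidiag (Finset.univ : Finset (Fin d)) m,
    normW (mderiv α f)

/-! ### The system for the envelopes -/

/-- The matrix `L(α, β) = -α I + ∑_ℓ β_ℓ A_ℓ - i E`. -/
def symbolL {d n : ℕ} (A : Fin d → Matrix (Fin n) (Fin n) ℝ) (Em : Matrix (Fin n) (Fin n) ℝ)
    (α : ℝ) (β : Space d) : Matrix (Fin n) (Fin n) ℂ :=
  -(α : ℂ) • (1 : Matrix (Fin n) (Fin n) ℂ) + ∑ l, (β l : ℂ) • (A l).map Complex.ofReal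
    - Complex.I • Em.map Complex.ofReal

/-- The complex trilinear extension of the real trilinear map `T` to `ℂ^n`. -/
def triExt {n : ℕ}
    (T : (Fin n → ℝ) →ₗ[ℝ] (Fin n → ℝ) →ₗ[ℝ] (Fin n → ℝ) →ₗ[ℝ] (Fin n → ℝ))
    (a b c : Vec n) : Vec n :=
  ∑ p, ∑ q, ∑ r, (a p * b q * c r) •
    WithLp.toLp 2 (fun i =>
      ((T (Pi.single p 1) (Pi.single q 1) (Pi.single r 1) i : ℝ) : ℂ))

/-- The set of harmonics `{±1, ±3}`. -/
def harmonics : Finset ℤ := {1, -1, 3, -3}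

/-- All `(j₁, j₂, j₃) ∈ {±1, ±3}³` with `j₁ + j₂ + j₃ = j`. -/
def triples (j : ℤ) : Finset (ℤ × ℤ × ℤ) :=
  (harmonics ×ˢ harmonics ×ˢ harmonics).filter fun J => J.1 + J.2.1 + J.2.2 = j

/-- Componentwise complex conjugation. -/
def conjVec {n : ℕ} (v : Vec n) : Vec n := WithLp.toLp 2 fun i => starRingEnd ℂ (v i)

/-- `u = (u_j)`, `j ∈ {±1, ±3}`, with `u_{-j} = conj u_j`, is a classical solution of
`∂_t u_j + (i/ε) L(jω, jκ) u_j + A(∂) u_j = ε ∑_{j₁+j₂+j₃=j} T(u_{j₁}, u_{j₂}, u_{j₃})`, `j ∈ {1, 3}`,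
on the time interval `[0, τ]` with initial data `u_1(0) = p`, `u_3(0) = 0`; the argument `u j t x`
is the value of `u_j(t, x)`. -/
structure IsClassicalSolution {d n : ℕ}
    (A : Fin d → Matrix (Fin n) (Fin n) ℝ) (Em : Matrix (Fin n) (Fin n) ℝ)
    (T : (Fin n → ℝ) →ₗ[ℝ] (Fin n → ℝ) →ₗ[ℝ] (Fin n → ℝ) →ₗ[ℝ] (Fin n → ℝ))
    (ω : ℝ) (κ : Space d) (ε τ : ℝ) (p : Space d → Vec n)
    (u : ℤ → ℝ → Space d → Vec n) : Prop where
  /-- `u_{-j}` is the complex conjugate of `u_j`. -/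
  conj : ∀ j ∈ ({1, 3} : Finset ℤ), ∀ t ∈ Icc 0 τ, ∀ x, u (-j) t x = conjVec (u j t x)
  /-- `u_j(t) ∈ W¹` (in particular `u_j(t) ∈ W`). -/
  memW1 : ∀ j ∈ ({1, 3} : Finset ℤ), ∀ t ∈ Icc 0 τ, MemWs 1 (u j t)
  /-- `u_j ∈ C¹([0, τ], W)`. -/
  contDiff_W : ∀ j ∈ ({1, 3} : Finset ℤ), ContDiffOn ℝ 1 (fun t => hatL1 (u j t)) (Icc 0 τ)
  /-- `u_j ∈ C([0, τ], W¹)`. -/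
  continuous_W1 : ∀ j ∈ ({1, 3} : Finset ℤ), ∀ α : Fin d → ℕ, ∑ l, α l ≤ 1 →
    ContinuousOn (fun t => hatL1 (mderiv α (u j t))) (Icc 0 τ)
  /-- The partial differential equation. -/
  pde : ∀ j ∈ ({1, 3} : Finset ℤ), ∀ t ∈ Ioc 0 τ, ∀ x,
    HasDerivWithinAt (fun s => u j s x)
      (-((Complex.I / (ε : ℂ)) •
            Matrix.toEuclideanLin (symbolL A Em ((j : ℝ) * ω) ((j : ℝ) • κ)) (u j t x))
        - ∑ l, Matrix.toEuclideanLin ((A l).map Complex.ofReal) (pderiv l (u j t) x)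
        + (ε : ℂ) • ∑ J ∈ triples j, triExt T (u J.1 t x) (u J.2.1 t x) (u J.2.2 t x))
      (Icc 0 τ) t
  /-- The initial data for `u_1`. -/
  initial_one : ∀ x, u 1 0 x = p x
  /-- The initial data for `u_3`. -/
  initial_three : ∀ x, u 3 0 x = 0

/-! ### Smooth eigendecomposition and transformed variables -/

/-- An eigendecomposition of the Hermitian matrices `L(0, β) = A(β) - i E`: real eigenvalues
`λ_ℓ(β)` and an orthonormal basis of eigenvectors `ψ_ℓ(β)` which are smooth on `ℝ^d ∖ {0}`, with
globally Lipschitz continuous eigenvalues. -/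
structure SmoothEigen {d n : ℕ}
    (A : Fin d → Matrix (Fin n) (Fin n) ℝ) (Em : Matrix (Fin n) (Fin n) ℝ) where
  /-- The eigenvalues. -/
  lam : Fin n → Space d → ℝ
  /-- The eigenvectors. -/
  psi : Fin n → Space d → Vec n
  eigen : ∀ l β, Matrix.toEuclideanLin (symbolL A Em 0 β) (psi l β) = (lam l β : ℂ) • psi l β
  orthonormal : ∀ β, Orthonormal ℂ fun l => psi l β
  lam_smooth : ∀ l, ContDiffOn ℝ ((⊤ : ℕ∞) : WithTop ℕ∞) (lam l) {0}ᶜ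
  psi_smooth : ∀ l, ContDiffOn ℝ ((⊤ : ℕ∞) : WithTop ℕ∞) (psi l) {0}ᶜ
  lam_lipschitz : ∀ l, ∃ C : ℝ, ∀ β' β, |lam l β' - lam l β| ≤ C * ∑ i, |β' i - β i|

section Transform

variable {d n : ℕ} {A : Fin d → Matrix (Fin n) (Fin n) ℝ} {Em : Matrix (Fin n) (Fin n) ℝ}

/-- The eigenvalue `λ_{jℓ}(θ)` of `L_j(θ) = L(jω, jκ + θ)`. -/
def lamJ (S : ℤ → SmoothEigen A Em) (ω : ℝ) (κ : Space d) (j : ℤ) (l : Fin n) (θ : Space d) : ℝ :=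
  (S j).lam l ((j : ℝ) • κ + θ) - (j : ℝ) * ω

/-- The eigenvector `ψ_{jℓ}(θ)` of `L_j(θ) = L(jω, jκ + θ)`. -/
def psiJ (S : ℤ → SmoothEigen A Em) (κ : Space d) (j : ℤ) (l : Fin n) (θ : Space d) : Vec n :=
  (S j).psi l ((j : ℝ) • κ + θ)

/-- The unitary matrix `Ψ_j(θ)` with columns `ψ_{jℓ}(θ)`. -/
def PsiJ (S : ℤ → SmoothEigen A Em) (κ : Space d) (j : ℤ) (θ : Space d) :
    Matrix (Fin n) (Fin n) ℂ :=
  Matrix.of fun i l => psiJ S κ j l θ i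

/-- The matrix `S_{j,ε}(t, k) = exp((i t / ε) Λ_j(ε k)) Ψ_j(ε k)^*`. -/
def SMat (S : ℤ → SmoothEigen A Em) (ω : ℝ) (κ : Space d) (ε : ℝ) (j : ℤ) (t : ℝ) (k : Space d) :
    Matrix (Fin n) (Fin n) ℂ :=
  Matrix.diagonal
      (fun l => Complex.exp (Complex.I * (t : ℂ) / (ε : ℂ) * (lamJ S ω κ j l (ε • k) : ℂ)))
    * (PsiJ S κ j (ε • k)).conjTranspose

/-- The transformed variable `z_j(t, k) = S_{j,ε}(t, k) û_j(t, k)`. -/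
def zVar (S : ℤ → SmoothEigen A Em) (ω : ℝ) (κ : Space d) (ε : ℝ) (u : ℤ → ℝ → Space d → Vec n)
    (j : ℤ) (t : ℝ) (k : Space d) : Vec n :=
  Matrix.toEuclideanLin (SMat S ω κ ε j t k) (hat (u j t) k)

/-- The projection `𝒫_ε(k) w = ψ_{11}(ε k) ψ_{11}(ε k)^* w`. -/
def projEps [NeZero n] (S : ℤ → SmoothEigen A Em) (κ : Space d) (ε : ℝ) (k : Space d) (w : Vec n) :
    Vec n :=
  inner ℂ (psiJ S κ 1 0 (ε • k)) w • psiJ S κ 1 0 (ε • k)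

end Transform

/-- The projection `P (w_1, …, w_n) = (w_1, 0, …, 0)`. -/
def projP {n : ℕ} [NeZero n] (w : Vec n) : Vec n := EuclideanSpace.single 0 (w 0)

/-- The Fourier multiplier `(D_μ w)(k) = i k_μ w(k)`. -/
def mulD {d n : ℕ} (μ : Fin d) (w : Space d → Vec n) (k : Space d) : Vec n :=
  (Complex.I * (k μ : ℂ)) • w k

/-- The scaled norm
`2 ‖P y_1‖_{L¹} + (2/ε) ‖(I - P) y_1‖_{L¹} + (2/ε) ‖y_3‖_{L¹}`, with values in `[0, ∞]`. -/
def scaledNorm {d n : ℕ} [NeZero n] (ε : ℝ) (y₁ y₃ : Space d → Vec n) : ℝ≥0∞ :=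
  2 * normL1 (fun k => projP (y₁ k))
    + ENNReal.ofReal (2 / ε) * normL1 (fun k => y₁ k - projP (y₁ k))
    + ENNReal.ofReal (2 / ε) * normL1 y₃

end Envelope

end

/-!
The components `c_{jℓ} = ⟨ψ_{jℓ}(ε ·), û_j⟩` satisfy
`∂_t c + (i/ε) λ_{jℓ}(ε ·) c = ε ⟨ψ, N_j⟩`, where `N_j` is the Fourier transform of the
nonlinearity. Since `L(α, β)` is Hermitian, weighted `L¹` norms of `û` grow only through the
nonlinearity and stay bounded on times of length `1/ε`.

Polarized data make the noncritical components `O(ε)` at `t = 0`, at the expense of one factor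
`|k|`, but their forcing acts on a time interval of length `1/ε`. As `λ_{jℓ}(0) ≠ 0` for these
components, it oscillates relative to the linear evolution and is removed by the normal form
`y = c + i ε² λ_{jℓ}(0)⁻¹ ⟨ψ, N_j⟩`. What remains is `O(ε²)`: the error in replacing `λ_{jℓ}(εk)`
by `λ_{jℓ}(0)` is `O(ε |k|)`, and `∂_t N_j` is bounded up to a multiple of
`(noncritical components) / ε`, so that Gronwall's lemma closes. The weights `1` and `|k|` at the
level of the components thus require the moments of `û` of order one and two, which explains the
assumptions `p ∈ W¹` and `p ∈ W²`.
-/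

set_option maxSynthPendingDepth 3

noncomputable section

namespace Envelope

open Filter
open scoped NNReal Topology Convolution

section Fourier

open scoped FourierTransform

theorem ae_eq_zero_of_fourier_eq_zero {V E : Type*} [NormedAddCommGroup V] [InnerProductSpace ℝ V]
    [FiniteDimensional ℝ V] [MeasurableSpace V] [BorelSpace V] [NormedAddCommGroup E]
    [NormedSpace ℂ E] [CompleteSpace E] {g : V → E} (hg : Integrable g) (h : ∀ x, 𝓕 g x = 0) :
    g =ᵐ[volume] 0 := by
  refine ae_eq_zero_of_integral_contDiff_smul_eq_zero hg.locallyIntegrable ?_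
  intro φ φ_smooth φ_supp
  let Φ : SchwartzMap V ℂ := (φ_supp.comp_left (g := Complex.ofRealCLM) rfl).toSchwartzMap
    (Complex.ofRealCLM.contDiff.comp φ_smooth)
  have fourier_inv (ξ : V) : VectorFourier.fourierIntegral Real.fourierChar volume (innerₗ V)
      (𝓕⁻ Φ : SchwartzMap V ℂ) ξ = φ ξ := by
    change 𝓕 (⇑(𝓕⁻ Φ : SchwartzMap V ℂ)) ξ = _
    rw [← SchwartzMap.fourier_coe, FourierTransform.fourier_fourierInv_eq]
    rfl
  have fourier_g (ξ : V) :
      VectorFourier.fourierIntegral Real.fourierChar volume (innerₗ V).flip g ξ = 0 := by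
    rw [flip_innerₗ]
    exact h ξ
  have parseval := VectorFourier.integral_fourierIntegral_smul_eq_flip (L := innerₗ V)
    Real.continuous_fourierChar continuous_inner
    ((𝓕⁻ Φ : SchwartzMap V ℂ).integrable (μ := volume)) hg
  simp only [fourier_inv, fourier_g, smul_zero, integral_zero] at parseval
  exact parseval

variable {d n : ℕ} {f g : Space d → Vec n}

/-- The normalizing constant `(2π)^{-d/2}` of the Fourier transform. -/
def fourierConst (d : ℕ) : ℝ := (2 * Real.pi) ^ (-(d : ℝ) / 2)

theorem fourierConst_pos (d : ℕ) : 0 < fourierConst d := by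
  unfold fourierConst
  positivity

theorem invFourier_eq_fourier (g : Space d → Vec n) (x : Space d) :
    invFourier g x = fourierConst d • 𝓕 g (-(2 * Real.pi)⁻¹ • x) := by
  have char_eq (k : Space d) : Complex.exp (Complex.I * ((inner ℝ k x : ℝ) : ℂ))
      = Real.fourierChar (-inner ℝ k (-(2 * Real.pi)⁻¹ • x)) := by
    rw [Real.fourierChar_apply, inner_smul_right]
    push_cast
    field_simp
  simp only [invFourier, fourierConst, Real.fourier_eq, Circle.smul_def, char_eq]

theorem integrable_cexp_smul (hg : Integrable g) (x : Space d) :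
    Integrable fun k ↦ Complex.exp (Complex.I * ((inner ℝ k x : ℝ) : ℂ)) • g k :=
  hg.bdd_smul 1 (by fun_prop) (ae_of_all _ fun _ ↦ (Complex.norm_exp_I_mul_ofReal _).le)

theorem invFourier_add (hf : Integrable f) (hg : Integrable g) (x : Space d) :
    invFourier (f + g) x = invFourier f x + invFourier g x := by
  simp only [invFourier, Pi.add_apply, smul_add]
  rw [integral_add (integrable_cexp_smul hf x) (integrable_cexp_smul hg x), smul_add]

theorem invFourier_congr_ae (h : f =ᵐ[volume] g) (x : Space d) :
    invFourier f x = invFourier g x := by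
  unfold invFourier
  congr 1
  refine integral_congr_ae ?_
  filter_upwards [h] with k hk
  rw [hk]

theorem invFourier_clm_comp (B : Vec n →L[ℂ] Vec n) (hf : Integrable f) (x : Space d) :
    invFourier (fun k ↦ B (f k)) x = B (invFourier f x) := by
  simp only [invFourier]
  rw [B.map_smul_of_tower, ← B.integral_comp_comm (integrable_cexp_smul hf x)]
  simp only [map_smul]

theorem invFourier_sub (hf : Integrable f) (hg : Integrable g) (x : Space d) :
    invFourier (f - g) x = invFourier f x - invFourier g x := by
  simp only [invFourier, Pi.sub_apply, smul_sub]
  rw [integral_sub (integrable_cexp_smul hf x) (integrable_cexp_smul hg x), smul_sub]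

theorem norm_invFourier_le (f : Space d → Vec n) (x : Space d) :
    ‖invFourier f x‖ ≤ fourierConst d * ∫ k, ‖f k‖ := by
  change ‖fourierConst d • _‖ ≤ _
  rw [norm_smul, Real.norm_of_nonneg (fourierConst_pos d).le]
  refine mul_le_mul_of_nonneg_left ?_ (fourierConst_pos d).le
  refine (norm_integral_le_integral_norm _).trans_eq ?_
  simp only [norm_smul, Complex.norm_exp_I_mul_ofReal, one_mul]

theorem ae_eq_of_invFourier_eq (hf : Integrable f) (hg : Integrable g)
    (h : ∀ x, invFourier f x = invFourier g x) : f =ᵐ[volume] g := by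
  rw [← sub_ae_eq_zero]
  refine ae_eq_zero_of_fourier_eq_zero (hf.sub hg) fun x ↦ ?_
  have rescale : -(2 * Real.pi)⁻¹ • -(2 * Real.pi) • x = x := by
    rw [smul_smul, neg_mul_neg, inv_mul_cancel₀ (by positivity), one_smul]
  have h_smul : fourierConst d • 𝓕 (f - g) x = 0 := by
    rw [← rescale, ← invFourier_eq_fourier, invFourier_sub hf hg, h, sub_self]
  exact (smul_eq_zero.mp h_smul).resolve_left (fourierConst_pos d).ne'

theorem invFourier_cexp_smul (g : Space d → Vec n) (x y : Space d) :
    invFourier (fun k ↦ Complex.exp (Complex.I * ((inner ℝ k y : ℝ) : ℂ)) • g k) x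
      = invFourier g (x + y) := by
  simp only [invFourier, smul_smul, ← Complex.exp_add, inner_add_right, Complex.ofReal_add, mul_add]

theorem MemW.eq_invFourier (h : MemW f) (x : Space d) : f x = invFourier (hat f) x := by
  unfold hat
  rw [dif_pos h]
  exact h.choose_spec.2 x

theorem IsFourier.hat_ae_eq (h : IsFourier f g) : hat f =ᵐ[volume] g :=
  ae_eq_of_invFourier_eq (integrable_hat f) h.1 fun x ↦ by
    rw [← MemW.eq_invFourier ⟨g, h⟩, h.2]

theorem coeFn_hatL1 (f : Space d → Vec n) : hatL1 f =ᵐ[volume] hat f :=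
  Integrable.coeFn_toL1 _

end Fourier

section Derivative

variable {d n : ℕ}

theorem ae_cexp_coord_ne_one (l : Fin d) :
    ∀ᵐ k : Space d, Complex.exp (Complex.I * ((k l : ℝ) : ℂ)) ≠ 1 := by
  have coord_qmp : Measure.QuasiMeasurePreserving (fun k : Space d ↦ k l) volume volume :=
    (Measure.quasiMeasurePreserving_eval (fun _ ↦ volume) l).comp
      (PiLp.volume_preserving_ofLp (Fin d)).quasiMeasurePreserving
  have periods_null := (countable_range fun m : ℤ ↦ (m : ℝ) * (2 * Real.pi)).ae_notMem volume
  filter_upwards [coord_qmp.ae periods_null] with k hk h_exp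
  obtain ⟨m, hm⟩ := Complex.exp_eq_one_iff.mp h_exp
  refine hk ⟨m, Complex.ofReal_injective (mul_left_cancel₀ Complex.I_ne_zero ?_)⟩
  rw [hm]
  push_cast
  ring

/-- The symbol of the averaging operator `f ↦ ∫₀¹ f(· + s e_l) ds`, evaluated at `y = k_l`. -/
def avgSymbol (y : ℝ) : ℂ := ∫ s in (0 : ℝ)..1, Complex.exp (Complex.I * ((s * y : ℝ) : ℂ))

theorem mul_avgSymbol (y : ℝ) :
    Complex.I * (y : ℂ) * avgSymbol y = Complex.exp (Complex.I * (y : ℂ)) - 1 := by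
  have h_deriv (s : ℝ) : HasDerivAt (fun s : ℝ ↦ Complex.exp (Complex.I * ((s * y : ℝ) : ℂ)))
      (Complex.I * (y : ℂ) * Complex.exp (Complex.I * ((s * y : ℝ) : ℂ))) s := by
    have := (((hasDerivAt_id s).mul_const y).ofReal_comp.const_mul Complex.I).cexp
    simpa [mul_comm] using this
  rw [avgSymbol, ← intervalIntegral.integral_const_mul,
    intervalIntegral.integral_eq_sub_of_hasDerivAt (fun s _ ↦ h_deriv s)
      (Continuous.intervalIntegrable (by fun_prop) _ _)]
  simp

theorem norm_avgSymbol_le (y : ℝ) : ‖avgSymbol y‖ ≤ 1 := by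
  simpa [avgSymbol] using intervalIntegral.norm_integral_le_of_norm_le_const (a := (0 : ℝ)) (b := 1)
    (f := fun s : ℝ ↦ Complex.exp (Complex.I * ((s * y : ℝ) : ℂ)))
    fun s _ ↦ (Complex.norm_exp_I_mul_ofReal _).le

theorem continuous_avgSymbol : Continuous avgSymbol := by
  unfold avgSymbol
  apply intervalIntegral.continuous_parametric_intervalIntegral_of_continuous'
  fun_prop

theorem intervalIntegral_invFourier {g : Space d → Vec n} (hg : Integrable g) (x y : Space d) :
    ∫ s in (0 : ℝ)..1, invFourier g (x + s • y)
      = invFourier (fun k ↦ avgSymbol (inner ℝ k y) • g k) x := by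
  have avg_wave (k : Space d) :
      ∫ s in (0 : ℝ)..1, Complex.exp (Complex.I * ((inner ℝ k (x + s • y) : ℝ) : ℂ))
        = Complex.exp (Complex.I * ((inner ℝ k x : ℝ) : ℂ)) * avgSymbol (inner ℝ k y) := by
    simp only [avgSymbol, inner_add_right, inner_smul_right, Complex.ofReal_add, mul_add,
      Complex.exp_add, intervalIntegral.integral_const_mul]
  simp only [invFourier]
  rw [intervalIntegral.integral_smul, intervalIntegral_integral_swap]
  · simp only [intervalIntegral.integral_smul_const, avg_wave, mul_smul]
  · have h_snd : Integrable (fun p : ℝ × Space d ↦ g p.2)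
        ((volume.restrict (uIoc 0 1)).prod volume) := by
      rw [uIoc_of_le zero_le_one]
      exact hg.comp_snd _
    exact h_snd.bdd_smul 1 (by fun_prop)
      (ae_of_all _ fun _ ↦ (Complex.norm_exp_I_mul_ofReal _).le)

theorem intervalIntegral_pderiv {f : Space d → Vec n} (hf : ContDiff ℝ 1 f) (l : Fin d)
    (x : Space d) :
    ∫ s in (0 : ℝ)..1, pderiv l f (x + s • EuclideanSpace.single l 1)
      = f (x + EuclideanSpace.single l 1) - f x := by
  have h_deriv (s : ℝ) : HasDerivAt (fun s : ℝ ↦ f (x + s • EuclideanSpace.single l 1))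
      (pderiv l f (x + s • EuclideanSpace.single l 1)) s := by
    refine (hf.differentiable one_ne_zero _).hasFDerivAt.comp_hasDerivAt s ?_
    simpa using ((hasDerivAt_id s).smul_const (EuclideanSpace.single l (1 : ℝ))).const_add x
  have h_cont : Continuous fun s : ℝ ↦ pderiv l f (x + s • EuclideanSpace.single l 1) := by
    have := hf.continuous_fderiv one_ne_zero
    unfold pderiv
    fun_prop
  rw [intervalIntegral.integral_eq_sub_of_hasDerivAt (fun s _ ↦ h_deriv s)
    (h_cont.intervalIntegrable _ _)]
  simp

-- Averaging `∂_l f` over unit segments gives a difference of translates of `f`, whose Fourier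
-- transforms exist without differentiating under the integral sign.
theorem cexp_sub_one_smul_hat_ae_eq {f : Space d → Vec n} (hf : ContDiff ℝ 1 f) (hfW : MemW f)
    (l : Fin d) (hdf : MemW (pderiv l f)) :
    (fun k : Space d ↦ (Complex.exp (Complex.I * ((k l : ℝ) : ℂ)) - 1) • hat f k)
      =ᵐ[volume] fun k ↦ avgSymbol (k l) • hat (pderiv l f) k := by
  have inner_single (k : Space d) : inner ℝ k (EuclideanSpace.single l 1) = k l := by
    simp [EuclideanSpace.inner_single_right]
  have shift_int := integrable_cexp_smul (integrable_hat f) (EuclideanSpace.single l 1)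
  have avg_int : Integrable fun k : Space d ↦ avgSymbol (k l) • hat (pderiv l f) k :=
    (integrable_hat _).bdd_smul 1
      (continuous_avgSymbol.comp
        (by fun_prop : Continuous fun k : Space d ↦ k l)).aestronglyMeasurable
      (ae_of_all _ fun k ↦ norm_avgSymbol_le _)
  have avg_invFourier (x : Space d) :
      invFourier (fun k ↦ avgSymbol (k l) • hat (pderiv l f) k) x
        = f (x + EuclideanSpace.single l 1) - f x := by
    simpa only [inner_single, ← hdf.eq_invFourier, intervalIntegral_pderiv hf] using
      (intervalIntegral_invFourier (integrable_hat (pderiv l f)) x (EuclideanSpace.single l 1)).symm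
  have diff_eq := ae_eq_of_invFourier_eq (shift_int.sub (integrable_hat f)) avg_int fun x ↦ by
    rw [avg_invFourier, invFourier_sub shift_int (integrable_hat f), invFourier_cexp_smul,
      ← hfW.eq_invFourier, ← hfW.eq_invFourier]
  filter_upwards [diff_eq] with k hk
  rw [sub_smul, one_smul, ← hk, Pi.sub_apply, inner_single]

theorem hat_pderiv {f : Space d → Vec n} (hf : ContDiff ℝ 1 f) (hfW : MemW f) (l : Fin d)
    (hdf : MemW (pderiv l f)) :
    hat (pderiv l f) =ᵐ[volume] fun k ↦ (Complex.I * ((k l : ℝ) : ℂ)) • hat f k := by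
  filter_upwards [cexp_sub_one_smul_hat_ae_eq hf hfW l hdf, ae_cexp_coord_ne_one l] with k hk hne
  refine smul_right_injective _ (sub_ne_zero.mpr hne) ?_
  calc (Complex.exp (Complex.I * (k l : ℂ)) - 1) • hat (pderiv l f) k
      = (Complex.I * (k l : ℂ)) • avgSymbol (k l) • hat (pderiv l f) k := by
        rw [smul_smul, mul_avgSymbol]
    _ = (Complex.exp (Complex.I * (k l : ℂ)) - 1) • (Complex.I * (k l : ℂ)) • hat f k := by
        rw [← hk, smul_comm]

end Derivative

section Conjugation

variable {d n : ℕ}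

/-- Componentwise complex conjugation as a real-linear isometry. -/
def conjLI (n : ℕ) : Vec n →ₗᵢ[ℝ] Vec n where
  toFun := conjVec
  map_add' u v := by ext i; simp [conjVec]
  map_smul' c v := by ext i; simp [conjVec]
  norm_map' v := by simp [conjVec, EuclideanSpace.norm_eq]

theorem norm_conjVec (v : Vec n) : ‖conjVec v‖ = ‖v‖ := (conjLI n).norm_map v

theorem conjVec_smul (c : ℂ) (v : Vec n) : conjVec (c • v) = (starRingEnd ℂ c) • conjVec v := by
  ext i
  simp [conjVec]

theorem IsFourier.conj {f g : Space d → Vec n} (h : IsFourier f g) :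
    IsFourier (fun x ↦ conjVec (f x)) (fun k ↦ conjVec (g (-k))) := by
  have conj_wave (x k : Space d) :
      conjVec (Complex.exp (Complex.I * ((inner ℝ k x : ℝ) : ℂ)) • g k)
        = Complex.exp (Complex.I * ((inner ℝ (-k) x : ℝ) : ℂ)) • conjVec (g k) := by
    rw [conjVec_smul, ← Complex.exp_conj]
    simp
  refine ⟨(conjLI n).toContinuousLinearMap.integrable_comp h.1.comp_neg, fun x ↦ ?_⟩
  simp only [h.2 x, invFourier]
  calc conjLI n (fourierConst d • ∫ k, Complex.exp (Complex.I * ((inner ℝ k x : ℝ) : ℂ)) • g k)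
      = fourierConst d •
          ∫ k, conjVec (Complex.exp (Complex.I * ((inner ℝ k x : ℝ) : ℂ)) • g k) := by
        rw [map_smul]
        exact congrArg _ ((conjLI n).toContinuousLinearMap.integral_comp_comm
          (integrable_cexp_smul h.1 x)).symm
    _ = _ := by
        rw [← integral_neg_eq_self]
        simp only [conj_wave, neg_neg]
        rfl

end Conjugation

section WeightedNorm

variable {X E F : Type*} [MeasureSpace X] [NormedAddCommGroup E] [NormedAddCommGroup F]

/-- The weighted `L¹` norm `∫ w |f|`, with values in `[0, ∞]`. The weight is finite so that powers
and truncations of `1 + |k|` can be used without case distinctions. -/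
def wnorm (w : X → ℝ≥0) (f : X → E) : ℝ≥0∞ := ∫⁻ k, (w k : ℝ≥0∞) * ‖f k‖ₑ

theorem wnorm_le_of_ae {w w' : X → ℝ≥0} {f : X → E} {g : X → F} (C : ℝ≥0)
    (h : ∀ᵐ k, (w k : ℝ) * ‖f k‖ ≤ C * (w' k * ‖g k‖)) : wnorm w f ≤ C * wnorm w' g := by
  unfold wnorm
  rw [← lintegral_const_mul' _ _ ENNReal.coe_ne_top]
  apply lintegral_mono_ae
  filter_upwards [h] with k hk
  rw [← ofReal_norm, ← ofReal_norm, ← ENNReal.ofReal_coe_nnreal, ← ENNReal.ofReal_coe_nnreal,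
    ← ENNReal.ofReal_coe_nnreal, ← ENNReal.ofReal_mul (by positivity),
    ← ENNReal.ofReal_mul (by positivity), ← ENNReal.ofReal_mul (by positivity)]
  exact ENNReal.ofReal_le_ofReal hk

theorem wnorm_mono_ae {w w' : X → ℝ≥0} {f : X → E} {g : X → F}
    (h : ∀ᵐ k, (w k : ℝ) * ‖f k‖ ≤ w' k * ‖g k‖) : wnorm w f ≤ wnorm w' g := by
  simpa using wnorm_le_of_ae 1 (by simpa using h)

theorem wnorm_congr_ae {w : X → ℝ≥0} {f : X → E} {g : X → F}
    (h : ∀ᵐ k, ‖f k‖ = ‖g k‖) : wnorm w f = wnorm w g :=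
  le_antisymm (wnorm_mono_ae (h.mono fun k hk ↦ by rw [hk]))
    (wnorm_mono_ae (h.mono fun k hk ↦ by rw [hk]))

theorem wnorm_mono_weight {w w' : X → ℝ≥0} (f : X → E) (h : ∀ k, w k ≤ w' k) :
    wnorm w f ≤ wnorm w' f :=
  wnorm_mono_ae (ae_of_all _ fun k ↦
    mul_le_mul_of_nonneg_right (NNReal.coe_le_coe.mpr (h k)) (norm_nonneg _))

theorem aemeasurable_weight_mul_enorm {w : X → ℝ≥0} (hw : Measurable w) {f : X → E}
    (hf : AEStronglyMeasurable f) : AEMeasurable (fun k ↦ (w k : ℝ≥0∞) * ‖f k‖ₑ) :=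
  hw.coe_nnreal_ennreal.aemeasurable.mul hf.enorm

theorem wnorm_add_le {w : X → ℝ≥0} (hw : Measurable w) {f : X → E}
    (hf : AEStronglyMeasurable f) (g : X → E) :
    wnorm w (fun k ↦ f k + g k) ≤ wnorm w f + wnorm w g := by
  unfold wnorm
  rw [← lintegral_add_left' (aemeasurable_weight_mul_enorm hw hf)]
  refine lintegral_mono fun k ↦ ?_
  rw [← mul_add]
  gcongr
  exact enorm_add_le _ _

theorem wnorm_sum_le {ι : Type*} (s : Finset ι) {w : X → ℝ≥0} (hw : Measurable w)
    {f : ι → X → E} (hf : ∀ i ∈ s, AEStronglyMeasurable (f i)) :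
    wnorm w (fun k ↦ ∑ i ∈ s, f i k) ≤ ∑ i ∈ s, wnorm w (f i) := by
  unfold wnorm
  rw [← lintegral_finsetSum' _ fun i hi ↦ aemeasurable_weight_mul_enorm hw (hf i hi)]
  refine lintegral_mono fun k ↦ ?_
  rw [← Finset.mul_sum]
  gcongr
  exact enorm_sum_le _ _

theorem wnorm_lt_top {w : X → ℝ≥0} {N : ℝ≥0} (hN : ∀ k, w k ≤ N) {f : X → E}
    (hf : Integrable f) : wnorm w f < ∞ := by
  have le_unweighted : wnorm w f ≤ N * wnorm 1 f := wnorm_le_of_ae N (ae_of_all _ fun k ↦ by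
    simpa using mul_le_mul_of_nonneg_right (NNReal.coe_le_coe.mpr (hN k)) (norm_nonneg _))
  refine le_unweighted.trans_lt (ENNReal.mul_lt_top ENNReal.coe_lt_top ?_)
  simpa [wnorm, HasFiniteIntegral] using hf.2

theorem wnorm_eq_iSup_min {W : X → ℝ≥0} (hW : Measurable W) {f : X → E}
    (hf : AEStronglyMeasurable f) :
    wnorm W f = ⨆ N : ℕ, wnorm (fun k ↦ min (W k) N) f := by
  unfold wnorm
  rw [← lintegral_iSup']
  · congr 1
    ext1 k
    rw [← ENNReal.iSup_mul]
    congr 1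
    apply le_antisymm
    · obtain ⟨N, hN⟩ := exists_nat_ge (W k)
      exact le_iSup_of_le N (by simp only [min_eq_left hN, le_refl])
    · exact iSup_le fun N ↦ ENNReal.coe_le_coe.mpr (min_le_left _ _)
  · intro N
    exact (hW.min measurable_const).coe_nnreal_ennreal.aemeasurable.mul hf.enorm
  · refine ae_of_all _ fun k N N' h ↦ ?_
    dsimp only
    gcongr

theorem wnorm_le_of_forall_min {W : X → ℝ≥0} (hW : Measurable W) {f : X → E}
    (hf : AEStronglyMeasurable f) {C : ℝ≥0∞} (h : ∀ N : ℕ, wnorm (fun k ↦ min (W k) N) f ≤ C) :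
    wnorm W f ≤ C := by
  rw [wnorm_eq_iSup_min hW hf]
  exact iSup_le h

/-- The Lebesgue space `L¹(ℝ^d, E)`, in which the Fourier transforms of the solution live. -/
abbrev L1 (d : ℕ) (E : Type*) [NormedAddCommGroup E] := Lp E 1 (volume : Measure (Space d))

theorem wnorm_one_coe {d : ℕ} (f : L1 d E) : wnorm 1 f = ENNReal.ofReal ‖f‖ := by
  rw [L1.norm_eq_integral_norm, ofReal_integral_norm_eq_lintegral_enorm (L1.integrable_coeFn f)]
  simp [wnorm]

end WeightedNorm

section Convolution

variable {d : ℕ} {E F G : Type*} [NormedAddCommGroup E] [NormedAddCommGroup F]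
  [NormedAddCommGroup G] [NormedSpace ℂ E] [NormedSpace ℂ F] [NormedSpace ℂ G]

theorem enorm_convolution_le (B : E →L[ℂ] F →L[ℂ] G) (f : Space d → E) (g : Space d → F)
    (x : Space d) : ‖(f ⋆[B] g) x‖ₑ ≤ ‖B‖ₑ * ∫⁻ t, ‖f t‖ₑ * ‖g (x - t)‖ₑ := by
  rw [convolution_def]
  refine (enorm_integral_le_lintegral_enorm _).trans ?_
  rw [← lintegral_const_mul' _ _ enorm_ne_top]
  refine lintegral_mono fun t ↦ ?_
  rw [← mul_assoc, ← ofReal_norm, ← ofReal_norm B, ← ofReal_norm (f t),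
    ← ofReal_norm (g (x - t)), ← ENNReal.ofReal_mul (norm_nonneg _),
    ← ENNReal.ofReal_mul (by positivity)]
  exact ENNReal.ofReal_le_ofReal (B.le_opNorm₂ _ _)

theorem wnorm_convolution_le (B : E →L[ℂ] F →L[ℂ] G) {w : Space d → ℝ≥0} (hw : Measurable w)
    {f : Space d → E} {g : Space d → F} (hf : AEStronglyMeasurable f)
    (hg : AEStronglyMeasurable g) :
    wnorm w (f ⋆[B] g) ≤ ‖B‖ₑ * ∫⁻ t, ‖f t‖ₑ * ∫⁻ y, (w (y + t) : ℝ≥0∞) * ‖g y‖ₑ := by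
  have integrand_meas : AEMeasurable (fun p : Space d × Space d ↦
      (w p.1 : ℝ≥0∞) * (‖f p.2‖ₑ * ‖g (p.1 - p.2)‖ₑ)) (volume.prod volume) := by
    have product_meas :=
      (hf.norm.convolution_integrand (μ := volume) (ContinuousLinearMap.mul ℝ ℝ) hg.norm).enorm
    refine (hw.comp measurable_fst).coe_nnreal_ennreal.aemeasurable.mul (product_meas.congr ?_)
    exact ae_of_all _ fun p ↦ by simp [enorm_mul]
  calc wnorm w (f ⋆[B] g)
      ≤ ∫⁻ x, (w x : ℝ≥0∞) * (‖B‖ₑ * ∫⁻ t, ‖f t‖ₑ * ‖g (x - t)‖ₑ) := by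
        refine lintegral_mono fun x ↦ ?_
        dsimp only
        gcongr
        exact enorm_convolution_le B f g x
    _ = ‖B‖ₑ * ∫⁻ x, ∫⁻ t, (w x : ℝ≥0∞) * (‖f t‖ₑ * ‖g (x - t)‖ₑ) := by
        rw [← lintegral_const_mul' _ _ enorm_ne_top]
        congr 1
        ext1 x
        rw [lintegral_const_mul' _ _ ENNReal.coe_ne_top, mul_left_comm]
    _ = ‖B‖ₑ * ∫⁻ t, ‖f t‖ₑ * ∫⁻ x, (w x : ℝ≥0∞) * ‖g (x - t)‖ₑ := by
        rw [lintegral_lintegral_swap integrand_meas]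
        congr 2
        ext1 t
        rw [← lintegral_const_mul' _ _ enorm_ne_top]
        congr 1
        ext1 x
        rw [mul_left_comm]
    _ = _ := by
        congr 2
        ext1 t
        rw [← lintegral_sub_right_eq_self (fun y ↦ (w (y + t) : ℝ≥0∞) * ‖g y‖ₑ) t]
        simp

theorem wnorm_convolution_le_mul (B : E →L[ℂ] F →L[ℂ] G) {w : Space d → ℝ≥0} (hw : Measurable w)
    (hmul : ∀ x y, w (x + y) ≤ w x * w y) {f : Space d → E} {g : Space d → F}
    (hf : Integrable f) (hg : Integrable g) :
    wnorm w (f ⋆[B] g) ≤ ‖B‖ₑ * (wnorm w f * wnorm w g) := by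
  refine (wnorm_convolution_le B hw hf.1 hg.1).trans ?_
  gcongr
  unfold wnorm
  rw [← lintegral_mul_const'' _ (aemeasurable_weight_mul_enorm hw hf.1)]
  refine lintegral_mono fun t ↦ ?_
  dsimp only
  rw [mul_comm (w t : ℝ≥0∞), mul_assoc]
  gcongr
  rw [← lintegral_const_mul' _ _ ENNReal.coe_ne_top]
  refine lintegral_mono fun y ↦ ?_
  dsimp only
  rw [← mul_assoc]
  gcongr
  rw [mul_comm]
  exact_mod_cast hmul y t

theorem wnorm_convolution_le_add (B : E →L[ℂ] F →L[ℂ] G) {w : Space d → ℝ≥0} (hw : Measurable w)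
    {K : ℝ≥0} (hadd : ∀ x y, w (x + y) ≤ K * (w x + w y)) {f : Space d → E} {g : Space d → F}
    (hf : Integrable f) (hg : Integrable g) :
    wnorm w (f ⋆[B] g)
      ≤ ‖B‖ₑ * (K * (wnorm w f * wnorm 1 g + wnorm 1 f * wnorm w g)) := by
  refine (wnorm_convolution_le B hw hf.1 hg.1).trans ?_
  gcongr
  have wnorm_shift_le (t : Space d) :
      ∫⁻ y, (w (y + t) : ℝ≥0∞) * ‖g y‖ₑ ≤ K * (w t * wnorm 1 g + wnorm w g) := by
    unfold wnorm
    rw [← lintegral_const_mul' (w t : ℝ≥0∞) _ ENNReal.coe_ne_top, ← lintegral_add_right' _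
      (aemeasurable_weight_mul_enorm hw hg.1),
      ← lintegral_const_mul' _ _ ENNReal.coe_ne_top]
    refine lintegral_mono fun y ↦ ?_
    simp only [Pi.one_apply, ENNReal.coe_one, one_mul]
    rw [← add_mul, ← mul_assoc]
    gcongr
    rw [add_comm (w t : ℝ≥0∞)]
    exact_mod_cast hadd y t
  calc ∫⁻ t, ‖f t‖ₑ * ∫⁻ y, (w (y + t) : ℝ≥0∞) * ‖g y‖ₑ
      ≤ ∫⁻ t, K * (((w t : ℝ≥0∞) * ‖f t‖ₑ) * wnorm 1 g + ‖f t‖ₑ * wnorm w g) := by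
        refine lintegral_mono fun t ↦ ?_
        calc _ ≤ ‖f t‖ₑ * (K * (w t * wnorm 1 g + wnorm w g)) := by gcongr; exact wnorm_shift_le t
          _ = _ := by ring
    _ = _ := by
        rw [lintegral_const_mul' _ _ ENNReal.coe_ne_top, lintegral_add_left'
          ((aemeasurable_weight_mul_enorm hw hf.1).mul_const _),
          lintegral_mul_const'' _ (aemeasurable_weight_mul_enorm hw hf.1),
          lintegral_mul_const'' _ hf.1.enorm]
        simp [wnorm]

/-- The convolution of two `L¹` functions with respect to a bounded bilinear map. -/
def convFun (B : E →L[ℂ] F →L[ℂ] G) (f : L1 d E) (g : L1 d F) : L1 d G :=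
  ((L1.integrable_coeFn f).integrable_convolution B (L1.integrable_coeFn g)).toL1 _

theorem coeFn_convFun (B : E →L[ℂ] F →L[ℂ] G) (f : L1 d E) (g : L1 d F) :
    convFun B f g =ᵐ[volume] (⇑f ⋆[B] ⇑g) :=
  Integrable.coeFn_toL1 _

theorem convFun_add_left (B : E →L[ℂ] F →L[ℂ] G) (f f' : L1 d E) (g : L1 d F) :
    convFun B (f + f') g = convFun B f g + convFun B f' g := by
  unfold convFun
  rw [← Integrable.toL1_add, Integrable.toL1_eq_toL1_iff,
    convolution_congr _ (Lp.coeFn_add f f') (ae_eq_refl _)]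
  filter_upwards [(L1.integrable_coeFn f).ae_convolution_exists B (L1.integrable_coeFn g),
    (L1.integrable_coeFn f').ae_convolution_exists B (L1.integrable_coeFn g)] with x hf hf'
  exact hf.add_distrib hf'

theorem convFun_add_right (B : E →L[ℂ] F →L[ℂ] G) (f : L1 d E) (g g' : L1 d F) :
    convFun B f (g + g') = convFun B f g + convFun B f g' := by
  unfold convFun
  rw [← Integrable.toL1_add, Integrable.toL1_eq_toL1_iff,
    convolution_congr _ (ae_eq_refl _) (Lp.coeFn_add g g')]
  filter_upwards [(L1.integrable_coeFn f).ae_convolution_exists B (L1.integrable_coeFn g),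
    (L1.integrable_coeFn f).ae_convolution_exists B (L1.integrable_coeFn g')] with x hg hg'
  exact hg.distrib_add hg'

theorem convFun_smul_left (B : E →L[ℂ] F →L[ℂ] G) (c : ℝ) (f : L1 d E) (g : L1 d F) :
    convFun B (c • f) g = c • convFun B f g := by
  unfold convFun
  rw [← Integrable.toL1_smul, Integrable.toL1_eq_toL1_iff,
    convolution_congr _ (Lp.coeFn_smul c f) (ae_eq_refl _)]
  refine ae_of_all _ fun x ↦ ?_
  simp only [convolution_def, Pi.smul_apply, ContinuousLinearMap.map_smul_of_tower, smul_apply,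
    integral_smul]

theorem convFun_smul_right (B : E →L[ℂ] F →L[ℂ] G) (c : ℝ) (f : L1 d E) (g : L1 d F) :
    convFun B f (c • g) = c • convFun B f g := by
  unfold convFun
  rw [← Integrable.toL1_smul, Integrable.toL1_eq_toL1_iff,
    convolution_congr _ (ae_eq_refl _) (Lp.coeFn_smul c g)]
  refine ae_of_all _ fun x ↦ ?_
  simp only [convolution_def, Pi.smul_apply, ContinuousLinearMap.map_smul_of_tower, integral_smul]

theorem norm_convFun_le (B : E →L[ℂ] F →L[ℂ] G) (f : L1 d E) (g : L1 d F) :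
    ‖convFun B f g‖ ≤ ‖B‖ * ‖f‖ * ‖g‖ := by
  have wnorm_le := wnorm_convolution_le_mul B (w := 1) measurable_const (fun x y ↦ by simp)
    (L1.integrable_coeFn f) (L1.integrable_coeFn g)
  rw [← wnorm_congr_ae ((coeFn_convFun B f g).mono fun k hk ↦ congrArg norm hk), wnorm_one_coe,
    wnorm_one_coe, wnorm_one_coe, ← ofReal_norm, ← ENNReal.ofReal_mul (norm_nonneg _),
    ← ENNReal.ofReal_mul (norm_nonneg _), ← mul_assoc] at wnorm_le
  exact (ENNReal.ofReal_le_ofReal_iff (by positivity)).mp wnorm_le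

/-- Convolution with respect to a bounded bilinear map, as a bounded bilinear map on `L¹`. It is
bundled over `ℝ` because it will be differentiated along curves depending on a real time. -/
def convL (B : E →L[ℂ] F →L[ℂ] G) : L1 d E →L[ℝ] L1 d F →L[ℝ] L1 d G :=
  LinearMap.mkContinuous₂
    (LinearMap.mk₂ ℝ (convFun B) (convFun_add_left B) (convFun_smul_left B) (convFun_add_right B)
      (convFun_smul_right B))
    ‖B‖ (norm_convFun_le B)

theorem coeFn_convL (B : E →L[ℂ] F →L[ℂ] G) (f : L1 d E) (g : L1 d F) :
    convL B f g =ᵐ[volume] (⇑f ⋆[B] ⇑g) :=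
  coeFn_convFun B f g

theorem wnorm_convL_le_mul (B : E →L[ℂ] F →L[ℂ] G) {w : Space d → ℝ≥0} (hw : Measurable w)
    (hmul : ∀ x y, w (x + y) ≤ w x * w y) (f : L1 d E) (g : L1 d F) :
    wnorm w (convL B f g) ≤ ‖B‖ₑ * (wnorm w f * wnorm w g) := by
  rw [wnorm_congr_ae ((coeFn_convL B f g).mono fun _ hk ↦ congrArg norm hk)]
  exact wnorm_convolution_le_mul B hw hmul (L1.integrable_coeFn f) (L1.integrable_coeFn g)

theorem wnorm_convL_le_add (B : E →L[ℂ] F →L[ℂ] G) {w : Space d → ℝ≥0} (hw : Measurable w)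
    {K : ℝ≥0} (hadd : ∀ x y, w (x + y) ≤ K * (w x + w y)) (f : L1 d E) (g : L1 d F) :
    wnorm w (convL B f g)
      ≤ ‖B‖ₑ * (K * (wnorm w f * wnorm 1 g + wnorm 1 f * wnorm w g)) := by
  rw [wnorm_congr_ae ((coeFn_convL B f g).mono fun _ hk ↦ congrArg norm hk)]
  exact wnorm_convolution_le_add B hw hadd (L1.integrable_coeFn f) (L1.integrable_coeFn g)

open scoped FourierTransform in
theorem fourier_convL [CompleteSpace E] [CompleteSpace F] [CompleteSpace G]
    (B : E →L[ℂ] F →L[ℂ] G) (f : L1 d E) (g : L1 d F) (ξ : Space d) :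
    𝓕 (convL B f g : Space d → G) ξ = B (𝓕 (f : Space d → E) ξ) (𝓕 (g : Space d → F) ξ) := by
  rw [← Real.fourier_bilin_convolution_eq B (L1.integrable_coeFn f) (L1.integrable_coeFn g),
    Real.fourier_eq, Real.fourier_eq]
  apply integral_congr_ae
  filter_upwards [coeFn_convL B f g] with k hk
  rw [hk]

/-- The trilinear convolution product on `L¹` defined by a trilinear map. Convolving `convL t a b`,
whose values are linear maps, with `c` applies the former to the latter. -/
def conv3 (t : E →L[ℂ] E →L[ℂ] E →L[ℂ] E) (a b c : L1 d E) : L1 d E :=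
  convL (ContinuousLinearMap.id ℂ (E →L[ℂ] E)) (convL t a b) c

theorem enorm_id_le (E : Type*) [NormedAddCommGroup E] [NormedSpace ℂ E] :
    ‖ContinuousLinearMap.id ℂ E‖ₑ ≤ 1 := by
  rw [← ofReal_norm, ← ENNReal.ofReal_one]
  exact ENNReal.ofReal_le_ofReal ContinuousLinearMap.norm_id_le

theorem wnorm_conv3_le_mul (t : E →L[ℂ] E →L[ℂ] E →L[ℂ] E) {w : Space d → ℝ≥0}
    (hw : Measurable w) (hmul : ∀ x y, w (x + y) ≤ w x * w y) (a b c : L1 d E) :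
    wnorm w (conv3 t a b c) ≤ ‖t‖ₑ * (wnorm w a * wnorm w b * wnorm w c) := by
  refine (wnorm_convL_le_mul _ hw hmul _ _).trans ?_
  calc _ ≤ 1 * (‖t‖ₑ * (wnorm w a * wnorm w b) * wnorm w c) := by
        gcongr
        · exact enorm_id_le _
        · exact wnorm_convL_le_mul _ hw hmul _ _
    _ = _ := by ring

theorem wnorm_conv3_le_add (t : E →L[ℂ] E →L[ℂ] E →L[ℂ] E) {w : Space d → ℝ≥0}
    (hw : Measurable w) {K : ℝ≥0} (hK : 1 ≤ K) (hadd : ∀ x y, w (x + y) ≤ K * (w x + w y))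
    (a b c : L1 d E) :
    wnorm w (conv3 t a b c) ≤ ‖t‖ₑ * K ^ 2 * (wnorm w a * wnorm 1 b * wnorm 1 c
      + wnorm 1 a * wnorm w b * wnorm 1 c + wnorm 1 a * wnorm 1 b * wnorm w c) := by
  refine (wnorm_convL_le_add _ hw hadd _ _).trans ?_
  have K_le_sq : (K : ℝ≥0∞) ≤ K ^ 2 := by exact_mod_cast le_self_pow hK two_ne_zero
  calc _ ≤ 1 * (K * (‖t‖ₑ * (K * (wnorm w a * wnorm 1 b + wnorm 1 a * wnorm w b)) * wnorm 1 c
          + ‖t‖ₑ * (wnorm 1 a * wnorm 1 b) * wnorm w c)) := by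
        gcongr
        · exact enorm_id_le _
        · exact wnorm_convL_le_add _ hw hadd _ _
        · exact wnorm_convL_le_mul _ (w := 1) measurable_const (fun x y ↦ by simp) _ _
    _ = ‖t‖ₑ * K ^ 2 * (wnorm w a * wnorm 1 b * wnorm 1 c + wnorm 1 a * wnorm w b * wnorm 1 c)
          + ‖t‖ₑ * K * (wnorm 1 a * wnorm 1 b * wnorm w c) := by ring
    _ ≤ ‖t‖ₑ * K ^ 2 * (wnorm w a * wnorm 1 b * wnorm 1 c + wnorm 1 a * wnorm w b * wnorm 1 c)
          + ‖t‖ₑ * K ^ 2 * (wnorm 1 a * wnorm 1 b * wnorm w c) := by gcongr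
    _ = _ := by ring

theorem hasDerivWithinAt_conv3 (t : E →L[ℂ] E →L[ℂ] E →L[ℂ] E) {a b c : ℝ → L1 d E}
    {a' b' c' : L1 d E} {s : Set ℝ} {x : ℝ} (ha : HasDerivWithinAt a a' s x)
    (hb : HasDerivWithinAt b b' s x) (hc : HasDerivWithinAt c c' s x) :
    HasDerivWithinAt (fun y ↦ conv3 t (a y) (b y) (c y))
      (conv3 t (a x) (b x) c' + (conv3 t (a x) b' (c x) + conv3 t a' (b x) (c x))) s x := by
  have outer_deriv :=
    (convL (ContinuousLinearMap.id ℂ (E →L[ℂ] E))).hasDerivWithinAt_of_bilinear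
      ((convL t).hasDerivWithinAt_of_bilinear ha hb) hc
  rwa [map_add, add_apply] at outer_deriv

theorem continuousOn_conv3 (t : E →L[ℂ] E →L[ℂ] E →L[ℂ] E) {a b c : ℝ → L1 d E} {s : Set ℝ}
    (ha : ContinuousOn a s) (hb : ContinuousOn b s) (hc : ContinuousOn c s) :
    ContinuousOn (fun y ↦ conv3 t (a y) (b y) (c y)) s := by
  unfold conv3
  fun_prop

open scoped FourierTransform in
theorem invFourier_conv3 {n : ℕ} (t : Vec n →L[ℂ] Vec n →L[ℂ] Vec n →L[ℂ] Vec n)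
    (a b c : L1 d (Vec n)) (x : Space d) :
    t (invFourier a x) (invFourier b x) (invFourier c x)
      = (fourierConst d ^ 2) • invFourier (conv3 t a b c) x := by
  simp only [invFourier_eq_fourier, conv3, fourier_convL, ContinuousLinearMap.id_apply,
    ContinuousLinearMap.map_smul_of_tower, smul_apply, smul_smul]
  congr 1
  ring

end Convolution

section Slope

/-- The upper right Dini derivative of `φ` at `t` is at most `c`, in the form required by
Grönwall's inequality for functions, such as norms, that need not be differentiable. -/
def RightSlopeLE (φ : ℝ → ℝ) (c t : ℝ) : Prop :=
  ∀ r, c < r → ∀ᶠ z in 𝓝[>] t, (z - t)⁻¹ * (φ z - φ t) < r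

theorem RightSlopeLE.mono {φ : ℝ → ℝ} {c c' t : ℝ} (h : RightSlopeLE φ c t) (hc : c ≤ c') :
    RightSlopeLE φ c' t :=
  fun r hr ↦ h r (hc.trans_lt hr)

theorem RightSlopeLE.add {φ ψ : ℝ → ℝ} {c c' t : ℝ} (h : RightSlopeLE φ c t)
    (h' : RightSlopeLE ψ c' t) : RightSlopeLE (fun s ↦ φ s + ψ s) (c + c') t := by
  intro r hr
  filter_upwards [h (c + (r - (c + c')) / 2) (by linarith),
    h' (c' + (r - (c + c')) / 2) (by linarith)] with z hz hz'
  rw [add_sub_add_comm, mul_add]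
  linarith

theorem RightSlopeLE.sum {ι : Type*} (s : Finset ι) {φ : ι → ℝ → ℝ} {c : ι → ℝ} {t : ℝ}
    (h : ∀ i ∈ s, RightSlopeLE (φ i) (c i) t) :
    RightSlopeLE (fun x ↦ ∑ i ∈ s, φ i x) (∑ i ∈ s, c i) t := by
  classical
  induction s using Finset.induction_on with
  | empty =>
    intro r hr
    simpa using hr
  | insert i s hi ih =>
    simp only [Finset.sum_insert hi]
    exact (h i (Finset.mem_insert_self _ _)).add
      (ih fun j hj ↦ h j (Finset.mem_insert_of_mem hj))

theorem le_gronwallBound_of_rightSlopeLE {φ c : ℝ → ℝ} {δ K e T : ℝ}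
    (hφ : ContinuousOn φ (Icc 0 T)) (hs : ∀ t ∈ Ico 0 T, RightSlopeLE φ (c t) t) (h0 : φ 0 ≤ δ)
    (hc : ∀ t ∈ Ico 0 T, c t ≤ K * φ t + e) : ∀ t ∈ Icc 0 T, φ t ≤ gronwallBound δ K e t := by
  intro t ht
  simpa only [sub_zero] using le_gronwallBound_of_liminf_deriv_right_le hφ
    (fun x hx r hr ↦ (hs x hx r hr).frequently) h0 hc t ht

theorem le_linear_of_rightSlopeLE {φ c : ℝ → ℝ} {δ K T : ℝ}
    (hφ : ContinuousOn φ (Icc 0 T)) (hs : ∀ t ∈ Ico 0 T, RightSlopeLE φ (c t) t) (h0 : φ 0 ≤ δ)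
    (hc : ∀ t ∈ Ico 0 T, φ t = δ + K * t → c t < K) : ∀ t ∈ Icc 0 T, φ t ≤ δ + K * t := by
  intro t ht
  refine image_le_of_liminf_slope_right_lt_deriv_boundary (B := fun t ↦ δ + K * t)
    (B' := fun _ ↦ K) hφ (fun x hx r hr ↦ ?_) (by simpa using h0)
    (fun x ↦ ?_) hc ht
  · refine ((hs x hx r hr).mono fun z hz ↦ ?_).frequently
    rwa [slope_def_field, div_eq_inv_mul]
  · simpa using ((hasDerivAt_id x).const_mul K).const_add δ

end Slope

section WeightedSlope

variable {d : ℕ} {E : Type*} [NormedAddCommGroup E]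

/-- The weighted `L¹` norm as a real number; it is `0` where `wnorm` is infinite. -/
def wreal (w : Space d → ℝ≥0) (f : Space d → E) : ℝ := (wnorm w f).toReal

theorem wreal_nonneg (w : Space d → ℝ≥0) (f : Space d → E) : 0 ≤ wreal w f :=
  ENNReal.toReal_nonneg

theorem ofReal_wreal {w : Space d → ℝ≥0} {N : ℝ≥0} (hN : ∀ k, w k ≤ N) (f : L1 d E) :
    ENNReal.ofReal (wreal w f) = wnorm w f :=
  ENNReal.ofReal_toReal (wnorm_lt_top hN (L1.integrable_coeFn f)).ne

theorem wreal_eq_integral {w : Space d → ℝ≥0} (hw : Measurable w) (f : L1 d E) :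
    wreal w f = ∫ k, (w k : ℝ) * ‖f k‖ := by
  have integrand_meas : AEStronglyMeasurable fun k ↦ (w k : ℝ) * ‖f k‖ :=
    hw.coe_nnreal_real.aestronglyMeasurable.mul (L1.integrable_coeFn f).1.norm
  rw [integral_eq_lintegral_of_nonneg_ae (ae_of_all _ fun k ↦ by positivity) integrand_meas]
  unfold wreal wnorm
  congr 2
  ext1 k
  rw [ENNReal.ofReal_mul NNReal.zero_le_coe, ofReal_norm, ENNReal.ofReal_coe_nnreal]

theorem integrable_weight_mul_norm {w : Space d → ℝ≥0} (hw : Measurable w) {N : ℝ≥0}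
    (hN : ∀ k, w k ≤ N) (f : L1 d E) : Integrable fun k ↦ (w k : ℝ) * ‖f k‖ :=
  (L1.integrable_coeFn f).norm.bdd_mul hw.coe_nnreal_real.aestronglyMeasurable
    (ae_of_all _ fun k ↦ by
      rw [Real.norm_of_nonneg NNReal.zero_le_coe]; exact NNReal.coe_le_coe.mpr (hN k))

theorem wreal_add_le {w : Space d → ℝ≥0} (hw : Measurable w) {N : ℝ≥0} (hN : ∀ k, w k ≤ N)
    (f g : L1 d E) : wreal w (f + g : L1 d E) ≤ wreal w f + wreal w g := by
  simp only [wreal_eq_integral hw]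
  rw [← integral_add (integrable_weight_mul_norm hw hN f) (integrable_weight_mul_norm hw hN g)]
  refine integral_mono_ae (integrable_weight_mul_norm hw hN _)
    ((integrable_weight_mul_norm hw hN f).add (integrable_weight_mul_norm hw hN g)) ?_
  filter_upwards [Lp.coeFn_add f g] with k hk
  rw [hk, ← mul_add]
  exact mul_le_mul_of_nonneg_left (norm_add_le _ _) NNReal.zero_le_coe

theorem wreal_smul [NormedSpace ℝ E] {w : Space d → ℝ≥0} (hw : Measurable w) {c : ℝ} (hc : 0 ≤ c)
    (f : L1 d E) : wreal w (c • f : L1 d E) = c * wreal w f := by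
  simp only [wreal_eq_integral hw]
  rw [← integral_const_mul]
  apply integral_congr_ae
  filter_upwards [Lp.coeFn_smul c f] with k hk
  rw [hk, Pi.smul_apply, norm_smul, Real.norm_of_nonneg hc]
  ring

theorem wreal_le_norm {w : Space d → ℝ≥0} (hw : Measurable w) {N : ℝ≥0} (hN : ∀ k, w k ≤ N)
    (f : L1 d E) : wreal w f ≤ N * ‖f‖ := by
  rw [wreal_eq_integral hw, L1.norm_eq_integral_norm, ← integral_const_mul]
  refine integral_mono (integrable_weight_mul_norm hw hN f)
    ((L1.integrable_coeFn f).norm.const_mul _) fun k ↦ ?_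
  exact mul_le_mul_of_nonneg_right (NNReal.coe_le_coe.mpr (hN k)) (norm_nonneg _)

theorem continuous_wreal {w : Space d → ℝ≥0} (hw : Measurable w) {N : ℝ≥0} (hN : ∀ k, w k ≤ N) :
    Continuous fun f : L1 d E ↦ wreal w f := by
  refine (LipschitzWith.of_le_add_mul N fun f g ↦ ?_).continuous
  calc wreal w f = wreal w (g + (f - g) : L1 d E) := by rw [add_sub_cancel]
    _ ≤ wreal w g + wreal w (f - g : L1 d E) := wreal_add_le hw hN g (f - g)
    _ ≤ wreal w g + N * dist f g := by
        rw [dist_eq_norm]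
        gcongr
        exact wreal_le_norm hw hN (f - g)

theorem norm_add_real_smul_sq [InnerProductSpace ℂ E] {a b : E}
    (hab : RCLike.re (inner ℂ a b) = 0) (h : ℝ) : ‖a + h • b‖ ^ 2 = ‖a‖ ^ 2 + h ^ 2 * ‖b‖ ^ 2 := by
  have re_inner : RCLike.re (inner ℂ a (h • b)) = 0 := by
    rw [← Complex.coe_smul, inner_smul_right, ← RCLike.ofReal_eq_complex_ofReal,
      RCLike.re_ofReal_mul, hab, mul_zero]
  rw [norm_add_sq (𝕜 := ℂ), re_inner, norm_smul, mul_pow, Real.norm_eq_abs, sq_abs]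
  ring

theorem hasDerivAt_norm_add_sub_smul [InnerProductSpace ℂ E] {a b : E}
    (hab : RCLike.re (inner ℂ a b) = 0) (hb : a = 0 → b = 0) (t : ℝ) :
    HasDerivAt (fun z : ℝ ↦ ‖a + (z - t) • b‖) 0 t := by
  by_cases ha : a = 0
  · simp only [ha, hb ha, smul_zero, add_zero, norm_zero]
    exact hasDerivAt_const t 0
  have norm_eq_sqrt : (fun z : ℝ ↦ ‖a + (z - t) • b‖)
      = fun z ↦ √(‖a‖ ^ 2 + (z - t) ^ 2 * ‖b‖ ^ 2) := by
    ext1 z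
    rw [← norm_add_real_smul_sq hab, Real.sqrt_sq (norm_nonneg _)]
  have sq_deriv : HasDerivAt (fun z : ℝ ↦ ‖a‖ ^ 2 + (z - t) ^ 2 * ‖b‖ ^ 2) 0 t := by
    simpa using ((((hasDerivAt_id t).sub_const t).pow 2).mul_const (‖b‖ ^ 2)).const_add (‖a‖ ^ 2)
  rw [norm_eq_sqrt]
  simpa using sq_deriv.sqrt (by simpa using ha)

theorem tendsto_slope_wreal_of_orthogonal [InnerProductSpace ℂ E] {w : Space d → ℝ≥0}
    (hw : Measurable w) {N : ℝ≥0} (hN : ∀ k, w k ≤ N) (f β : L1 d E) (t : ℝ)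
    (horth : ∀ᵐ k, RCLike.re (inner ℂ (f k) (β k)) = 0) (hβ : ∀ᵐ k, f k = 0 → β k = 0) :
    Tendsto (fun z : ℝ ↦ (z - t)⁻¹ * (wreal w (f + (z - t) • β : L1 d E) - wreal w f))
      (𝓝[>] t) (𝓝 0) := by
  have slope_eq_integral (z : ℝ) :
      (z - t)⁻¹ * (wreal w (f + (z - t) • β : L1 d E) - wreal w f)
        = ∫ k, (w k : ℝ) * ((z - t)⁻¹ * (‖f k + (z - t) • β k‖ - ‖f k‖)) := by
    simp only [wreal_eq_integral hw]
    rw [← integral_sub (integrable_weight_mul_norm hw hN _) (integrable_weight_mul_norm hw hN _),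
      ← integral_const_mul]
    apply integral_congr_ae
    filter_upwards [Lp.coeFn_add f ((z - t) • β), Lp.coeFn_smul (z - t) β] with k hk hk'
    rw [hk, Pi.add_apply, hk', Pi.smul_apply]
    ring
  simp only [slope_eq_integral]
  rw [← integral_zero (Space d) ℝ]
  apply tendsto_integral_filter_of_dominated_convergence (fun k ↦ (w k : ℝ) * ‖β k‖)
  · refine Eventually.of_forall fun z ↦ ?_
    have f_meas := (L1.integrable_coeFn f).1
    have β_meas := (L1.integrable_coeFn β).1
    exact hw.coe_nnreal_real.aestronglyMeasurable.mul
      (((f_meas.add (β_meas.const_smul (z - t))).norm.sub f_meas.norm).const_mul _)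
  · filter_upwards [self_mem_nhdsWithin] with z hz
    have z_sub_pos : 0 < z - t := sub_pos.mpr hz
    refine ae_of_all _ fun k ↦ ?_
    rw [norm_mul, Real.norm_of_nonneg NNReal.zero_le_coe]
    refine mul_le_mul_of_nonneg_left ?_ NNReal.zero_le_coe
    rw [norm_mul, norm_inv, Real.norm_of_nonneg z_sub_pos.le, inv_mul_le_iff₀ z_sub_pos,
      Real.norm_eq_abs]
    refine (abs_norm_sub_norm_le _ _).trans ?_
    rw [add_sub_cancel_left, norm_smul, Real.norm_of_nonneg z_sub_pos.le]
  · exact integrable_weight_mul_norm hw hN β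
  · filter_upwards [horth, hβ] with k hk hk'
    have norm_slope := hasDerivWithinAt_iff_tendsto_slope.mp
      ((hasDerivAt_norm_add_sub_smul hk hk' t).hasDerivWithinAt (s := Ici t))
    rw [Ici_sdiff_left] at norm_slope
    simpa [slope_def_field, div_eq_inv_mul] using norm_slope.const_mul (w k : ℝ)

theorem wreal_add_smul_add_smul_le [NormedSpace ℝ E] {w : Space d → ℝ≥0} (hw : Measurable w)
    {N : ℝ≥0} (hN : ∀ k, w k ≤ N) {h : ℝ} (hh : 0 ≤ h) (f g e : L1 d E) :
    wreal w (f + (h • g + h • e) : L1 d E) ≤ wreal w f + h * (wreal w g + N * ‖e‖) := by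
  refine (wreal_add_le hw hN _ _).trans ?_
  rw [mul_add, ← wreal_smul hw hh g]
  refine add_le_add_right ((wreal_add_le hw hN _ _).trans ?_) _
  rw [wreal_smul hw hh e]
  gcongr
  exact wreal_le_norm hw hN e

theorem rightSlopeLE_wreal [InnerProductSpace ℂ E] {w : Space d → ℝ≥0} (hw : Measurable w)
    {N : ℝ≥0} (hN : ∀ k, w k ≤ N) {f : ℝ → L1 d E} {β g : L1 d E} {t : ℝ}
    (hf : HasDerivWithinAt f (β + g) (Ici t) t)
    (horth : ∀ᵐ k, RCLike.re (inner ℂ (f t k) (β k)) = 0)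
    (hβ : ∀ᵐ k, f t k = 0 → β k = 0) :
    RightSlopeLE (fun s ↦ wreal w (f s)) (wreal w g) t := by
  have f_slope := hasDerivWithinAt_iff_tendsto_slope.mp hf
  rw [Ici_sdiff_left] at f_slope
  have remainder_tendsto :
      Tendsto (fun z ↦ (N : ℝ) * ‖slope f t z - (β + g)‖) (𝓝[>] t) (𝓝 0) := by
    simpa using ((f_slope.sub_const (β + g)).norm).const_mul (N : ℝ)
  have bound_tendsto := ((tendsto_slope_wreal_of_orthogonal hw hN (f t) β t horth hβ).add
    remainder_tendsto).add_const (wreal w g)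
  rw [add_zero, zero_add] at bound_tendsto
  intro r hr
  filter_upwards [bound_tendsto.eventually (gt_mem_nhds hr), self_mem_nhdsWithin] with z lt_r hz
  have z_sub_pos : 0 < z - t := sub_pos.mpr hz
  refine lt_of_le_of_lt ?_ lt_r
  have decomposition :
      f z = (f t + (z - t) • β) + ((z - t) • g + (z - t) • (slope f t z - (β + g))) := by
    rw [slope_def_module, smul_sub, smul_smul, mul_inv_cancel₀ z_sub_pos.ne']
    module
  have wreal_le := wreal_add_smul_add_smul_le hw hN z_sub_pos.le (f t + (z - t) • β) g
    (slope f t z - (β + g))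
  rw [← decomposition] at wreal_le
  rw [inv_mul_le_iff₀ z_sub_pos, mul_add, mul_add, mul_inv_cancel_left₀ z_sub_pos.ne']
  linarith

theorem integrable_clm_apply {F : Type*} [NormedAddCommGroup F] [NormedSpace ℂ E]
    [NormedSpace ℂ F] {m : Space d → E →L[ℂ] F} (hm : AEStronglyMeasurable m) {C : ℝ}
    (hC : ∀ k, ‖m k‖ ≤ C) (f : L1 d E) : Integrable fun k ↦ m k (f k) := by
  have eval_cont : Continuous fun q : (E →L[ℂ] F) × E ↦ q.1 q.2 := by fun_prop
  exact ((L1.integrable_coeFn f).norm.const_mul C).mono'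
    (eval_cont.comp_aestronglyMeasurable (hm.prodMk (L1.integrable_coeFn f).1))
    (ae_of_all _ fun k ↦ (m k).le_of_opNorm_le (hC k) _)

theorem exists_mulOp {F : Type*} [NormedAddCommGroup F] [NormedSpace ℂ E] [NormedSpace ℂ F]
    {m : Space d → E →L[ℂ] F} (hm : AEStronglyMeasurable m) {C : ℝ} (hC : ∀ k, ‖m k‖ ≤ C) :
    ∃ Q : L1 d E →L[ℝ] L1 d F, ∀ f : L1 d E, Q f =ᵐ[volume] fun k ↦ m k (f k) := by
  have int_mul := integrable_clm_apply hm hC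
  refine ⟨LinearMap.mkContinuous
    { toFun := fun f ↦ (int_mul f).toL1
      map_add' := fun f g ↦ by
        rw [← Integrable.toL1_add, Integrable.toL1_eq_toL1_iff]
        filter_upwards [Lp.coeFn_add f g] with k hk
        rw [hk, Pi.add_apply, map_add, Pi.add_apply]
      map_smul' := fun c f ↦ by
        rw [RingHom.id_apply, ← Integrable.toL1_smul, Integrable.toL1_eq_toL1_iff]
        filter_upwards [Lp.coeFn_smul c f] with k hk
        rw [hk, Pi.smul_apply, ContinuousLinearMap.map_smul_of_tower] } C ?_,
    fun f ↦ Integrable.coeFn_toL1 (int_mul f)⟩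
  intro f
  change ‖(int_mul f).toL1‖ ≤ _
  rw [L1.norm_eq_integral_norm, L1.norm_eq_integral_norm, ← integral_const_mul]
  refine integral_mono_ae (L1.integrable_coeFn _).norm ((L1.integrable_coeFn f).norm.const_mul C) ?_
  filter_upwards [Integrable.coeFn_toL1 (int_mul f)] with k hk
  rw [hk]
  exact (m k).le_of_opNorm_le (hC k) _

end WeightedSlope

section MultiIndex

variable {d n : ℕ}

theorem foldr_pderiv_single (l : Fin d) (s : ℕ) (f : Space d → Vec n) (L : List (Fin d))
    (hL : L.Nodup) :
    L.foldr (fun m g ↦ (pderiv m)^[(Pi.single l s : Fin d → ℕ) m] g) f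
      = if l ∈ L then (pderiv l)^[s] f else f := by
  induction L with
  | nil => simp
  | cons m L ih =>
    rw [List.nodup_cons] at hL
    rw [List.foldr_cons, ih hL.2]
    by_cases h : m = l
    · subst h
      simp [hL.1]
    · simp [Ne.symm h]

theorem mderiv_single (l : Fin d) (s : ℕ) (f : Space d → Vec n) :
    mderiv (Pi.single l s) f = (pderiv l)^[s] f := by
  unfold mderiv
  rw [foldr_pderiv_single l s f _ (List.nodup_finRange d), if_pos (List.mem_finRange l)]

theorem mderiv_zero (f : Space d → Vec n) : mderiv 0 f = f := by
  unfold mderiv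
  induction List.finRange d with
  | nil => rfl
  | cons m L ih => rw [List.foldr_cons, ih]; rfl

theorem MemWs.memW {s : ℕ} {f : Space d → Vec n} (h : MemWs s f) : MemW f := by
  simpa [mderiv_zero] using h.2 0 (by simp)

theorem MemWs.memW_iterate_pderiv {s m : ℕ} {f : Space d → Vec n} (h : MemWs s f) (hm : m ≤ s)
    (l : Fin d) : MemW ((pderiv l)^[m] f) := by
  rw [← mderiv_single]
  exact h.2 _ (by simpa [Finset.sum_pi_single] using hm)

theorem MemWs.memW_pderiv {f : Space d → Vec n} (h : MemWs 1 f) (l : Fin d) :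
    MemW (pderiv l f) :=
  h.memW_iterate_pderiv (m := 1) le_rfl l

end MultiIndex

section PointwiseMaps

variable {d n : ℕ}

/-- The inverse Fourier transform at a point as a bounded linear map on `L¹`. -/
def invFourierL (x : Space d) : L1 d (Vec n) →L[ℝ] Vec n :=
  LinearMap.mkContinuous
    { toFun := fun f ↦ invFourier f x
      map_add' := fun f g ↦ by
        rw [← invFourier_add (L1.integrable_coeFn f) (L1.integrable_coeFn g)]
        exact invFourier_congr_ae (Lp.coeFn_add f g) x
      map_smul' := fun c f ↦ by
        rw [RingHom.id_apply, ← Complex.coe_smul c (invFourier f x)]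
        refine Eq.trans (invFourier_congr_ae ?_ x)
          (invFourier_clm_comp ((c : ℂ) • ContinuousLinearMap.id ℂ (Vec n))
            (L1.integrable_coeFn f) x)
        filter_upwards [Lp.coeFn_smul c f] with k hk
        rw [hk, Pi.smul_apply, ← Complex.coe_smul]
        rfl }
    (fourierConst d) (fun f ↦ by
      rw [L1.norm_eq_integral_norm]
      exact norm_invFourier_le f x)

theorem invFourierL_apply (x : Space d) (f : L1 d (Vec n)) :
    invFourierL x f = invFourier f x := rfl

theorem eq_of_invFourierL_eq {f g : L1 d (Vec n)} (h : ∀ x, invFourierL x f = invFourierL x g) :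
    f = g :=
  Lp.ext (ae_eq_of_invFourier_eq (L1.integrable_coeFn f) (L1.integrable_coeFn g) h)

theorem invFourierL_hatL1 {f : Space d → Vec n} (h : MemW f) (x : Space d) :
    invFourierL x (hatL1 f) = f x := by
  rw [invFourierL_apply, invFourier_congr_ae (coeFn_hatL1 f), h.eq_invFourier]

/-- The pointwise action of a linear map on `L¹`. -/
def mapL (B : Vec n →L[ℂ] Vec n) : L1 d (Vec n) →L[ℝ] L1 d (Vec n) :=
  (B.restrictScalars ℝ).compLpL 1 volume

theorem coeFn_mapL (B : Vec n →L[ℂ] Vec n) (f : L1 d (Vec n)) :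
    mapL B f =ᵐ[volume] fun k ↦ B (f k) :=
  (B.restrictScalars ℝ).coeFn_compLpL f

theorem invFourierL_mapL (B : Vec n →L[ℂ] Vec n) (f : L1 d (Vec n)) (x : Space d) :
    invFourierL x (mapL B f) = B (invFourierL x f) := by
  rw [invFourierL_apply, invFourierL_apply, invFourier_congr_ae (coeFn_mapL B f),
    invFourier_clm_comp B (L1.integrable_coeFn f)]

/-- The action of complex conjugation on the Fourier side, `f ↦ conj f(-·)`. -/
def conjRefl : L1 d (Vec n) →L[ℝ] L1 d (Vec n) :=
  ((conjLI n).toContinuousLinearMap.compLpL 1 volume).comp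
    (Lp.compMeasurePreservingₗᵢ ℝ (fun k : Space d ↦ -k)
      (Measure.measurePreserving_neg volume)).toContinuousLinearMap

theorem coeFn_conjRefl (f : L1 d (Vec n)) :
    conjRefl f =ᵐ[volume] fun k ↦ conjVec (f (-k)) := by
  have neg_mp := Measure.measurePreserving_neg (volume : Measure (Space d))
  filter_upwards [(conjLI n).toContinuousLinearMap.coeFn_compLpL
      (Lp.compMeasurePreserving (fun k : Space d ↦ -k) neg_mp f),
    Lp.coeFn_compMeasurePreserving f neg_mp] with k h_conj h_refl
  exact h_conj.trans (congrArg conjVec h_refl)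

theorem wnorm_conjRefl {w : Space d → ℝ≥0} (hw : ∀ k, w (-k) = w k) (f : L1 d (Vec n)) :
    wnorm w (conjRefl f) = wnorm w f := by
  rw [wnorm_congr_ae (g := fun k ↦ f (-k))
    ((coeFn_conjRefl f).mono fun k hk ↦ by rw [hk, norm_conjVec])]
  unfold wnorm
  rw [← lintegral_neg_eq_self (fun k ↦ (w k : ℝ≥0∞) * ‖f k‖ₑ)]
  simp only [hw]

theorem MemW.isFourier {f : Space d → Vec n} (h : MemW f) : IsFourier f (hat f) :=
  ⟨integrable_hat f, h.eq_invFourier⟩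

theorem hatL1_conj {f g : Space d → Vec n} (hf : MemW f) (h : ∀ x, g x = conjVec (f x)) :
    hatL1 g = conjRefl (hatL1 f) := by
  obtain rfl : g = fun x ↦ conjVec (f x) := funext h
  apply Lp.ext
  have neg_qmp :=
    (Measure.measurePreserving_neg (volume : Measure (Space d))).quasiMeasurePreserving
  filter_upwards [coeFn_hatL1 fun x ↦ conjVec (f x), coeFn_conjRefl (hatL1 f),
    neg_qmp.ae (coeFn_hatL1 f), hf.isFourier.conj.hat_ae_eq] with k h_left h_right h_neg h_conj
  rw [h_left, h_conj, h_right, h_neg]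

end PointwiseMaps

section Symbol

variable {d n : ℕ} (A : Fin d → Matrix (Fin n) (Fin n) ℝ) (Em : Matrix (Fin n) (Fin n) ℝ)

/-- The complex linear map defined by a real matrix. -/
def matL (M : Matrix (Fin n) (Fin n) ℝ) : Vec n →L[ℂ] Vec n :=
  LinearMap.toContinuousLinearMap (Matrix.toEuclideanLin (M.map Complex.ofReal))

/-- The matrix `L(α, β)` as a bounded linear map. -/
def symL (α : ℝ) (β : Space d) : Vec n →L[ℂ] Vec n :=
  LinearMap.toContinuousLinearMap (Matrix.toEuclideanLin (symbolL A Em α β))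

theorem symL_apply (α : ℝ) (β : Space d) (v : Vec n) :
    symL A Em α β v = Matrix.toEuclideanLin (symbolL A Em α β) v := rfl

theorem symL_add (α : ℝ) (β θ : Space d) (v : Vec n) :
    symL A Em α (β + θ) v = symL A Em α β v + ∑ l, ((θ l : ℝ) : ℂ) • matL (A l) v := by
  have symbol_add : symbolL A Em α (β + θ) = symbolL A Em α β
      + ∑ l, ((θ l : ℝ) : ℂ) • (A l).map Complex.ofReal := by
    unfold symbolL
    simp only [PiLp.add_apply, Complex.ofReal_add, add_smul, Finset.sum_add_distrib]
    abel
  rw [symL_apply, symL_apply, symbol_add, map_add, LinearMap.add_apply, map_sum,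
    LinearMap.sum_apply]
  simp only [map_smul, LinearMap.smul_apply]
  rfl

theorem symL_eq_sub_smul (α : ℝ) (β : Space d) (v : Vec n) :
    symL A Em α β v = symL A Em 0 β v - (α : ℂ) • v := by
  have symbol_eq : symbolL A Em α β = symbolL A Em 0 β - (α : ℂ) • 1 := by
    unfold symbolL
    simp only [Complex.ofReal_zero, neg_zero, zero_smul, zero_add, neg_smul]
    abel
  rw [symL_apply, symL_apply, symbol_eq, map_sub, LinearMap.sub_apply, map_smul,
    LinearMap.smul_apply, Matrix.toLpLin_one]
  rfl

end Symbol

section Evolution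

variable {d n : ℕ} {A : Fin d → Matrix (Fin n) (Fin n) ℝ} {Em : Matrix (Fin n) (Fin n) ℝ}
  (T : (Fin n → ℝ) →ₗ[ℝ] (Fin n → ℝ) →ₗ[ℝ] (Fin n → ℝ) →ₗ[ℝ] (Fin n → ℝ))

/-- The complex trilinear extension `triExt T` as a bounded trilinear map. -/
def triL : Vec n →L[ℂ] Vec n →L[ℂ] Vec n →L[ℂ] Vec n :=
  ∑ p, ∑ q, ∑ r, (EuclideanSpace.proj (𝕜 := ℂ) p).smulRight
    ((EuclideanSpace.proj (𝕜 := ℂ) q).smulRight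
      ((EuclideanSpace.proj (𝕜 := ℂ) r).smulRight (WithLp.toLp 2 (fun i ↦
        ((T (Pi.single p 1) (Pi.single q 1) (Pi.single r 1) i : ℝ) : ℂ)) : Vec n)))

theorem triL_apply (a b c : Vec n) : triL T a b c = triExt T a b c := by
  unfold triL triExt
  simp only [sum_apply, ContinuousLinearMap.smulRight_apply, smul_apply, smul_smul]
  rfl

/-- The Fourier transform of the nonlinearity; the power of `fourierConst d` turns the pointwise
product of three functions into the convolution of their unitary Fourier transforms. -/
def nonlin (j : ℤ) (a : ℤ → L1 d (Vec n)) : L1 d (Vec n) :=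
  fourierConst d ^ 2 • ∑ J ∈ triples j, conv3 (triL T) (a J.1) (a J.2.1) (a J.2.2)

variable (A Em) in
/-- The evolution of the Fourier transforms `a_j = û_j` in `L¹`. The linear part `β` of the time
derivative is an element of `L¹` although the multiplier defining it is unbounded. -/
structure Evolution (ω : ℝ) (κ : Space d) (ε τ : ℝ) (a : ℤ → ℝ → L1 d (Vec n)) : Prop where
  conj : ∀ j ∈ ({1, 3} : Finset ℤ), ∀ t ∈ Icc 0 τ, a (-j) t = conjRefl (a j t)
  deriv : ∀ j ∈ ({1, 3} : Finset ℤ), ∀ t ∈ Icc 0 τ, ∃ β : L1 d (Vec n),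
    (∀ᵐ k, β k = -((Complex.I / (ε : ℂ)) •
      symL A Em ((j : ℝ) * ω) ((j : ℝ) • κ + ε • k) (a j t k))) ∧
    HasDerivWithinAt (a j) (β + ε • nonlin T j fun i ↦ a i t) (Icc 0 τ) t

theorem mem_harmonics_of_mem_triples {j : ℤ} {J : ℤ × ℤ × ℤ} (h : J ∈ triples j) :
    J.1 ∈ harmonics ∧ J.2.1 ∈ harmonics ∧ J.2.2 ∈ harmonics := by
  simpa [triples, and_assoc] using (Finset.mem_filter.mp h).1

theorem subset_harmonics : ({1, 3} : Finset ℤ) ⊆ harmonics := by decide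

theorem eq_or_eq_neg_of_mem_harmonics {j : ℤ} (h : j ∈ harmonics) :
    ∃ i ∈ ({1, 3} : Finset ℤ), j = i ∨ j = -i := by
  revert j
  decide

theorem invFourierL_nonlin (j : ℤ) (a : ℤ → L1 d (Vec n)) (x : Space d) :
    invFourierL x (nonlin T j a) = ∑ J ∈ triples j,
      triExt T (invFourierL x (a J.1)) (invFourierL x (a J.2.1)) (invFourierL x (a J.2.2)) := by
  unfold nonlin
  rw [map_smul, map_sum, Finset.smul_sum]
  refine Finset.sum_congr rfl fun J _ ↦ ?_
  simp only [← triL_apply, invFourierL_apply, invFourier_conv3]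

theorem continuousOn_nonlin (j : ℤ) {a : ℤ → ℝ → L1 d (Vec n)} {s : Set ℝ}
    (h : ∀ i ∈ harmonics, ContinuousOn (a i) s) :
    ContinuousOn (fun t ↦ nonlin T j fun i ↦ a i t) s := by
  refine (continuousOn_finsetSum _ fun J hJ ↦ ?_).const_smul (fourierConst d ^ 2)
  obtain ⟨h₁, h₂, h₃⟩ := mem_harmonics_of_mem_triples hJ
  exact continuousOn_conv3 _ (h _ h₁) (h _ h₂) (h _ h₃)

variable (A Em) in
/-- The Fourier transform of `-(i/ε) L(α, β) f - A(∂) f`, formed from those of `f` and of its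
partial derivatives. -/
def linPart (α ε : ℝ) (β : Space d) (f : Space d → Vec n) : L1 d (Vec n) :=
  mapL (-(Complex.I / (ε : ℂ)) • symL A Em α β) (hatL1 f)
    - ∑ l, mapL (matL (A l)) (hatL1 (pderiv l f))

theorem hatL1_pderiv {f : Space d → Vec n} (hf : MemWs 1 f) (l : Fin d) :
    hatL1 (pderiv l f) =ᵐ[volume] fun k ↦ (Complex.I * ((k l : ℝ) : ℂ)) • hatL1 f k := by
  filter_upwards [coeFn_hatL1 (pderiv l f), coeFn_hatL1 f,
    hat_pderiv (by simpa using hf.1) hf.memW l (hf.memW_pderiv l)] with k h_pderiv h_f h_hat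
  rw [h_pderiv, h_f, h_hat]

theorem coeFn_linPart (α : ℝ) {ε : ℝ} (hε : ε ≠ 0) (β : Space d) {f : Space d → Vec n}
    (hf : MemWs 1 f) :
    ∀ᵐ k, linPart A Em α ε β f k
      = -((Complex.I / (ε : ℂ)) • symL A Em α (β + ε • k) (hatL1 f k)) := by
  have ε_ne : (ε : ℂ) ≠ 0 := Complex.ofReal_ne_zero.mpr hε
  filter_upwards [ae_all_iff.mpr fun l ↦ hatL1_pderiv hf l,
    ae_all_iff.mpr fun l ↦ coeFn_mapL (matL (A l)) (hatL1 (pderiv l f)),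
    Lp.coeFn_sub (mapL (-(Complex.I / (ε : ℂ)) • symL A Em α β) (hatL1 f))
      (∑ l, mapL (matL (A l)) (hatL1 (pderiv l f))),
    coeFn_mapL (-(Complex.I / (ε : ℂ)) • symL A Em α β) (hatL1 f),
    Lp.coeFn_finsetSum Finset.univ fun l ↦ mapL (matL (A l)) (hatL1 (pderiv l f))]
    with k h_pderiv h_mat h_sub h_sym h_sum
  unfold linPart
  rw [h_sub, Pi.sub_apply, h_sym, h_sum, Finset.sum_apply, symL_add, smul_apply, smul_add,
    neg_smul, neg_add, sub_eq_add_neg, Finset.smul_sum]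
  congr 2
  refine Finset.sum_congr rfl fun l _ ↦ ?_
  rw [h_mat, h_pderiv, map_smul, PiLp.smul_apply, smul_smul]
  congr 1
  push_cast [smul_eq_mul]
  field_simp

namespace IsClassicalSolution

variable {T} {ω : ℝ} {κ : Space d} {ε τ : ℝ} {p : Space d → Vec n} {u : ℤ → ℝ → Space d → Vec n}

theorem memW (hu : IsClassicalSolution A Em T ω κ ε τ p u) {i : ℤ} (hi : i ∈ harmonics) {t : ℝ}
    (ht : t ∈ Icc 0 τ) : MemW (u i t) := by
  obtain ⟨j, hj, rfl | rfl⟩ := eq_or_eq_neg_of_mem_harmonics hi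
  · exact (hu.memW1 _ hj t ht).memW
  · rw [show u (-j) t = fun x ↦ conjVec (u j t x) from funext (hu.conj j hj t ht)]
    exact ⟨_, (hu.memW1 j hj t ht).memW.isFourier.conj⟩

theorem hatL1_neg (hu : IsClassicalSolution A Em T ω κ ε τ p u) {j : ℤ}
    (hj : j ∈ ({1, 3} : Finset ℤ)) {t : ℝ} (ht : t ∈ Icc 0 τ) :
    hatL1 (u (-j) t) = conjRefl (hatL1 (u j t)) :=
  hatL1_conj (hu.memW1 j hj t ht).memW (hu.conj j hj t ht)

theorem continuousOn_hatL1 (hu : IsClassicalSolution A Em T ω κ ε τ p u) {i : ℤ}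
    (hi : i ∈ harmonics) : ContinuousOn (fun t ↦ hatL1 (u i t)) (Icc 0 τ) := by
  obtain ⟨j, hj, rfl | rfl⟩ := eq_or_eq_neg_of_mem_harmonics hi
  · exact (hu.contDiff_W _ hj).continuousOn
  · exact (conjRefl.continuous.comp_continuousOn (hu.contDiff_W j hj).continuousOn).congr
      fun t ht ↦ hu.hatL1_neg hj ht

theorem continuousOn_hatL1_pderiv (hu : IsClassicalSolution A Em T ω κ ε τ p u) {j : ℤ}
    (hj : j ∈ ({1, 3} : Finset ℤ)) (l : Fin d) :
    ContinuousOn (fun t ↦ hatL1 (pderiv l (u j t))) (Icc 0 τ) := by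
  simpa only [mderiv_single, Function.iterate_one] using
    hu.continuous_W1 j hj (Pi.single l 1) (by simp)

theorem continuousOn_rhs (hu : IsClassicalSolution A Em T ω κ ε τ p u) {j : ℤ}
    (hj : j ∈ ({1, 3} : Finset ℤ)) :
    ContinuousOn (fun t ↦ linPart A Em ((j : ℝ) * ω) ε ((j : ℝ) • κ) (u j t)
      + ε • nonlin T j fun i ↦ hatL1 (u i t)) (Icc 0 τ) := by
  refine ContinuousOn.add (ContinuousOn.sub ?_ ?_) ?_
  · exact (mapL _).continuous.comp_continuousOn (hu.continuousOn_hatL1 (subset_harmonics hj))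
  · exact continuousOn_finsetSum _ fun l _ ↦
      (mapL _).continuous.comp_continuousOn (hu.continuousOn_hatL1_pderiv hj l)
  · exact (continuousOn_nonlin T j fun i hi ↦ hu.continuousOn_hatL1 hi).const_smul ε

theorem hasDerivWithinAt_hatL1 (hu : IsClassicalSolution A Em T ω κ ε τ p u) {j : ℤ}
    (hj : j ∈ ({1, 3} : Finset ℤ)) {t : ℝ} (ht : t ∈ Icc 0 τ) :
    HasDerivWithinAt (fun t ↦ hatL1 (u j t))
      (derivWithin (fun t ↦ hatL1 (u j t)) (Icc 0 τ) t) (Icc 0 τ) t :=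
  (((hu.contDiff_W j hj).differentiableOn one_ne_zero) t ht).hasDerivWithinAt

theorem invFourierL_rhs (hu : IsClassicalSolution A Em T ω κ ε τ p u) {j : ℤ}
    (hj : j ∈ ({1, 3} : Finset ℤ)) {t : ℝ} (ht : t ∈ Icc 0 τ) (x : Space d) :
    invFourierL x (linPart A Em ((j : ℝ) * ω) ε ((j : ℝ) • κ) (u j t)
        + ε • nonlin T j fun i ↦ hatL1 (u i t))
      = -((Complex.I / (ε : ℂ)) •
          Matrix.toEuclideanLin (symbolL A Em ((j : ℝ) * ω) ((j : ℝ) • κ)) (u j t x))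
        - ∑ l, Matrix.toEuclideanLin ((A l).map Complex.ofReal) (pderiv l (u j t) x)
        + (ε : ℂ) • ∑ J ∈ triples j, triExt T (u J.1 t x) (u J.2.1 t x) (u J.2.2 t x) := by
  have nonlin_eq : invFourierL x (nonlin T j fun i ↦ hatL1 (u i t))
      = ∑ J ∈ triples j, triExt T (u J.1 t x) (u J.2.1 t x) (u J.2.2 t x) := by
    rw [invFourierL_nonlin]
    refine Finset.sum_congr rfl fun J hJ ↦ ?_
    obtain ⟨h₁, h₂, h₃⟩ := mem_harmonics_of_mem_triples hJ
    rw [invFourierL_hatL1 (hu.memW h₁ ht), invFourierL_hatL1 (hu.memW h₂ ht),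
      invFourierL_hatL1 (hu.memW h₃ ht)]
  simp only [linPart, map_add, map_sub, map_sum, map_smul, invFourierL_mapL, nonlin_eq,
    invFourierL_hatL1 (hu.memW (subset_harmonics hj) ht),
    invFourierL_hatL1 ((hu.memW1 j hj t ht).memW_pderiv _)]
  rw [smul_apply, neg_smul, Complex.coe_smul]
  rfl

-- The equation is known for `t > 0` and pointwise in `x`; it extends to `t = 0` because both sides
-- are continuous with values in `L¹`.
theorem derivWithin_hatL1 (hτ : 0 < τ) (hu : IsClassicalSolution A Em T ω κ ε τ p u) {j : ℤ}
    (hj : j ∈ ({1, 3} : Finset ℤ)) :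
    EqOn (derivWithin (fun t ↦ hatL1 (u j t)) (Icc 0 τ))
      (fun t ↦ linPart A Em ((j : ℝ) * ω) ε ((j : ℝ) • κ) (u j t)
        + ε • nonlin T j fun i ↦ hatL1 (u i t)) (Icc 0 τ) := by
  have unique_diff : UniqueDiffOn ℝ (Icc 0 τ) := uniqueDiffOn_Icc hτ
  have hat_inv {s : ℝ} (hs : s ∈ Icc 0 τ) (x : Space d) : u j s x = invFourierL x (hatL1 (u j s)) :=
    (invFourierL_hatL1 (hu.memW (subset_harmonics hj) hs) x).symm
  refine EqOn.of_subset_closure (s := Ioc 0 τ) (fun t ht ↦ ?_)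
    ((hu.contDiff_W j hj).continuousOn_derivWithin unique_diff le_rfl) (hu.continuousOn_rhs hj)
    Ioc_subset_Icc_self (closure_Ioc hτ.ne).ge
  have ht' : t ∈ Icc 0 τ := Ioc_subset_Icc_self ht
  refine eq_of_invFourierL_eq fun x ↦ ?_
  have pointwise_deriv : HasDerivWithinAt (fun s ↦ u j s x) _ (Icc 0 τ) t :=
    ((invFourierL x).hasFDerivAt.comp_hasDerivWithinAt t (hu.hasDerivWithinAt_hatL1 hj ht')).congr
      (fun s hs ↦ hat_inv hs x) (hat_inv ht' x)
  rw [hu.invFourierL_rhs hj ht',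
    ← (unique_diff t ht').eq_deriv _ pointwise_deriv (hu.pde j hj t ht x)]

theorem evolution (hε : ε ≠ 0) (hτ : 0 < τ) (hu : IsClassicalSolution A Em T ω κ ε τ p u) :
    Evolution A Em T ω κ ε τ fun j t ↦ hatL1 (u j t) where
  conj j hj t ht := hu.hatL1_neg hj ht
  deriv j hj t ht := by
    exact ⟨linPart A Em ((j : ℝ) * ω) ε ((j : ℝ) • κ) (u j t),
      coeFn_linPart _ hε _ (hu.memW1 j hj t ht),
      (hu.hasDerivWithinAt_hatL1 hj ht).congr_deriv (hu.derivWithin_hatL1 hτ hj ht)⟩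

end IsClassicalSolution

end Evolution

section WeightedL1

variable {d : ℕ} {E : Type*} [NormedAddCommGroup E]

theorem wnorm_coe_add_le {w : Space d → ℝ≥0} (hw : Measurable w) (f g : L1 d E) :
    wnorm w (f + g : L1 d E) ≤ wnorm w f + wnorm w g := by
  rw [wnorm_congr_ae ((Lp.coeFn_add f g).mono fun k hk ↦ by rw [hk])]
  exact wnorm_add_le hw (L1.integrable_coeFn f).1 _

theorem wnorm_coe_sum_le {ι : Type*} (s : Finset ι) {w : Space d → ℝ≥0} (hw : Measurable w)
    (f : ι → L1 d E) : wnorm w (∑ i ∈ s, f i : L1 d E) ≤ ∑ i ∈ s, wnorm w (f i) := by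
  rw [wnorm_congr_ae ((Lp.coeFn_finsetSum s f).mono fun k hk ↦ by rw [hk, Finset.sum_apply])]
  exact wnorm_sum_le s hw fun i _ ↦ (L1.integrable_coeFn (f i)).1

theorem wnorm_coe_smul_le {𝕜 : Type*} [NormedRing 𝕜] [Module 𝕜 E] [IsBoundedSMul 𝕜 E]
    (w : Space d → ℝ≥0) (c : 𝕜) (f : L1 d E) :
    wnorm w (c • f : L1 d E) ≤ ENNReal.ofReal ‖c‖ * wnorm w f := by
  have pointwise_le : ∀ᵐ k, (w k : ℝ) * ‖(c • f : L1 d E) k‖ ≤ ‖c‖₊ * (w k * ‖f k‖) := by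
    filter_upwards [Lp.coeFn_smul c f] with k hk
    rw [hk, Pi.smul_apply, coe_nnnorm, mul_left_comm]
    exact mul_le_mul_of_nonneg_left (norm_smul_le _ _) NNReal.zero_le_coe
  simpa only [← ENNReal.ofReal_coe_nnreal, coe_nnnorm] using wnorm_le_of_ae ‖c‖₊ pointwise_le

theorem wreal_zero {w : Space d → ℝ≥0} (hw : Measurable w) : wreal w (0 : L1 d E) = 0 := by
  rw [wreal_eq_integral hw]
  apply integral_eq_zero_of_ae
  filter_upwards [Lp.coeFn_zero E 1 (volume : Measure (Space d))] with k hk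
  simp only [hk, Pi.zero_apply, norm_zero, mul_zero]

theorem wreal_le_of_wnorm_le {w : Space d → ℝ≥0} {f : Space d → E} {X : ℝ} (hX : 0 ≤ X)
    (h : wnorm w f ≤ ENNReal.ofReal X) : wreal w f ≤ X :=
  ENNReal.toReal_le_of_le_ofReal hX h

theorem wnorm_le_of_wreal_le {w : Space d → ℝ≥0} {N : ℝ≥0} (hN : ∀ k, w k ≤ N) {f : L1 d E}
    {X : ℝ} (h : wreal w f ≤ X) : wnorm w f ≤ ENNReal.ofReal X := by
  rw [← ofReal_wreal hN]
  exact ENNReal.ofReal_le_ofReal h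

end WeightedL1

section Nonlinearity

variable {d n : ℕ} (T : (Fin n → ℝ) →ₗ[ℝ] (Fin n → ℝ) →ₗ[ℝ] (Fin n → ℝ) →ₗ[ℝ] (Fin n → ℝ))

/-- The constant in the estimates of the nonlinearity; there are at most `64 = 4 ^ 3` triples. -/
def nonlinConst (d : ℕ) : ℝ := fourierConst d ^ 2 * 64 * ‖triL T‖

theorem nonlinConst_nonneg : 0 ≤ nonlinConst T d := by
  unfold nonlinConst; positivity

theorem card_triples_le (j : ℤ) : (triples j).card ≤ 64 :=
  (Finset.card_filter_le _ _).trans (by decide)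

theorem wnorm_smul_sum_triples_le {w : Space d → ℝ≥0} (hw : Measurable w) (j : ℤ)
    {f : ℤ × ℤ × ℤ → L1 d (Vec n)} {X : ℝ}
    (h : ∀ J ∈ triples j, wnorm w (f J) ≤ ‖triL T‖ₑ * ENNReal.ofReal X) :
    wnorm w (fourierConst d ^ 2 • ∑ J ∈ triples j, f J : L1 d (Vec n))
      ≤ ENNReal.ofReal (nonlinConst T d * X) := by
  have term_le (J) (hJ : J ∈ triples j) : wnorm w (f J) ≤ ENNReal.ofReal (‖triL T‖ * X) :=
    (h J hJ).trans_eq (by rw [← ofReal_norm, ENNReal.ofReal_mul (norm_nonneg _)])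
  have card_le : ((triples j).card : ℝ≥0∞) ≤ 64 := by exact_mod_cast card_triples_le j
  calc wnorm w (fourierConst d ^ 2 • ∑ J ∈ triples j, f J : L1 d (Vec n))
      ≤ ENNReal.ofReal (fourierConst d ^ 2) * ∑ J ∈ triples j, wnorm w (f J) := by
        refine (wnorm_coe_smul_le w _ _).trans ?_
        rw [Real.norm_of_nonneg (by positivity)]
        gcongr
        exact wnorm_coe_sum_le _ hw _
    _ ≤ ENNReal.ofReal (fourierConst d ^ 2) * (64 * ENNReal.ofReal (‖triL T‖ * X)) := by
        refine mul_le_mul_right ((Finset.sum_le_card_nsmul _ _ _ term_le).trans ?_) _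
        rw [nsmul_eq_mul]
        gcongr
    _ = ENNReal.ofReal (nonlinConst T d * X) := by
        rw [← ENNReal.ofReal_ofNat, ← ENNReal.ofReal_mul (by norm_num),
          ← ENNReal.ofReal_mul (by positivity), nonlinConst]
        ring_nf

theorem wnorm_nonlin_le_mul {w : Space d → ℝ≥0} (hw : Measurable w)
    (hmul : ∀ x y, w (x + y) ≤ w x * w y) (j : ℤ) {a : ℤ → L1 d (Vec n)} {B : ℝ} (hB : 0 ≤ B)
    (ha : ∀ i ∈ harmonics, wnorm w (a i) ≤ ENNReal.ofReal B) :
    wnorm w (nonlin T j a) ≤ ENNReal.ofReal (nonlinConst T d * B ^ 3) := by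
  refine wnorm_smul_sum_triples_le T hw j fun J hJ ↦ ?_
  obtain ⟨mem_fst, mem_snd, mem_thd⟩ := mem_harmonics_of_mem_triples hJ
  refine (wnorm_conv3_le_mul _ hw hmul _ _ _).trans ?_
  rw [ENNReal.ofReal_pow hB, pow_three']
  gcongr
  exacts [ha _ mem_fst, ha _ mem_snd, ha _ mem_thd]

theorem wnorm_nonlin_le_add {w : Space d → ℝ≥0} (hw : Measurable w) {K : ℝ≥0} (hK : 1 ≤ K)
    (hadd : ∀ x y, w (x + y) ≤ K * (w x + w y)) (j : ℤ) {a : ℤ → L1 d (Vec n)} {B X : ℝ}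
    (hB : 0 ≤ B) (ha : ∀ i ∈ harmonics, wnorm 1 (a i) ≤ ENNReal.ofReal B)
    (hwa : ∀ i ∈ harmonics, wnorm w (a i) ≤ ENNReal.ofReal X) :
    wnorm w (nonlin T j a) ≤ ENNReal.ofReal (nonlinConst T d * (K ^ 2 * (3 * B ^ 2 * X))) := by
  refine wnorm_smul_sum_triples_le T hw j fun J hJ ↦ ?_
  obtain ⟨mem_fst, mem_snd, mem_thd⟩ := mem_harmonics_of_mem_triples hJ
  have bound_eq : ENNReal.ofReal (K ^ 2 * (3 * B ^ 2 * X)) = (K : ℝ≥0∞) ^ 2 *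
      (ENNReal.ofReal X * ENNReal.ofReal B * ENNReal.ofReal B
        + ENNReal.ofReal B * ENNReal.ofReal X * ENNReal.ofReal B
        + ENNReal.ofReal B * ENNReal.ofReal B * ENNReal.ofReal X) := by
    rw [ENNReal.ofReal_mul (by positivity), ENNReal.ofReal_pow NNReal.zero_le_coe,
      ENNReal.ofReal_coe_nnreal, ENNReal.ofReal_mul (by positivity),
      ENNReal.ofReal_mul (by positivity), ENNReal.ofReal_pow hB, ENNReal.ofReal_ofNat]
    ring
  refine (wnorm_conv3_le_add _ hw hK hadd _ _ _).trans ?_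
  rw [bound_eq, mul_assoc]
  gcongr
  exacts [hwa _ mem_fst, ha _ mem_snd, ha _ mem_thd, ha _ mem_fst, hwa _ mem_snd, ha _ mem_thd,
    ha _ mem_fst, ha _ mem_snd, hwa _ mem_thd]

/-- The derivative of `nonlin T j` at `a` in the direction `a'`. -/
def nonlinDeriv (j : ℤ) (a a' : ℤ → L1 d (Vec n)) : L1 d (Vec n) :=
  fourierConst d ^ 2 • ∑ J ∈ triples j, (conv3 (triL T) (a J.1) (a J.2.1) (a' J.2.2)
    + (conv3 (triL T) (a J.1) (a' J.2.1) (a J.2.2) + conv3 (triL T) (a' J.1) (a J.2.1) (a J.2.2)))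

theorem hasDerivWithinAt_nonlin (j : ℤ) {a : ℤ → ℝ → L1 d (Vec n)} {a' : ℤ → L1 d (Vec n)}
    {s : Set ℝ} {t : ℝ} (h : ∀ i ∈ harmonics, HasDerivWithinAt (a i) (a' i) s t) :
    HasDerivWithinAt (fun x ↦ nonlin T j fun i ↦ a i x) (nonlinDeriv T j (fun i ↦ a i t) a')
      s t := by
  refine (HasDerivWithinAt.fun_sum fun J hJ ↦ ?_).const_smul (fourierConst d ^ 2)
  obtain ⟨mem_fst, mem_snd, mem_thd⟩ := mem_harmonics_of_mem_triples hJ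
  exact hasDerivWithinAt_conv3 _ (h _ mem_fst) (h _ mem_snd) (h _ mem_thd)

theorem wnorm_nonlinDeriv_le_mul {w : Space d → ℝ≥0} (hw : Measurable w)
    (hmul : ∀ x y, w (x + y) ≤ w x * w y) (j : ℤ) {a a' : ℤ → L1 d (Vec n)} {B D : ℝ}
    (hB : 0 ≤ B) (ha : ∀ i ∈ harmonics, wnorm w (a i) ≤ ENNReal.ofReal B)
    (ha' : ∀ i ∈ harmonics, wnorm w (a' i) ≤ ENNReal.ofReal D) :
    wnorm w (nonlinDeriv T j a a') ≤ ENNReal.ofReal (nonlinConst T d * (3 * B ^ 2 * D)) := by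
  refine wnorm_smul_sum_triples_le T hw j fun J hJ ↦ ?_
  obtain ⟨mem_fst, mem_snd, mem_thd⟩ := mem_harmonics_of_mem_triples hJ
  have conv3_le (b c e : L1 d (Vec n)) := wnorm_conv3_le_mul (triL T) hw hmul b c e
  have bound_eq : ENNReal.ofReal (3 * B ^ 2 * D) =
      ENNReal.ofReal B * ENNReal.ofReal B * ENNReal.ofReal D
        + (ENNReal.ofReal B * ENNReal.ofReal D * ENNReal.ofReal B
        + ENNReal.ofReal D * ENNReal.ofReal B * ENNReal.ofReal B) := by
    rw [ENNReal.ofReal_mul (by positivity), ENNReal.ofReal_mul (by positivity),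
      ENNReal.ofReal_pow hB, ENNReal.ofReal_ofNat]
    ring
  rw [bound_eq, mul_add, mul_add]
  refine (wnorm_coe_add_le hw _ _).trans (add_le_add ((conv3_le _ _ _).trans ?_)
    ((wnorm_coe_add_le hw _ _).trans
      (add_le_add ((conv3_le _ _ _).trans ?_) ((conv3_le _ _ _).trans ?_))))
  · gcongr
    exacts [ha _ mem_fst, ha _ mem_snd, ha' _ mem_thd]
  · gcongr
    exacts [ha _ mem_fst, ha' _ mem_snd, ha _ mem_thd]
  · gcongr
    exacts [ha' _ mem_fst, ha _ mem_snd, ha _ mem_thd]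

end Nonlinearity

section HermitianSymbol

variable {d n : ℕ} {A : Fin d → Matrix (Fin n) (Fin n) ℝ} {Em : Matrix (Fin n) (Fin n) ℝ}

theorem isHermitian_symbolL (hA : ∀ l, (A l).IsSymm) (hE : Em.transpose = -Em) (α : ℝ)
    (β : Space d) : (symbolL A Em α β).IsHermitian := by
  ext i j
  have A_symm (l : Fin d) : A l j i = A l i j := (hA l).apply i j
  have E_skew : Em j i = -Em i j := congrFun (congrFun hE i) j
  simp only [symbolL, Matrix.conjTranspose_apply, Matrix.sub_apply, Matrix.add_apply,
    Matrix.smul_apply, Matrix.sum_apply, Matrix.map_apply, smul_eq_mul, star_sub, star_add,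
    star_mul', star_neg, Complex.star_def, Complex.conj_ofReal, Complex.conj_I, A_symm, E_skew,
    star_sum, Matrix.one_apply, apply_ite (starRingEnd ℂ), map_one, map_zero,
    eq_comm (a := i) (b := j)]
  push_cast
  ring_nf

theorem symL_isSymmetric (hA : ∀ l, (A l).IsSymm) (hE : Em.transpose = -Em) (α : ℝ) (β : Space d) :
    (symL A Em α β : Vec n →ₗ[ℂ] Vec n).IsSymmetric :=
  Matrix.isSymmetric_toEuclideanLin_iff.mpr (isHermitian_symbolL hA hE α β)

theorem re_inner_neg_smul_symL (hA : ∀ l, (A l).IsSymm) (hE : Em.transpose = -Em) (α ε : ℝ)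
    (β : Space d) (v : Vec n) :
    RCLike.re (inner ℂ v (-((Complex.I / (ε : ℂ)) • symL A Em α β v))) = 0 := by
  have inner_real : ((RCLike.re (inner ℂ v (symL A Em α β v)) : ℝ) : ℂ)
      = inner ℂ v (symL A Em α β v) := (symL_isSymmetric hA hE α β).coe_re_inner_self_apply v
  rw [inner_neg_right, inner_smul_right, ← inner_real, div_mul_eq_mul_div, mul_div_assoc,
    ← Complex.ofReal_div]
  simp

end HermitianSymbol

section GrowthOfNorms

variable {d n : ℕ} {A : Fin d → Matrix (Fin n) (Fin n) ℝ} {Em : Matrix (Fin n) (Fin n) ℝ}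
  {T : (Fin n → ℝ) →ₗ[ℝ] (Fin n → ℝ) →ₗ[ℝ] (Fin n → ℝ) →ₗ[ℝ] (Fin n → ℝ)}
  {ω : ℝ} {κ : Space d} {ε τ : ℝ} {a : ℤ → ℝ → L1 d (Vec n)}

theorem hasDerivWithinAt_Ici_of_Icc {F : Type*} [NormedAddCommGroup F] [NormedSpace ℝ F]
    {f : ℝ → F} {f' : F} {x t y : ℝ} (h : HasDerivWithinAt f f' (Icc x y) t) (ht : t ∈ Ico x y) :
    HasDerivWithinAt f f' (Ici t) t :=
  h.mono_of_mem_nhdsWithin (mem_of_superset (Icc_mem_nhdsGE ht.2) (Icc_subset_Icc_left ht.1))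

/-- The sum of the weighted norms of the two harmonics `1` and `3`, which control all the
others. -/
def pairNorm (w : Space d → ℝ≥0) (a : ℤ → L1 d (Vec n)) : ℝ := wreal w (a 1) + wreal w (a 3)

theorem pairNorm_nonneg (w : Space d → ℝ≥0) (a : ℤ → L1 d (Vec n)) : 0 ≤ pairNorm w a :=
  add_nonneg (wreal_nonneg _ _) (wreal_nonneg _ _)

theorem wnorm_le_of_pairNorm_le {w : Space d → ℝ≥0} {N : ℝ≥0} (hN : ∀ k, w k ≤ N)
    {a : ℤ → L1 d (Vec n)} {X : ℝ} (h : pairNorm w a ≤ X) {j : ℤ}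
    (hj : j ∈ ({1, 3} : Finset ℤ)) : wnorm w (a j) ≤ ENNReal.ofReal X := by
  refine wnorm_le_of_wreal_le hN (le_trans ?_ h)
  simp only [Finset.mem_insert, Finset.mem_singleton] at hj
  rcases hj with rfl | rfl
  exacts [le_add_of_nonneg_right (wreal_nonneg _ _), le_add_of_nonneg_left (wreal_nonneg _ _)]

namespace Evolution

theorem mono {τ' : ℝ} (h : Evolution A Em T ω κ ε τ a) (hτ : τ' ≤ τ) :
    Evolution A Em T ω κ ε τ' a where
  conj j hj t ht := h.conj j hj t (Icc_subset_Icc_right hτ ht)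
  deriv j hj t ht := by
    obtain ⟨β, hβ, a_deriv⟩ := h.deriv j hj t (Icc_subset_Icc_right hτ ht)
    exact ⟨β, hβ, a_deriv.mono (Icc_subset_Icc_right hτ)⟩

theorem continuousOn (h : Evolution A Em T ω κ ε τ a) {j : ℤ} (hj : j ∈ ({1, 3} : Finset ℤ)) :
    ContinuousOn (a j) (Icc 0 τ) := fun t ht ↦ by
  obtain ⟨β, -, a_deriv⟩ := h.deriv j hj t ht
  exact a_deriv.continuousWithinAt

theorem wnorm_le (h : Evolution A Em T ω κ ε τ a) {w : Space d → ℝ≥0} (hw : ∀ k, w (-k) = w k)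
    {t : ℝ} (ht : t ∈ Icc 0 τ) {C : ℝ≥0∞} (hC : ∀ j ∈ ({1, 3} : Finset ℤ), wnorm w (a j t) ≤ C) :
    ∀ i ∈ harmonics, wnorm w (a i t) ≤ C := by
  intro i hi
  obtain ⟨j, hj, rfl | rfl⟩ := eq_or_eq_neg_of_mem_harmonics hi
  · exact hC _ hj
  · rw [h.conj j hj t ht, wnorm_conjRefl hw]
    exact hC _ hj

theorem rightSlopeLE (hA : ∀ l, (A l).IsSymm) (hE : Em.transpose = -Em) (hε : 0 ≤ ε)
    (h : Evolution A Em T ω κ ε τ a) {w : Space d → ℝ≥0} (hw : Measurable w) {N : ℝ≥0}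
    (hN : ∀ k, w k ≤ N) {j : ℤ} (hj : j ∈ ({1, 3} : Finset ℤ)) {t : ℝ} (ht : t ∈ Ico 0 τ) {X : ℝ}
    (hX : 0 ≤ X) (hF : wnorm w (nonlin T j fun i ↦ a i t) ≤ ENNReal.ofReal X) :
    RightSlopeLE (fun s ↦ wreal w (a j s)) (ε * X) t := by
  obtain ⟨β, hβ, a_deriv⟩ := h.deriv j hj t (Ico_subset_Icc_self ht)
  refine (rightSlopeLE_wreal hw hN (hasDerivWithinAt_Ici_of_Icc a_deriv ht) ?_ ?_).mono ?_
  · filter_upwards [hβ] with k hk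
    rw [hk]
    exact re_inner_neg_smul_symL hA hE _ _ _ _
  · filter_upwards [hβ] with k hk a_eq_zero
    rw [hk, a_eq_zero, map_zero, smul_zero, neg_zero]
  · rw [wreal_smul hw hε]
    exact mul_le_mul_of_nonneg_left (wreal_le_of_wnorm_le hX hF) hε

theorem continuousOn_pairNorm (h : Evolution A Em T ω κ ε τ a) {w : Space d → ℝ≥0}
    (hw : Measurable w) {N : ℝ≥0} (hN : ∀ k, w k ≤ N) :
    ContinuousOn (fun t ↦ pairNorm w fun i ↦ a i t) (Icc 0 τ) :=
  ((continuous_wreal hw hN).comp_continuousOn (h.continuousOn (by decide))).add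
    ((continuous_wreal hw hN).comp_continuousOn (h.continuousOn (by decide)))

theorem rightSlopeLE_pairNorm (hA : ∀ l, (A l).IsSymm) (hE : Em.transpose = -Em) (hε : 0 ≤ ε)
    (h : Evolution A Em T ω κ ε τ a) {w : Space d → ℝ≥0} (hw : Measurable w) {N : ℝ≥0}
    (hN : ∀ k, w k ≤ N) {t : ℝ} (ht : t ∈ Ico 0 τ) {X : ℝ} (hX : 0 ≤ X)
    (hF : ∀ j, wnorm w (nonlin T j fun i ↦ a i t) ≤ ENNReal.ofReal X) :
    RightSlopeLE (fun s ↦ pairNorm w fun i ↦ a i s) (ε * (2 * X)) t :=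
  ((h.rightSlopeLE hA hE hε hw hN (by decide) ht hX (hF 1)).add
    (h.rightSlopeLE hA hE hε hw hN (by decide) ht hX (hF 3))).mono (by linarith)

end Evolution

theorem pairNorm_le_of_three_eq_zero {w : Space d → ℝ≥0} (hw : Measurable w)
    {a : ℤ → L1 d (Vec n)} {M : ℝ} (hM : 0 ≤ M) (hone : wnorm w (a 1) ≤ ENNReal.ofReal M)
    (hthree : a 3 = 0) : pairNorm w a ≤ M := by
  rw [pairNorm, hthree, wreal_zero hw, add_zero]
  exact wreal_le_of_wnorm_le hM hone

theorem Evolution.rightSlopeLE_pairNorm_one (hA : ∀ l, (A l).IsSymm) (hE : Em.transpose = -Em)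
    (hε : 0 ≤ ε) (h : Evolution A Em T ω κ ε τ a) {t : ℝ} (ht : t ∈ Ico 0 τ) :
    RightSlopeLE (fun s ↦ pairNorm 1 fun i ↦ a i s)
      (ε * (2 * (nonlinConst T d * pairNorm 1 (fun i ↦ a i t) ^ 3))) t := by
  have total_nonneg := pairNorm_nonneg 1 fun i ↦ a i t
  have wnorm_one_le : ∀ i ∈ harmonics,
      wnorm 1 (a i t) ≤ ENNReal.ofReal (pairNorm 1 fun i ↦ a i t) :=
    h.wnorm_le (w := 1) (fun _ ↦ rfl) (Ico_subset_Icc_self ht) fun _ hj ↦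
      wnorm_le_of_pairNorm_le (a := fun i ↦ a i t) (N := 1) (fun _ ↦ le_rfl) le_rfl hj
  exact h.rightSlopeLE_pairNorm hA hE hε measurable_one (N := 1) (fun _ ↦ le_rfl) ht
    (mul_nonneg (nonlinConst_nonneg T) (pow_nonneg total_nonneg 3)) fun j ↦
    wnorm_nonlin_le_mul T measurable_one (fun _ _ ↦ (one_mul 1).ge) j total_nonneg wnorm_one_le

theorem exists_time_wnorm_le (hA : ∀ l, (A l).IsSymm) (hE : Em.transpose = -Em)
    (T : (Fin n → ℝ) →ₗ[ℝ] (Fin n → ℝ) →ₗ[ℝ] (Fin n → ℝ) →ₗ[ℝ] (Fin n → ℝ)) (ω : ℝ) (κ : Space d)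
    {tend : ℝ} (htend : 0 < tend) {B : ℝ} (hB : 0 < B) :
    ∃ tstar ∈ Ioc 0 tend, ∀ ε : ℝ, 0 < ε → ∀ a : ℤ → ℝ → L1 d (Vec n),
      Evolution A Em T ω κ ε (tstar / ε) a → wnorm 1 (a 1 0) ≤ ENNReal.ofReal B → a 3 0 = 0 →
      ∀ t ∈ Icc 0 (tstar / ε), ∀ j ∈ ({1, 3} : Finset ℤ),
        wnorm 1 (a j t) ≤ ENNReal.ofReal (2 * B) := by
  have const_nonneg := nonlinConst_nonneg (d := d) T
  let K : ℝ := 2 * (nonlinConst T d * (2 * B) ^ 3) + 1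
  have K_pos : 0 < K := by positivity
  refine ⟨min tend (B / K), ⟨lt_min htend (by positivity), min_le_left _ _⟩, ?_⟩
  intro ε hε a ha hone hthree t ht j hj
  have barrier_le (s : ℝ) (hs : s ∈ Icc 0 (min tend (B / K) / ε)) : B + ε * K * s ≤ 2 * B := by
    have scaled_time_le : s * ε ≤ B / K :=
      ((le_div_iff₀ hε).mp hs.2).trans (min_le_right _ _)
    rw [le_div_iff₀ K_pos] at scaled_time_le
    linarith
  have pairNorm_le := le_linear_of_rightSlopeLE (δ := B) (K := ε * K)
    (ha.continuousOn_pairNorm (w := 1) measurable_one (N := 1) fun _ ↦ le_rfl)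
    (fun s hs ↦ ha.rightSlopeLE_pairNorm_one hA hE hε.le hs)
    (pairNorm_le_of_three_eq_zero measurable_one hB.le hone hthree) fun s hs heq ↦ by
      have norm_le := heq.trans_le (barrier_le s (Ico_subset_Icc_self hs))
      have total_nonneg := pairNorm_nonneg 1 fun i ↦ a i s
      calc ε * (2 * (nonlinConst T d * pairNorm 1 (fun i ↦ a i s) ^ 3))
          ≤ ε * (2 * (nonlinConst T d * (2 * B) ^ 3)) := by gcongr
        _ < ε * K := by gcongr; exact lt_add_one _
  exact wnorm_le_of_pairNorm_le (w := 1) (N := 1) (fun _ ↦ le_rfl)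
    ((pairNorm_le t ht).trans (barrier_le t ht)) hj

/-- The factor by which a weighted norm grows on a time interval of length `tend / ε` as long as
the `L¹` norm is at most `B`, for weights that are subadditive up to the factor `K`. -/
def growthFactor (T : (Fin n → ℝ) →ₗ[ℝ] (Fin n → ℝ) →ₗ[ℝ] (Fin n → ℝ) →ₗ[ℝ] (Fin n → ℝ)) (d : ℕ)
    (K : ℝ≥0) (B tend : ℝ) : ℝ :=
  Real.exp (2 * (nonlinConst T d * (K ^ 2 * (3 * B ^ 2))) * tend)

theorem Evolution.wnorm_growth_of_bounded (hA : ∀ l, (A l).IsSymm) (hE : Em.transpose = -Em)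
    (hε : 0 ≤ ε) (ha : Evolution A Em T ω κ ε τ a) {tend : ℝ} (hτ : ε * τ ≤ tend)
    {w : Space d → ℝ≥0} (hw : Measurable w) {N : ℝ≥0} (hN : ∀ k, w k ≤ N)
    (heven : ∀ k, w (-k) = w k) {K : ℝ≥0} (hK : 1 ≤ K) (hadd : ∀ x y, w (x + y) ≤ K * (w x + w y))
    {B M : ℝ} (hB : 0 ≤ B) (hM : 0 ≤ M)
    (hBa : ∀ t ∈ Icc 0 τ, ∀ j ∈ ({1, 3} : Finset ℤ), wnorm 1 (a j t) ≤ ENNReal.ofReal B)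
    (hone : wnorm w (a 1 0) ≤ ENNReal.ofReal M) (hthree : a 3 0 = 0) :
    ∀ t ∈ Icc 0 τ, ∀ j ∈ ({1, 3} : Finset ℤ),
      wnorm w (a j t) ≤ ENNReal.ofReal (M * growthFactor T d K B tend) := by
  intro t ht j hj
  have const_nonneg := nonlinConst_nonneg (d := d) T
  have total_nonneg (s : ℝ) := pairNorm_nonneg w fun i ↦ a i s
  have nonlin_le (s : ℝ) (hs : s ∈ Ico 0 τ) (j : ℤ) := wnorm_nonlin_le_add T hw hK hadd j hB
    (ha.wnorm_le (fun _ ↦ rfl) (Ico_subset_Icc_self hs) (hBa s (Ico_subset_Icc_self hs)))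
    (ha.wnorm_le heven (Ico_subset_Icc_self hs)
      fun j hj ↦ wnorm_le_of_pairNorm_le (a := fun i ↦ a i s) hN le_rfl hj)
  have gronwall := le_gronwallBound_of_rightSlopeLE (δ := M)
    (K := ε * (2 * (nonlinConst T d * (K ^ 2 * (3 * B ^ 2))))) (e := 0)
    (ha.continuousOn_pairNorm hw hN)
    (fun s hs ↦ ha.rightSlopeLE_pairNorm hA hE hε hw hN hs
      (by have := total_nonneg s; positivity) (nonlin_le s hs))
    (pairNorm_le_of_three_eq_zero hw hM hone hthree)
    (fun s _ ↦ by rw [add_zero]; exact le_of_eq (by ring)) t ht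
  refine wnorm_le_of_pairNorm_le (a := fun i ↦ a i t) hN (gronwall.trans ?_) hj
  have scaled_time_le : ε * t ≤ tend := (mul_le_mul_of_nonneg_left ht.2 hε).trans hτ
  rw [gronwallBound_ε0, mul_right_comm, mul_comm (ε * t), growthFactor]
  gcongr

theorem min_add_le_mul_add {w : Space d → ℝ≥0} {K : ℝ≥0} (hK : 1 ≤ K)
    (hadd : ∀ x y, w (x + y) ≤ K * (w x + w y)) (N : ℝ≥0) (x y : Space d) :
    min (w (x + y)) N ≤ K * (min (w x) N + min (w y) N) := by
  have le_mul : N ≤ K * N := le_mul_of_one_le_left zero_le hK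
  rcases le_total (w x) N with hx | hx
  · rcases le_total (w y) N with hy | hy
    · rw [min_eq_left hx, min_eq_left hy]
      exact (min_le_left _ _).trans (hadd x y)
    · rw [min_eq_right hy]
      refine (min_le_right _ _).trans (le_mul.trans ?_)
      gcongr
      exact le_add_self
  · rw [min_eq_right hx]
    refine (min_le_right _ _).trans (le_mul.trans ?_)
    gcongr
    exact le_self_add

theorem Evolution.wnorm_growth (hA : ∀ l, (A l).IsSymm) (hE : Em.transpose = -Em)
    (hε : 0 ≤ ε) (ha : Evolution A Em T ω κ ε τ a) {tend : ℝ} (hτ : ε * τ ≤ tend)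
    {w : Space d → ℝ≥0} (hw : Measurable w) (heven : ∀ k, w (-k) = w k) {K : ℝ≥0} (hK : 1 ≤ K)
    (hadd : ∀ x y, w (x + y) ≤ K * (w x + w y)) {B M : ℝ} (hB : 0 ≤ B) (hM : 0 ≤ M)
    (hBa : ∀ t ∈ Icc 0 τ, ∀ j ∈ ({1, 3} : Finset ℤ), wnorm 1 (a j t) ≤ ENNReal.ofReal B)
    (hone : wnorm w (a 1 0) ≤ ENNReal.ofReal M) (hthree : a 3 0 = 0) :
    ∀ t ∈ Icc 0 τ, ∀ j ∈ ({1, 3} : Finset ℤ),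
      wnorm w (a j t) ≤ ENNReal.ofReal (M * growthFactor T d K B tend) := by
  intro t ht j hj
  refine wnorm_le_of_forall_min hw (L1.integrable_coeFn _).1 fun N ↦ ?_
  exact ha.wnorm_growth_of_bounded hA hE hε hτ (hw.min measurable_const) (N := N)
    (fun k ↦ min_le_right _ _) (fun k ↦ by rw [heven]) hK (min_add_le_mul_add hK hadd N) hB hM hBa
    ((wnorm_mono_weight _ fun k ↦ min_le_left _ _).trans hone) hthree t ht j hj

end GrowthOfNorms

section PolynomialWeight

variable {d : ℕ}

/-- The weight `(1 + |k|)^s`, whose weighted `L¹` norm controls `s` derivatives in the Wiener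
algebra. -/
def polyWeight (d s : ℕ) (k : Space d) : ℝ≥0 := (1 + ‖k‖₊) ^ s

theorem measurable_polyWeight (s : ℕ) : Measurable (polyWeight d s) := by
  unfold polyWeight; fun_prop

theorem polyWeight_neg (s : ℕ) (k : Space d) : polyWeight d s (-k) = polyWeight d s k := by
  rw [polyWeight, nnnorm_neg, polyWeight]

theorem polyWeight_add_le_mul (s : ℕ) (x y : Space d) :
    polyWeight d s (x + y) ≤ polyWeight d s x * polyWeight d s y := by
  unfold polyWeight
  rw [← mul_pow]
  gcongr
  calc 1 + ‖x + y‖₊ ≤ 1 + (‖x‖₊ + ‖y‖₊) := by gcongr; exact nnnorm_add_le _ _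
    _ ≤ 1 + (‖x‖₊ + ‖y‖₊) + ‖x‖₊ * ‖y‖₊ := le_self_add
    _ = (1 + ‖x‖₊) * (1 + ‖y‖₊) := by ring

theorem polyWeight_add_le_add (s : ℕ) (x y : Space d) :
    polyWeight d s (x + y) ≤ 2 ^ s * (polyWeight d s x + polyWeight d s y) := by
  unfold polyWeight
  have base_le : 1 + ‖x + y‖₊ ≤ 2 * max (1 + ‖x‖₊) (1 + ‖y‖₊) := by
    calc 1 + ‖x + y‖₊ ≤ 1 + (‖x‖₊ + ‖y‖₊) := by gcongr; exact nnnorm_add_le _ _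
      _ ≤ (1 + ‖x‖₊) + (1 + ‖y‖₊) := by
        rw [add_add_add_comm]; gcongr; exact le_self_add
      _ ≤ max (1 + ‖x‖₊) (1 + ‖y‖₊) + max (1 + ‖x‖₊) (1 + ‖y‖₊) :=
        add_le_add (le_max_left _ _) (le_max_right _ _)
      _ = 2 * max (1 + ‖x‖₊) (1 + ‖y‖₊) := (two_mul _).symm
  refine (pow_le_pow_left' base_le s).trans ?_
  rw [mul_pow]
  gcongr
  rcases le_total (1 + ‖x‖₊) (1 + ‖y‖₊) with hxy | hxy
  · rw [max_eq_right hxy]; exact le_add_self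
  · rw [max_eq_left hxy]; exact le_self_add

end PolynomialWeight

section Spectral

variable {d n : ℕ} {A : Fin d → Matrix (Fin n) (Fin n) ℝ} {Em : Matrix (Fin n) (Fin n) ℝ}
  (S : ℤ → SmoothEigen A Em) (ω : ℝ) (κ : Space d)

theorem symL_psiJ (j : ℤ) (l : Fin n) (θ : Space d) :
    symL A Em ((j : ℝ) * ω) ((j : ℝ) • κ + θ) (psiJ S κ j l θ)
      = (lamJ S ω κ j l θ : ℂ) • psiJ S κ j l θ := by
  rw [symL_eq_sub_smul, symL_apply]
  unfold psiJ lamJ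
  rw [(S j).eigen, Complex.ofReal_sub, sub_smul]

theorem orthonormal_psiJ (j : ℤ) (θ : Space d) : Orthonormal ℂ fun l ↦ psiJ S κ j l θ :=
  (S j).orthonormal _

theorem norm_psiJ (j : ℤ) (l : Fin n) (θ : Space d) : ‖psiJ S κ j l θ‖ = 1 :=
  (orthonormal_psiJ S κ j θ).1 l

theorem psiJ_ne_zero (j : ℤ) (l : Fin n) (θ : Space d) : psiJ S κ j l θ ≠ 0 :=
  (orthonormal_psiJ S κ j θ).ne_zero l

theorem inner_psiJ_symL (hA : ∀ l, (A l).IsSymm) (hE : Em.transpose = -Em) (j : ℤ) (l : Fin n)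
    (θ : Space d) (v : Vec n) :
    inner ℂ (psiJ S κ j l θ) (symL A Em ((j : ℝ) * ω) ((j : ℝ) • κ + θ) v)
      = (lamJ S ω κ j l θ : ℂ) * inner ℂ (psiJ S κ j l θ) v := by
  have symL_symm := symL_isSymmetric hA hE ((j : ℝ) * ω) ((j : ℝ) • κ + θ) (psiJ S κ j l θ) v
  rw [ContinuousLinearMap.coe_coe] at symL_symm
  rw [← symL_symm, symL_psiJ, inner_smul_left, Complex.conj_ofReal]

/-- The orthonormal basis `ψ_{j1}(θ), …, ψ_{jn}(θ)` of eigenvectors of `L(jω, jκ + θ)`. -/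
def psiBasis (j : ℤ) (θ : Space d) : OrthonormalBasis (Fin n) ℂ (Vec n) :=
  OrthonormalBasis.mk (orthonormal_psiJ S κ j θ)
    ((orthonormal_psiJ S κ j θ).linearIndependent.span_eq_top_of_card_eq_finrank' (by simp)).ge

theorem sum_inner_psiJ_smul (j : ℤ) (θ : Space d) (v : Vec n) :
    ∑ l, inner ℂ (psiJ S κ j l θ) v • psiJ S κ j l θ = v := by
  simpa [psiBasis] using (psiBasis S κ j θ).sum_repr' v

theorem sum_norm_sq_inner_psiJ (j : ℤ) (θ : Space d) (v : Vec n) :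
    ∑ l, ‖inner ℂ (psiJ S κ j l θ) v‖ ^ 2 = ‖v‖ ^ 2 := by
  simpa [psiBasis] using (psiBasis S κ j θ).sum_sq_norm_inner_right v

theorem norm_inner_psiJ_le (j : ℤ) (l : Fin n) (θ : Space d) (v : Vec n) :
    ‖inner ℂ (psiJ S κ j l θ) v‖ ≤ ‖v‖ := by
  simpa [norm_psiJ] using norm_inner_le_norm (𝕜 := ℂ) (psiJ S κ j l θ) v

theorem norm_symL_le_sum (hA : ∀ l, (A l).IsSymm) (hE : Em.transpose = -Em) (j : ℤ)
    (θ : Space d) (v : Vec n) :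
    ‖symL A Em ((j : ℝ) * ω) ((j : ℝ) • κ + θ) v‖
      ≤ ∑ l, |lamJ S ω κ j l θ| * ‖inner ℂ (psiJ S κ j l θ) v‖ := by
  conv_lhs => rw [← sum_inner_psiJ_smul S κ j θ (symL A Em _ _ v)]
  refine (norm_sum_le _ _).trans (Finset.sum_le_sum fun l _ ↦ ?_)
  rw [norm_smul, norm_psiJ, mul_one, inner_psiJ_symL S ω κ hA hE, norm_mul, Complex.norm_real,
    Real.norm_eq_abs]

theorem exists_lipschitzWith_lam (j : ℤ) (l : Fin n) : ∃ K, LipschitzWith K ((S j).lam l) := by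
  obtain ⟨C, hC⟩ := (S j).lam_lipschitz l
  refine ⟨_, LipschitzWith.of_dist_le' (K := |C| * d) fun β' β ↦ ?_⟩
  rw [Real.dist_eq, dist_eq_norm]
  calc |(S j).lam l β' - (S j).lam l β| ≤ C * ∑ i, |β' i - β i| := hC β' β
    _ ≤ |C| * ∑ _i : Fin d, ‖β' - β‖ := by
      refine mul_le_mul (le_abs_self _) (Finset.sum_le_sum fun i _ ↦ ?_)
        (Finset.sum_nonneg fun i _ ↦ abs_nonneg _) (abs_nonneg _)
      exact PiLp.norm_apply_le (β' - β) i
    _ = |C| * d * ‖β' - β‖ := by simp [mul_assoc]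

theorem exists_forall_lipschitzWith_lam :
    ∃ Λ : ℝ≥0, ∀ j ∈ ({1, 3} : Finset ℤ), ∀ l, LipschitzWith Λ ((S j).lam l) := by
  choose K hK using exists_lipschitzWith_lam S
  refine ⟨(({1, 3} : Finset ℤ) ×ˢ Finset.univ).sup fun i ↦ K i.1 i.2, fun j hj l ↦ ?_⟩
  exact (hK j l).weaken (Finset.le_sup (f := fun i : ℤ × Fin n ↦ K i.1 i.2)
    (Finset.mk_mem_product hj (Finset.mem_univ l)))

/-- A common Lipschitz constant of the eigenvalues of `L_1` and `L_3`. -/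
def lamLip : ℝ≥0 := (exists_forall_lipschitzWith_lam S).choose

theorem abs_lamJ_smul_sub_le {ε : ℝ} (hε : 0 ≤ ε) {j : ℤ} (hj : j ∈ ({1, 3} : Finset ℤ))
    (l : Fin n) (k : Space d) :
    |lamJ S ω κ j l (ε • k) - lamJ S ω κ j l 0| ≤ lamLip S * ε * ‖k‖ := by
  have lipschitz := (exists_forall_lipschitzWith_lam S).choose_spec j hj l
  unfold lamJ
  rw [sub_sub_sub_cancel_right, ← Real.dist_eq]
  refine (lipschitz.dist_le_mul _ _).trans_eq ?_
  rw [dist_add_left, dist_zero_right, norm_smul, Real.norm_of_nonneg hε, mul_assoc, lamLip]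

theorem abs_lamJ_smul_le {ε : ℝ} (hε : 0 ≤ ε) {j : ℤ} (hj : j ∈ ({1, 3} : Finset ℤ))
    (l : Fin n) (k : Space d) :
    |lamJ S ω κ j l (ε • k)| ≤ |lamJ S ω κ j l 0| + lamLip S * ε * ‖k‖ := by
  have abs_diff_le := abs_lamJ_smul_sub_le S ω κ hε hj l k
  linarith [abs_sub_abs_le_abs_sub (lamJ S ω κ j l (ε • k)) (lamJ S ω κ j l 0)]

theorem measurable_psiJ (ε : ℝ) (j : ℤ) (l : Fin n) :
    Measurable fun k : Space d ↦ psiJ S κ j l (ε • k) := by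
  have psi_meas : Measurable ((S j).psi l) :=
    measurable_of_continuousOn_compl_singleton 0 ((S j).psi_smooth l).continuousOn
  exact psi_meas.comp (by fun_prop)

theorem measurable_lamJ (ε : ℝ) (j : ℤ) (l : Fin n) :
    Measurable fun k : Space d ↦ lamJ S ω κ j l (ε • k) := by
  have lam_meas : Measurable ((S j).lam l) :=
    measurable_of_continuousOn_compl_singleton 0 ((S j).lam_smooth l).continuousOn
  exact (lam_meas.comp (by fun_prop)).sub_const _

end Spectral

section Modes

theorem eq_zero_or_eq_zero_of_finrank_eq_one {V : Type*} [NormedAddCommGroup V]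
    [InnerProductSpace ℂ V] {K : Submodule ℂ V} (hK : Module.finrank ℂ K = 1) {v w : V}
    (hv : v ∈ K) (hw : w ∈ K) (horth : inner ℂ v w = 0) : v = 0 ∨ w = 0 := by
  obtain ⟨u, -, hu⟩ := finrank_eq_one_iff'.mp hK
  obtain ⟨a, ha⟩ := hu ⟨v, hv⟩
  obtain ⟨b, hb⟩ := hu ⟨w, hw⟩
  obtain rfl : a • (u : V) = v := congrArg Subtype.val ha
  obtain rfl : b • (u : V) = w := congrArg Subtype.val hb
  simp only [inner_smul_left, inner_smul_right, mul_eq_zero, map_eq_zero,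
    inner_self_eq_zero] at horth
  rcases horth with rfl | rfl | u_eq_zero
  · simp
  · simp
  · simp [u_eq_zero]

variable {d n : ℕ} {A : Fin d → Matrix (Fin n) (Fin n) ℝ} {Em : Matrix (Fin n) (Fin n) ℝ}
  (S : ℤ → SmoothEigen A Em) (ω : ℝ) (κ : Space d)

theorem toEuclideanLin_psiJ_eq_zero {j : ℤ} {l : Fin n} (h : lamJ S ω κ j l 0 = 0) :
    Matrix.toEuclideanLin (symbolL A Em ((j : ℝ) * ω) ((j : ℝ) • κ)) (psiJ S κ j l 0) = 0 := by
  have eigen := symL_psiJ S ω κ j l 0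
  rwa [add_zero, h, Complex.ofReal_zero, zero_smul, symL_apply] at eigen

theorem lamJ_ne_zero_of_isUnit {j : ℤ}
    (hinv : IsUnit (symbolL A Em ((j : ℝ) * ω) ((j : ℝ) • κ))) (l : Fin n) :
    lamJ S ω κ j l 0 ≠ 0 := fun h ↦ by
  have mulVec_eq_zero := congrArg WithLp.ofLp (toEuclideanLin_psiJ_eq_zero S ω κ h)
  rw [Matrix.toLpLin_apply, WithLp.ofLp_zero, ← Matrix.mulVec_zero (symbolL A Em _ _)]
    at mulVec_eq_zero
  exact psiJ_ne_zero S κ j l 0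
    (WithLp.ofLp_injective 2 (Matrix.mulVec_injective_of_isUnit hinv mulVec_eq_zero))

theorem lamJ_one_ne_zero [NeZero n]
    (hker : Module.finrank ℂ (LinearMap.ker (Matrix.toEuclideanLin (symbolL A Em ω κ))) = 1)
    (hS : lamJ S ω κ 1 0 0 = 0) {l : Fin n} (hl : l ≠ 0) : lamJ S ω κ 1 l 0 ≠ 0 := fun h ↦ by
  have mem_ker (m : Fin n) (hm : lamJ S ω κ 1 m 0 = 0) :
      psiJ S κ 1 m 0 ∈ LinearMap.ker (Matrix.toEuclideanLin (symbolL A Em ω κ)) := by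
    simpa using toEuclideanLin_psiJ_eq_zero S ω κ hm
  rcases eq_zero_or_eq_zero_of_finrank_eq_one hker (mem_ker l h) (mem_ker 0 hS)
    ((orthonormal_psiJ S κ 1 0).2 hl) with psi_eq_zero | psi_eq_zero
  exacts [psiJ_ne_zero S κ 1 l 0 psi_eq_zero, psiJ_ne_zero S κ 1 0 0 psi_eq_zero]

/-- The noncritical modes: all pairs `(j, ℓ)` with `j ∈ {1, 3}` except the critical one, which is
`(1, 0)` because `Fin n` starts at `0`. -/
def modes (n : ℕ) [NeZero n] : Finset (ℤ × Fin n) :=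
  (({1, 3} : Finset ℤ) ×ˢ Finset.univ).erase (1, 0)

theorem fst_mem_of_mem_modes [NeZero n] {i : ℤ × Fin n} (hi : i ∈ modes n) :
    i.1 ∈ ({1, 3} : Finset ℤ) :=
  (Finset.mem_product.mp (Finset.mem_of_mem_erase hi)).1

theorem lamJ_ne_zero_of_mem_modes [NeZero n]
    (hker : Module.finrank ℂ (LinearMap.ker (Matrix.toEuclideanLin (symbolL A Em ω κ))) = 1)
    (hinv : IsUnit (symbolL A Em (((3 : ℤ) : ℝ) * ω) (((3 : ℤ) : ℝ) • κ)))
    (hS : lamJ S ω κ 1 0 0 = 0) {i : ℤ × Fin n} (hi : i ∈ modes n) :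
    lamJ S ω κ i.1 i.2 0 ≠ 0 := by
  obtain ⟨j, l⟩ := i
  have not_critical := Finset.ne_of_mem_erase hi
  obtain rfl | rfl : j = 1 ∨ j = 3 := by simpa using fst_mem_of_mem_modes hi
  · exact lamJ_one_ne_zero S ω κ hker hS fun h ↦ not_critical (Prod.ext rfl h)
  · exact lamJ_ne_zero_of_isUnit S ω κ hinv l

end Modes

section WeightPairs

variable {d : ℕ}

/-- Weights `w` and `W` for which estimates in the `W`-weighted norm of `L¹` survive, in the
`w`-weighted norm, the multiplication by `k`. Submultiplicative weights turn `L¹` into a convolution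
algebra. The weight `w` is bounded, so that its weighted norm is finite on `L¹`. -/
structure IsWeightPair (w W : Space d → ℝ≥0) : Prop where
  measurable_left : Measurable w
  measurable_right : Measurable W
  left_neg : ∀ k, w (-k) = w k
  right_neg : ∀ k, W (-k) = W k
  left_add_le : ∀ x y, w (x + y) ≤ w x * w y
  right_add_le : ∀ x y, W (x + y) ≤ W x * W y
  bounded : ∃ N, ∀ k, w k ≤ N
  one_le_left : ∀ k, 1 ≤ w k
  mul_one_add_le : ∀ k, w k * (1 + ‖k‖₊) ≤ W k

namespace IsWeightPair

variable {w W : Space d → ℝ≥0}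

theorem left_le_right (h : IsWeightPair w W) (k : Space d) : w k ≤ W k :=
  (le_mul_of_one_le_right zero_le le_self_add).trans (h.mul_one_add_le k)

theorem one_add_norm_le (h : IsWeightPair w W) (k : Space d) : 1 + ‖k‖ ≤ W k :=
  mod_cast (le_mul_of_one_le_left zero_le (h.one_le_left k)).trans (h.mul_one_add_le k)

theorem mul_norm_le (h : IsWeightPair w W) (k : Space d) : w k * ‖k‖ ≤ W k := by
  refine le_trans ?_ (NNReal.coe_le_coe.mpr (h.mul_one_add_le k))
  push_cast
  gcongr
  exact le_add_of_nonneg_left zero_le_one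

end IsWeightPair

end WeightPairs

section EigenComponents

variable {d n : ℕ} {A : Fin d → Matrix (Fin n) (Fin n) ℝ} {Em : Matrix (Fin n) (Fin n) ℝ}
  (S : ℤ → SmoothEigen A Em) (ω : ℝ) (κ : Space d)

theorem exists_component (ε : ℝ) (j : ℤ) (l : Fin n) :
    ∃ Q : L1 d (Vec n) →L[ℝ] L1 d ℂ, ∀ f : L1 d (Vec n),
      Q f =ᵐ[volume] fun k ↦ inner ℂ (psiJ S κ j l (ε • k)) (f k) := by
  have psi_meas : StronglyMeasurable fun k : Space d ↦ innerSL ℂ (psiJ S κ j l (ε • k)) :=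
    (innerSL ℂ (E := Vec n)).continuous.comp_stronglyMeasurable
      (measurable_psiJ S κ ε j l).stronglyMeasurable
  exact exists_mulOp psi_meas.aestronglyMeasurable (C := 1) fun k ↦ by
    rw [innerSL_apply_norm, norm_psiJ]

/-- The component `f ↦ ⟨ψ_{jℓ}(ε ·), f⟩` of elements of `L¹`. -/
def component (ε : ℝ) (j : ℤ) (l : Fin n) : L1 d (Vec n) →L[ℝ] L1 d ℂ :=
  (exists_component S κ ε j l).choose

theorem coeFn_component (ε : ℝ) (j : ℤ) (l : Fin n) (f : L1 d (Vec n)) :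
    component S κ ε j l f =ᵐ[volume] fun k ↦ inner ℂ (psiJ S κ j l (ε • k)) (f k) :=
  (exists_component S κ ε j l).choose_spec f

theorem ae_norm_component_le (ε : ℝ) (j : ℤ) (l : Fin n) (f : L1 d (Vec n)) :
    ∀ᵐ k, ‖component S κ ε j l f k‖ ≤ ‖f k‖ := by
  filter_upwards [coeFn_component S κ ε j l f] with k hk
  exact hk ▸ norm_inner_psiJ_le S κ j l _ _

theorem wnorm_component_le (ε : ℝ) (j : ℤ) (l : Fin n) (w : Space d → ℝ≥0) (f : L1 d (Vec n)) :
    wnorm w (component S κ ε j l f) ≤ wnorm w f :=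
  wnorm_mono_ae ((ae_norm_component_le S κ ε j l f).mono fun _ hk ↦
    mul_le_mul_of_nonneg_left hk NNReal.zero_le_coe)

theorem integrable_weight_mul_norm_of_wnorm_lt_top {E : Type*} [NormedAddCommGroup E]
    {W : Space d → ℝ≥0} (hW : Measurable W) {f : L1 d E} (hf : wnorm W f < ∞) :
    Integrable fun k ↦ (W k : ℝ) * ‖f k‖ := by
  refine ⟨hW.coe_nnreal_real.aestronglyMeasurable.mul (L1.integrable_coeFn f).1.norm, ?_⟩
  refine lt_of_eq_of_lt (lintegral_congr fun k ↦ ?_) hf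
  rw [enorm_mul, enorm_norm, ← ofReal_norm, Real.norm_of_nonneg NNReal.zero_le_coe,
    ENNReal.ofReal_coe_nnreal]

theorem exists_coeFn_eq_lamJ_mul_component {ε : ℝ} (hε : 0 ≤ ε) {j : ℤ}
    (hj : j ∈ ({1, 3} : Finset ℤ)) (l : Fin n) {W : Space d → ℝ≥0} (hW : Measurable W)
    (hW_ge : ∀ k, 1 + ‖k‖ ≤ W k) {f : L1 d (Vec n)} (hf : wnorm W f < ∞) :
    ∃ H : L1 d ℂ,
      H =ᵐ[volume] fun k ↦ (lamJ S ω κ j l (ε • k) : ℂ) * component S κ ε j l f k := by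
  have lam_le (k : Space d) :
      |lamJ S ω κ j l (ε • k)| ≤ (|lamJ S ω κ j l 0| + lamLip S * ε) * W k := by
    refine (abs_lamJ_smul_le S ω κ hε hj l k).trans ?_
    have slope_nonneg : 0 ≤ lamLip S * ε := by positivity
    nlinarith [hW_ge k, norm_nonneg k, abs_nonneg (lamJ S ω κ j l 0)]
  have int : Integrable fun k ↦ (lamJ S ω κ j l (ε • k) : ℂ) * component S κ ε j l f k := by
    refine ((integrable_weight_mul_norm_of_wnorm_lt_top hW hf).const_mul
      (|lamJ S ω κ j l 0| + lamLip S * ε)).mono'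
      ((Complex.measurable_ofReal.comp (measurable_lamJ S ω κ ε j l)).aestronglyMeasurable.mul
        (L1.integrable_coeFn _).1) ?_
    filter_upwards [ae_norm_component_le S κ ε j l f] with k hk
    rw [norm_mul, Complex.norm_real, Real.norm_eq_abs, ← mul_assoc]
    exact mul_le_mul (lam_le k) hk (norm_nonneg _) (by positivity)
  exact ⟨int.toL1, int.coeFn_toL1⟩

end EigenComponents

section NormalForm

variable {d n : ℕ} {A : Fin d → Matrix (Fin n) (Fin n) ℝ} {Em : Matrix (Fin n) (Fin n) ℝ}
  (S : ℤ → SmoothEigen A Em) (ω : ℝ) (κ : Space d)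

/-- The coefficient `iε²/λ_{jℓ}(0)` of the nonlinearity in the normal form. -/
def normalFormCoeff (ε : ℝ) (j : ℤ) (l : Fin n) : ℂ :=
  Complex.I * ((ε ^ 2 / lamJ S ω κ j l 0 : ℝ) : ℂ)

/-- The normal form transformation of a component: adding a multiple of size `ε²` of the
nonlinearity `g` removes the nonresonant forcing of size `ε`. -/
def normalForm (ε : ℝ) (j : ℤ) (l : Fin n) (f g : L1 d (Vec n)) : L1 d ℂ :=
  component S κ ε j l f + normalFormCoeff S ω κ ε j l • component S κ ε j l g

theorem coeFn_normalForm (ε : ℝ) (j : ℤ) (l : Fin n) (f g : L1 d (Vec n)) :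
    ∀ᵐ k, normalForm S ω κ ε j l f g k
      = component S κ ε j l f k + normalFormCoeff S ω κ ε j l * component S κ ε j l g k := by
  filter_upwards [Lp.coeFn_add (component S κ ε j l f)
    (normalFormCoeff S ω κ ε j l • component S κ ε j l g),
    Lp.coeFn_smul (normalFormCoeff S ω κ ε j l) (component S κ ε j l g)] with k h_add h_smul
  rw [normalForm, h_add, Pi.add_apply, h_smul, Pi.smul_apply, smul_eq_mul]

theorem hasDerivWithinAt_normalForm (ε : ℝ) (j : ℤ) (l : Fin n) {f g : ℝ → L1 d (Vec n)}
    {f' g' : L1 d (Vec n)} {s : Set ℝ} {t : ℝ} (hf : HasDerivWithinAt f f' s t)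
    (hg : HasDerivWithinAt g g' s t) :
    HasDerivWithinAt (fun x ↦ normalForm S ω κ ε j l (f x) (g x)) (normalForm S ω κ ε j l f' g')
      s t :=
  ((component S κ ε j l).hasFDerivAt.comp_hasDerivWithinAt t hf).add
    (((component S κ ε j l).hasFDerivAt.comp_hasDerivWithinAt t hg).const_smul
      (normalFormCoeff S ω κ ε j l))

theorem continuousOn_normalForm (ε : ℝ) (j : ℤ) (l : Fin n) {f g : ℝ → L1 d (Vec n)} {s : Set ℝ}
    (hf : ContinuousOn f s) (hg : ContinuousOn g s) :
    ContinuousOn (fun x ↦ normalForm S ω κ ε j l (f x) (g x)) s :=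
  ((component S κ ε j l).continuous.comp_continuousOn hf).add
    (((component S κ ε j l).continuous.comp_continuousOn hg).const_smul
      (normalFormCoeff S ω κ ε j l))

theorem wnorm_correction_le (ε : ℝ) (j : ℤ) (l : Fin n) (w : Space d → ℝ≥0) {g : L1 d (Vec n)}
    {X : ℝ} (hg : wnorm w g ≤ ENNReal.ofReal X) :
    wnorm w (normalFormCoeff S ω κ ε j l • component S κ ε j l g : L1 d ℂ)
      ≤ ENNReal.ofReal (ε ^ 2 / |lamJ S ω κ j l 0| * X) := by
  have norm_coeff : ‖normalFormCoeff S ω κ ε j l‖ = ε ^ 2 / |lamJ S ω κ j l 0| := by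
    rw [normalFormCoeff, norm_mul, Complex.norm_I, one_mul, Complex.norm_real, Real.norm_eq_abs,
      abs_div, abs_of_nonneg (sq_nonneg ε)]
  refine (wnorm_coe_smul_le w _ _).trans ?_
  rw [norm_coeff, ENNReal.ofReal_mul (by positivity)]
  gcongr
  exact (wnorm_component_le S κ ε j l w g).trans hg

theorem wreal_normalForm_le {ε : ℝ} {j : ℤ} {l : Fin n} {w : Space d → ℝ≥0} (hw : Measurable w)
    {N : ℝ≥0} (hN : ∀ k, w k ≤ N) (f : L1 d (Vec n)) {g : L1 d (Vec n)} {X : ℝ} (hX : 0 ≤ X)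
    (hg : wnorm w g ≤ ENNReal.ofReal X) :
    wreal w (normalForm S ω κ ε j l f g)
      ≤ wreal w (component S κ ε j l f) + ε ^ 2 / |lamJ S ω κ j l 0| * X :=
  (wreal_add_le hw hN _ _).trans (add_le_add_right
    (wreal_le_of_wnorm_le (by positivity) (wnorm_correction_le S ω κ ε j l w hg)) _)

theorem wreal_component_le {ε : ℝ} {j : ℤ} {l : Fin n} {w : Space d → ℝ≥0} (hw : Measurable w)
    {N : ℝ≥0} (hN : ∀ k, w k ≤ N) (f : L1 d (Vec n)) {g : L1 d (Vec n)} {X : ℝ} (hX : 0 ≤ X)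
    (hg : wnorm w g ≤ ENNReal.ofReal X) :
    wreal w (component S κ ε j l f)
      ≤ wreal w (normalForm S ω κ ε j l f g) + ε ^ 2 / |lamJ S ω κ j l 0| * X := by
  let correction : L1 d ℂ := normalFormCoeff S ω κ ε j l • component S κ ε j l g
  have wnorm_neg : wnorm w (-correction) = wnorm w correction :=
    wnorm_congr_ae (f := ⇑(-correction)) (g := correction) <|
      (Lp.coeFn_neg correction).mono fun k hk ↦ by rw [hk, Pi.neg_apply, norm_neg]
  have sub_correction := wreal_add_le hw hN (normalForm S ω κ ε j l f g) (-correction)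
  rw [normalForm, add_neg_cancel_right] at sub_correction
  exact sub_correction.trans (add_le_add_right (wreal_le_of_wnorm_le (by positivity)
    (wnorm_neg.trans_le (wnorm_correction_le S ω κ ε j l w hg))) _)

theorem ae_component_linearPart_add_eq (hA : ∀ l, (A l).IsSymm) (hE : Em.transpose = -Em) {ε : ℝ}
    (hε : ε ≠ 0) {j : ℤ} {l : Fin n} (hμ : lamJ S ω κ j l 0 ≠ 0) {f g β : L1 d (Vec n)}
    (hβ : ∀ᵐ k, β k = -((Complex.I / (ε : ℂ)) •
      symL A Em ((j : ℝ) * ω) ((j : ℝ) • κ + ε • k) (f k)))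
    {H : L1 d ℂ}
    (hH : H =ᵐ[volume] fun k ↦ (lamJ S ω κ j l (ε • k) : ℂ) * component S κ ε j l g k) :
    ∀ᵐ k, (component S κ ε j l β + (ε / lamJ S ω κ j l 0) • H : L1 d ℂ) k
      = (-(Complex.I * ((lamJ S ω κ j l (ε • k) / ε : ℝ) : ℂ)))
        • normalForm S ω κ ε j l f g k := by
  have ε_ne : (ε : ℂ) ≠ 0 := mod_cast hε
  have μ_ne : (lamJ S ω κ j l 0 : ℂ) ≠ 0 := mod_cast hμ
  filter_upwards [Lp.coeFn_add (component S κ ε j l β) ((ε / lamJ S ω κ j l 0) • H),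
    Lp.coeFn_smul (ε / lamJ S ω κ j l 0) H, hH, coeFn_normalForm S ω κ ε j l f g, hβ,
    coeFn_component S κ ε j l β, coeFn_component S κ ε j l f]
    with k h_add h_smul h_mul h_normal h_lin hβ_comp hf_comp
  rw [h_add, Pi.add_apply, h_smul, Pi.smul_apply, h_mul, h_normal, hβ_comp, h_lin, hf_comp,
    inner_neg_right, inner_smul_right, inner_psiJ_symL S ω κ hA hE, normalFormCoeff,
    Complex.real_smul, smul_eq_mul]
  push_cast
  field_simp
  linear_combination ((lamJ S ω κ j l (ε • k) : ℂ) * (ε : ℂ) ^ 2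
    * component S κ ε j l g k) * Complex.I_sq

theorem wnorm_detuning_le {ε : ℝ} (hε : 0 ≤ ε) {j : ℤ} (hj : j ∈ ({1, 3} : Finset ℤ)) {l : Fin n}
    (hμ : lamJ S ω κ j l 0 ≠ 0) {w W : Space d → ℝ≥0} (hwW : ∀ k, w k * ‖k‖ ≤ W k)
    {g : L1 d (Vec n)} {X : ℝ} (hg : wnorm W g ≤ ENNReal.ofReal X) {H : L1 d ℂ}
    (hH : H =ᵐ[volume] fun k ↦ (lamJ S ω κ j l (ε • k) : ℂ) * component S κ ε j l g k) :
    wnorm w (ε • component S κ ε j l g - (ε / lamJ S ω κ j l 0) • H : L1 d ℂ)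
      ≤ ENNReal.ofReal (ε ^ 2 / |lamJ S ω κ j l 0| * (lamLip S * X)) := by
  let C : ℝ≥0 := ⟨ε ^ 2 / |lamJ S ω κ j l 0| * lamLip S, by positivity⟩
  have pointwise : ∀ᵐ k,
      (w k : ℝ) * ‖(ε • component S κ ε j l g - (ε / lamJ S ω κ j l 0) • H : L1 d ℂ) k‖
        ≤ C * (W k * ‖g k‖) := by
    filter_upwards [Lp.coeFn_sub (ε • component S κ ε j l g) ((ε / lamJ S ω κ j l 0) • H),
      Lp.coeFn_smul ε (component S κ ε j l g), Lp.coeFn_smul (ε / lamJ S ω κ j l 0) H, hH,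
      ae_norm_component_le S κ ε j l g] with k h_sub hg_smul hH_smul h_mul h_le
    have factor : (ε • component S κ ε j l g - (ε / lamJ S ω κ j l 0) • H : L1 d ℂ) k
        = ((ε / lamJ S ω κ j l 0 * (lamJ S ω κ j l 0 - lamJ S ω κ j l (ε • k)) : ℝ) : ℂ)
          * component S κ ε j l g k := by
      have μ_ne : (lamJ S ω κ j l 0 : ℂ) ≠ 0 := mod_cast hμ
      rw [h_sub, Pi.sub_apply, hg_smul, hH_smul, Pi.smul_apply, Pi.smul_apply, h_mul,
        Complex.real_smul, Complex.real_smul]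
      push_cast
      field_simp
    rw [factor, norm_mul, Complex.norm_real, Real.norm_eq_abs, abs_mul, abs_div,
      abs_of_nonneg hε, abs_sub_comm]
    calc (w k : ℝ) * (ε / |lamJ S ω κ j l 0| * |lamJ S ω κ j l (ε • k) - lamJ S ω κ j l 0|
          * ‖component S κ ε j l g k‖)
        ≤ w k * (ε / |lamJ S ω κ j l 0| * (lamLip S * ε * ‖k‖) * ‖g k‖) := by
          gcongr
          exact abs_lamJ_smul_sub_le S ω κ hε hj l k
      _ = C * ((w k * ‖k‖) * ‖g k‖) := by
          change _ = ε ^ 2 / |lamJ S ω κ j l 0| * lamLip S * _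
          ring
      _ ≤ C * (W k * ‖g k‖) := by gcongr; exact hwW k
  refine (wnorm_le_of_ae C pointwise).trans ?_
  rw [← mul_assoc, ENNReal.ofReal_mul (by positivity), ← ENNReal.ofReal_coe_nnreal]
  exact mul_le_mul_right hg _

theorem rightSlopeLE_normalForm (hA : ∀ l, (A l).IsSymm) (hE : Em.transpose = -Em) {ε : ℝ}
    (hε : 0 < ε) {j : ℤ} (hj : j ∈ ({1, 3} : Finset ℤ)) {l : Fin n}
    (hμ : lamJ S ω κ j l 0 ≠ 0) {a F : ℝ → L1 d (Vec n)} {β F' : L1 d (Vec n)} {t : ℝ}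
    (hβ : ∀ᵐ k, β k = -((Complex.I / (ε : ℂ)) •
      symL A Em ((j : ℝ) * ω) ((j : ℝ) • κ + ε • k) (a t k)))
    (ha : HasDerivWithinAt a (β + ε • F t) (Ici t) t) (hF : HasDerivWithinAt F F' (Ici t) t)
    {w W : Space d → ℝ≥0} (hwW : IsWeightPair w W) {X Y : ℝ} (hX : 0 ≤ X) (hY : 0 ≤ Y)
    (hFX : wnorm W (F t) ≤ ENNReal.ofReal X) (hFY : wnorm w F' ≤ ENNReal.ofReal Y) :
    RightSlopeLE (fun s ↦ wreal w (normalForm S ω κ ε j l (a s) (F s)))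
      (ε ^ 2 / |lamJ S ω κ j l 0| * (lamLip S * X + Y)) t := by
  obtain ⟨N, hN⟩ := hwW.bounded
  obtain ⟨H, hH⟩ := exists_coeFn_eq_lamJ_mul_component S ω κ hε.le hj l hwW.measurable_right
    hwW.one_add_norm_le (hFX.trans_lt ENNReal.ofReal_lt_top)
  -- `H` turns the linear part of the derivative into an imaginary multiple of the normal form.
  have deriv_eq : HasDerivWithinAt (fun s ↦ normalForm S ω κ ε j l (a s) (F s))
      ((component S κ ε j l β + (ε / lamJ S ω κ j l 0) • H)
        + ((ε • component S κ ε j l (F t) - (ε / lamJ S ω κ j l 0) • H)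
          + normalFormCoeff S ω κ ε j l • component S κ ε j l F')) (Ici t) t := by
    refine (hasDerivWithinAt_normalForm S ω κ ε j l ha hF).congr_deriv ?_
    rw [normalForm, map_add, map_smul]
    abel
  have rotation := ae_component_linearPart_add_eq S ω κ hA hE hε.ne' hμ hβ hH
  refine (rightSlopeLE_wreal hwW.measurable_left hN deriv_eq ?_ ?_).mono ?_
  · filter_upwards [rotation] with k hk
    rw [hk, inner_smul_right, inner_self_eq_norm_sq_to_K]
    simp [← Complex.ofReal_pow]
  · filter_upwards [rotation] with k hk normalForm_eq_zero
    rw [hk, normalForm_eq_zero, smul_zero]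
  · refine wreal_le_of_wnorm_le (by positivity) ?_
    rw [mul_add, ENNReal.ofReal_add (by positivity) (by positivity)]
    exact (wnorm_coe_add_le hwW.measurable_left _ _).trans
      (add_le_add (wnorm_detuning_le S ω κ hε.le hj hμ hwW.mul_norm_le hFX hH)
        (wnorm_correction_le S ω κ ε j l w hFY))

end NormalForm

section Noncritical

variable {d n : ℕ} {A : Fin d → Matrix (Fin n) (Fin n) ℝ} {Em : Matrix (Fin n) (Fin n) ℝ}
  (S : ℤ → SmoothEigen A Em) (ω : ℝ) (κ : Space d)

theorem norm_smul_symL_le (hA : ∀ l, (A l).IsSymm) (hE : Em.transpose = -Em) {ε : ℝ} (hε : 0 < ε)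
    {j : ℤ} (hj : j ∈ ({1, 3} : Finset ℤ)) (k : Space d) (v : Vec n) :
    ‖(Complex.I / (ε : ℂ)) • symL A Em ((j : ℝ) * ω) ((j : ℝ) • κ + ε • k) v‖
      ≤ (∑ l, |lamJ S ω κ j l 0| / ε * ‖inner ℂ (psiJ S κ j l (ε • k)) v‖)
        + n * lamLip S * (‖k‖ * ‖v‖) := by
  have term_le (l : Fin n) : |lamJ S ω κ j l (ε • k)| * ‖inner ℂ (psiJ S κ j l (ε • k)) v‖
      ≤ |lamJ S ω κ j l 0| * ‖inner ℂ (psiJ S κ j l (ε • k)) v‖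
        + lamLip S * ε * ‖k‖ * ‖v‖ := by
    refine (mul_le_mul_of_nonneg_right (abs_lamJ_smul_le S ω κ hε.le hj l k)
      (norm_nonneg _)).trans ?_
    rw [add_mul]
    gcongr
    exact norm_inner_psiJ_le S κ j l _ v
  rw [norm_smul, norm_div, Complex.norm_I, Complex.norm_real, Real.norm_of_nonneg hε.le, one_div,
    inv_mul_le_iff₀ hε]
  calc ‖symL A Em ((j : ℝ) * ω) ((j : ℝ) • κ + ε • k) v‖
      ≤ ∑ l, |lamJ S ω κ j l (ε • k)| * ‖inner ℂ (psiJ S κ j l (ε • k)) v‖ :=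
        norm_symL_le_sum S ω κ hA hE j (ε • k) v
    _ ≤ ∑ l, (|lamJ S ω κ j l 0| * ‖inner ℂ (psiJ S κ j l (ε • k)) v‖
          + lamLip S * ε * ‖k‖ * ‖v‖) := Finset.sum_le_sum fun l _ ↦ term_le l
    _ = ε * ((∑ l, |lamJ S ω κ j l 0| / ε * ‖inner ℂ (psiJ S κ j l (ε • k)) v‖)
          + n * lamLip S * (‖k‖ * ‖v‖)) := by
        rw [Finset.sum_add_distrib, mul_add, Finset.mul_sum, Finset.sum_const, Finset.card_univ,
          Fintype.card_fin, nsmul_eq_mul]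
        congr 1
        · exact Finset.sum_congr rfl fun l _ ↦ by field_simp
        · ring

variable [NeZero n]

/-- The sum of the weighted norms of the noncritical components, which is to be shown to be of
size `ε`. -/
def noncriticalNorm (w : Space d → ℝ≥0) (ε : ℝ) (a : ℤ → L1 d (Vec n)) : ℝ :=
  ∑ i ∈ modes n, wreal w (component S κ ε i.1 i.2 (a i.1))

/-- The sum of the moduli of the noncritical eigenvalues at `θ = 0`. -/
def lamSum : ℝ := ∑ i ∈ modes n, |lamJ S ω κ i.1 i.2 0|

/-- The sum of the reciprocals of the moduli of the noncritical eigenvalues at `θ = 0`, the size of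
the normal form transformation. -/
def lamInvSum : ℝ := ∑ i ∈ modes n, 1 / |lamJ S ω κ i.1 i.2 0|

theorem noncriticalNorm_nonneg (w : Space d → ℝ≥0) (ε : ℝ) (a : ℤ → L1 d (Vec n)) :
    0 ≤ noncriticalNorm S κ w ε a :=
  Finset.sum_nonneg fun _ _ ↦ wreal_nonneg _ _

theorem lamSum_nonneg : 0 ≤ lamSum S ω κ := Finset.sum_nonneg fun _ _ ↦ abs_nonneg _

theorem lamInvSum_nonneg : 0 ≤ lamInvSum S ω κ := Finset.sum_nonneg fun _ _ ↦ by positivity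

theorem wreal_component_le_noncriticalNorm (w : Space d → ℝ≥0) (ε : ℝ) (a : ℤ → L1 d (Vec n))
    {i : ℤ × Fin n} (hi : i ∈ modes n) :
    wreal w (component S κ ε i.1 i.2 (a i.1)) ≤ noncriticalNorm S κ w ε a :=
  Finset.single_le_sum (f := fun i : ℤ × Fin n ↦ wreal w (component S κ ε i.1 i.2 (a i.1)))
    (fun _ _ ↦ wreal_nonneg _ _) hi

theorem sum_le_sum_modes {f : ℤ × Fin n → ℝ} (hf : ∀ i, 0 ≤ f i) (hf_crit : f (1, 0) = 0) {j : ℤ}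
    (hj : j ∈ ({1, 3} : Finset ℤ)) : ∑ l, f (j, l) ≤ ∑ i ∈ modes n, f i := by
  rw [modes, Finset.sum_erase _ hf_crit, Finset.sum_product]
  exact Finset.single_le_sum (f := fun j ↦ ∑ l, f (j, l))
    (fun j _ ↦ Finset.sum_nonneg fun l _ ↦ hf _) hj

theorem sum_abs_lamJ_mul_wreal_component_le (hS : lamJ S ω κ 1 0 0 = 0) (w : Space d → ℝ≥0)
    (ε : ℝ) (a : ℤ → L1 d (Vec n)) {j : ℤ} (hj : j ∈ ({1, 3} : Finset ℤ)) :
    ∑ l, |lamJ S ω κ j l 0| * wreal w (component S κ ε j l (a j))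
      ≤ lamSum S ω κ * noncriticalNorm S κ w ε a := by
  refine (sum_le_sum_modes (f := fun i : ℤ × Fin n ↦
    |lamJ S ω κ i.1 i.2 0| * wreal w (component S κ ε i.1 i.2 (a i.1)))
    (fun i ↦ mul_nonneg (abs_nonneg _) (wreal_nonneg _ _)) (by simp [hS]) hj).trans ?_
  rw [lamSum, Finset.sum_mul]
  exact Finset.sum_le_sum fun i hi ↦ mul_le_mul_of_nonneg_left
    (wreal_component_le_noncriticalNorm S κ w ε a hi) (abs_nonneg _)

theorem wnorm_sum_abs_lamJ_mul_component_le (hS : lamJ S ω κ 1 0 0 = 0) {ε : ℝ} (hε : 0 < ε)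
    {w : Space d → ℝ≥0} (hw : Measurable w) {N : ℝ≥0} (hN : ∀ k, w k ≤ N)
    (a : ℤ → L1 d (Vec n)) {j : ℤ} (hj : j ∈ ({1, 3} : Finset ℤ)) :
    wnorm w (fun k ↦ ∑ l, |lamJ S ω κ j l 0| / ε * ‖component S κ ε j l (a j) k‖)
      ≤ ENNReal.ofReal (lamSum S ω κ * noncriticalNorm S κ w ε a / ε) := by
  have term_le (l : Fin n) :
      wnorm w (fun k ↦ |lamJ S ω κ j l 0| / ε * ‖component S κ ε j l (a j) k‖)
        ≤ ENNReal.ofReal (|lamJ S ω κ j l 0| * wreal w (component S κ ε j l (a j)) / ε) := by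
    rw [mul_div_right_comm, ENNReal.ofReal_mul (by positivity), ofReal_wreal hN]
    refine wnorm_le_of_ae (Real.toNNReal _) (ae_of_all _ fun k ↦ le_of_eq ?_)
    rw [Real.coe_toNNReal _ (by positivity), norm_mul, norm_norm,
      Real.norm_of_nonneg (by positivity)]
    ring
  refine (wnorm_sum_le _ hw fun l _ ↦ (L1.integrable_coeFn _).1.norm.const_mul _).trans ?_
  refine (Finset.sum_le_sum fun l _ ↦ term_le l).trans ?_
  rw [← ENNReal.ofReal_sum_of_nonneg fun l _ ↦
    div_nonneg (mul_nonneg (abs_nonneg _) (wreal_nonneg _ _)) hε.le, ← Finset.sum_div]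
  gcongr
  exact sum_abs_lamJ_mul_wreal_component_le S ω κ hS w ε a hj

theorem wnorm_linearPart_le (hA : ∀ l, (A l).IsSymm) (hE : Em.transpose = -Em)
    (hS : lamJ S ω κ 1 0 0 = 0) {ε : ℝ} (hε : 0 < ε) {w W : Space d → ℝ≥0}
    (hwW : IsWeightPair w W) {B : ℝ} {a : ℤ → L1 d (Vec n)} {j : ℤ}
    (hj : j ∈ ({1, 3} : Finset ℤ)) (ha : wnorm W (a j) ≤ ENNReal.ofReal B) {β : L1 d (Vec n)}
    (hβ : ∀ᵐ k, β k = -((Complex.I / (ε : ℂ)) •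
      symL A Em ((j : ℝ) * ω) ((j : ℝ) • κ + ε • k) (a j k))) :
    wnorm w β ≤ ENNReal.ofReal (lamSum S ω κ * noncriticalNorm S κ w ε a / ε)
      + ENNReal.ofReal (n * lamLip S * B) := by
  obtain ⟨N, hN⟩ := hwW.bounded
  have pointwise : ∀ᵐ k, (w k : ℝ) * ‖β k‖
      ≤ w k * ‖(∑ l, |lamJ S ω κ j l 0| / ε * ‖component S κ ε j l (a j) k‖)
        + n * lamLip S * (‖k‖ * ‖a j k‖)‖ := by
    filter_upwards [hβ, ae_all_iff.mpr fun l ↦ coeFn_component S κ ε j l (a j)] with k h_lin h_comp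
    simp only [h_comp]
    rw [Real.norm_of_nonneg (by positivity), h_lin, norm_neg]
    gcongr
    exact norm_smul_symL_le S ω κ hA hE hε hj k (a j k)
  have detuning_le : wnorm w (fun k ↦ n * lamLip S * (‖k‖ * ‖a j k‖))
      ≤ ENNReal.ofReal (n * lamLip S * B) := by
    rw [ENNReal.ofReal_mul (by positivity)]
    refine le_trans ?_ (mul_le_mul_right ha _)
    refine wnorm_le_of_ae (Real.toNNReal _) (ae_of_all _ fun k ↦ ?_)
    rw [Real.coe_toNNReal _ (by positivity), Real.norm_of_nonneg (by positivity)]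
    calc (w k : ℝ) * (n * lamLip S * (‖k‖ * ‖a j k‖))
        = n * lamLip S * ((w k * ‖k‖) * ‖a j k‖) := by ring
      _ ≤ n * lamLip S * (W k * ‖a j k‖) := by gcongr; exact hwW.mul_norm_le k
  refine (wnorm_mono_ae pointwise).trans ((wnorm_add_le hwW.measurable_left ?_ _).trans
    (add_le_add (wnorm_sum_abs_lamJ_mul_component_le S ω κ hS hε hwW.measurable_left hN a hj)
      detuning_le))
  exact Finset.aestronglyMeasurable_fun_sum _ fun l _ ↦
    (L1.integrable_coeFn _).1.norm.const_mul _

end Noncritical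

section TimeDerivative

variable {d n : ℕ} {A : Fin d → Matrix (Fin n) (Fin n) ℝ} {Em : Matrix (Fin n) (Fin n) ℝ}
  {ω : ℝ} {κ : Space d}
  {T : (Fin n → ℝ) →ₗ[ℝ] (Fin n → ℝ) →ₗ[ℝ] (Fin n → ℝ) →ₗ[ℝ] (Fin n → ℝ)}

theorem Evolution.exists_hasDerivWithinAt_of_harmonic {ε τ : ℝ} {a : ℤ → ℝ → L1 d (Vec n)}
    (ha : Evolution A Em T ω κ ε τ a) {w : Space d → ℝ≥0} (hw : ∀ k, w (-k) = w k) {t : ℝ}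
    (ht : t ∈ Icc 0 τ) {C : ℝ≥0∞}
    (h : ∀ j ∈ ({1, 3} : Finset ℤ), ∃ v, HasDerivWithinAt (a j) v (Icc 0 τ) t ∧ wnorm w v ≤ C) :
    ∃ a' : ℤ → L1 d (Vec n), ∀ i ∈ harmonics,
      HasDerivWithinAt (a i) (a' i) (Icc 0 τ) t ∧ wnorm w (a' i) ≤ C := by
  have exists_deriv : ∀ i ∈ harmonics, ∃ v, HasDerivWithinAt (a i) v (Icc 0 τ) t ∧
      wnorm w v ≤ C := by
    intro i hi
    obtain ⟨j, hj, rfl | rfl⟩ := eq_or_eq_neg_of_mem_harmonics hi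
    · exact h _ hj
    · obtain ⟨v, hv, hvC⟩ := h j hj
      refine ⟨conjRefl v, ?_, (wnorm_conjRefl hw v).trans_le hvC⟩
      exact (conjRefl.hasFDerivAt.comp_hasDerivWithinAt t hv).congr (fun s hs ↦ ha.conj j hj s hs)
        (ha.conj j hj t ht)
  choose! a' ha' using exists_deriv
  exact ⟨a', ha'⟩

theorem Evolution.wnorm_nonlin_le {ε τ : ℝ} {a : ℤ → ℝ → L1 d (Vec n)}
    (ha : Evolution A Em T ω κ ε τ a) {w W : Space d → ℝ≥0} (hwW : IsWeightPair w W) {B : ℝ}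
    (hB : 0 ≤ B) {t : ℝ} (ht : t ∈ Icc 0 τ)
    (hWB : ∀ j ∈ ({1, 3} : Finset ℤ), wnorm W (a j t) ≤ ENNReal.ofReal B) (j : ℤ) :
    wnorm w (nonlin T j fun m ↦ a m t) ≤ ENNReal.ofReal (nonlinConst T d * B ^ 3) :=
  (wnorm_mono_weight _ hwW.left_le_right).trans (wnorm_nonlin_le_mul T hwW.measurable_right
    hwW.right_add_le j hB (ha.wnorm_le hwW.right_neg ht hWB))

variable [NeZero n] (S : ℤ → SmoothEigen A Em)

theorem Evolution.exists_hasDerivWithinAt_nonlin (hA : ∀ l, (A l).IsSymm)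
    (hE : Em.transpose = -Em) (hS : lamJ S ω κ 1 0 0 = 0) {ε τ : ℝ} (hε : 0 < ε) (hε_le : ε ≤ 1)
    {a : ℤ → ℝ → L1 d (Vec n)} (ha : Evolution A Em T ω κ ε τ a) {w W : Space d → ℝ≥0}
    (hwW : IsWeightPair w W) {B : ℝ} (hB : 0 ≤ B) {t : ℝ} (ht : t ∈ Icc 0 τ)
    (hWB : ∀ j ∈ ({1, 3} : Finset ℤ), wnorm W (a j t) ≤ ENNReal.ofReal B) (j : ℤ) :
    ∃ F' : L1 d (Vec n), HasDerivWithinAt (fun x ↦ nonlin T j fun i ↦ a i x) F' (Icc 0 τ) t ∧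
      wnorm w F' ≤ ENNReal.ofReal (nonlinConst T d * (3 * B ^ 2 *
        (lamSum S ω κ * noncriticalNorm S κ w ε (fun i ↦ a i t) / ε + n * lamLip S * B
          + nonlinConst T d * B ^ 3))) := by
  have c_nonneg := nonlinConst_nonneg (d := d) T
  have q_nonneg := mul_nonneg (lamSum_nonneg S ω κ)
    (noncriticalNorm_nonneg S κ w ε fun i ↦ a i t)
  have hwB : ∀ i ∈ harmonics, wnorm w (a i t) ≤ ENNReal.ofReal B :=
    ha.wnorm_le hwW.left_neg ht fun j hj ↦
      (wnorm_mono_weight _ hwW.left_le_right).trans (hWB j hj)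
  have deriv_bound : ∀ j ∈ ({1, 3} : Finset ℤ), ∃ v, HasDerivWithinAt (a j) v (Icc 0 τ) t ∧
      wnorm w v ≤ ENNReal.ofReal (lamSum S ω κ * noncriticalNorm S κ w ε (fun i ↦ a i t) / ε
        + n * lamLip S * B + nonlinConst T d * B ^ 3) := by
    intro j hj
    obtain ⟨β, hβ, a_deriv⟩ := ha.deriv j hj t ht
    refine ⟨_, a_deriv, (wnorm_coe_add_le hwW.measurable_left _ _).trans ?_⟩
    rw [ENNReal.ofReal_add (by positivity) (by positivity), ENNReal.ofReal_add (by positivity)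
      (by positivity)]
    refine add_le_add
      (wnorm_linearPart_le S ω κ hA hE hS hε hwW (a := fun i ↦ a i t) hj (hWB j hj) hβ)
      ((wnorm_coe_smul_le w ε _).trans ((mul_le_of_le_one_left zero_le ?_).trans
        (ha.wnorm_nonlin_le hwW hB ht hWB j)))
    rwa [ENNReal.ofReal_le_one, Real.norm_of_nonneg hε.le]
  obtain ⟨a', ha'⟩ := ha.exists_hasDerivWithinAt_of_harmonic hwW.left_neg ht deriv_bound
  exact ⟨_, hasDerivWithinAt_nonlin T j fun i hi ↦ (ha' i hi).1,
    wnorm_nonlinDeriv_le_mul T hwW.measurable_left hwW.left_add_le j hB hwB fun i hi ↦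
      (ha' i hi).2⟩

end TimeDerivative

section ScaledGronwall

theorem gronwallBound_scaled_le {δ K L ε t T : ℝ} (hδ : 0 ≤ δ) (hK : 0 < K) (hL : 0 ≤ L)
    (hε : 0 < ε) (ht : ε * t ≤ T) :
    gronwallBound (ε * δ) (ε * K) (ε ^ 2 * L) t ≤ ε * ((δ + L / K) * Real.exp (K * T)) := by
  have exp_le : Real.exp (ε * K * t) ≤ Real.exp (K * T) := Real.exp_le_exp.mpr <| by
    calc ε * K * t = K * (ε * t) := by ring
      _ ≤ K * T := mul_le_mul_of_nonneg_left ht hK.le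
  rw [gronwallBound_of_K_ne_0 (mul_pos hε hK).ne']
  calc ε * δ * Real.exp (ε * K * t) + ε ^ 2 * L / (ε * K) * (Real.exp (ε * K * t) - 1)
      = ε * (δ * Real.exp (ε * K * t) + L / K * (Real.exp (ε * K * t) - 1)) := by
        field_simp
    _ ≤ ε * (δ * Real.exp (K * T) + L / K * Real.exp (K * T)) := by
        gcongr
        exact (sub_le_self _ zero_le_one).trans exp_le
    _ = ε * ((δ + L / K) * Real.exp (K * T)) := by ring

theorem le_mul_of_rightSlopeLE_scaled {z q : ℝ → ℝ} {ε τ T K L δ R : ℝ} (hε : 0 < ε)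
    (hτ : ε * τ ≤ T) (hK : 0 < K) (hL : 0 ≤ L) (hδ : 0 ≤ δ) (hR : 0 ≤ R)
    (hz : ContinuousOn z (Icc 0 τ))
    (hslope : ∀ s ∈ Ico 0 τ, RightSlopeLE z (ε * (K * q s) + ε ^ 2 * L) s)
    (hqz : ∀ s ∈ Icc 0 τ, q s ≤ z s + ε * R) (hz0 : z 0 ≤ ε * δ) :
    ∀ t ∈ Icc 0 τ, q t ≤ ((δ + (L + K * R) / K) * Real.exp (K * T) + R) * ε := by
  intro t ht
  have z_le : z t ≤ gronwallBound (ε * δ) (ε * K) (ε ^ 2 * (L + K * R)) t :=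
    le_gronwallBound_of_rightSlopeLE hz hslope hz0 (fun s hs ↦ by
      calc ε * (K * q s) + ε ^ 2 * L ≤ ε * (K * (z s + ε * R)) + ε ^ 2 * L := by
            gcongr; exact hqz s (Ico_subset_Icc_self hs)
        _ = ε * K * z s + ε ^ 2 * (L + K * R) := by ring) t ht
  have scaled_le := gronwallBound_scaled_le hδ hK (add_nonneg hL (mul_nonneg hK.le hR)) hε
    ((mul_le_mul_of_nonneg_left ht.2 hε.le).trans hτ)
  linarith [hqz t ht]

end ScaledGronwall

section ComponentBound

variable {d n : ℕ} [NeZero n] {A : Fin d → Matrix (Fin n) (Fin n) ℝ}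
  {Em : Matrix (Fin n) (Fin n) ℝ} (S : ℤ → SmoothEigen A Em) (ω : ℝ) (κ : Space d)
  (T : (Fin n → ℝ) →ₗ[ℝ] (Fin n → ℝ) →ₗ[ℝ] (Fin n → ℝ) →ₗ[ℝ] (Fin n → ℝ))

/-- The analogue of `noncriticalNorm` after the normal form transformation. -/
def normalFormNorm (w : Space d → ℝ≥0) (ε : ℝ) (a : ℤ → L1 d (Vec n)) : ℝ :=
  ∑ i ∈ modes n, wreal w (normalForm S ω κ ε i.1 i.2 (a i.1) (nonlin T i.1 a))

theorem sum_sq_div_abs_lamJ_mul (ε X : ℝ) :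
    ∑ i ∈ modes n, ε ^ 2 / |lamJ S ω κ i.1 i.2 0| * X = ε ^ 2 * (lamInvSum S ω κ * X) := by
  rw [lamInvSum, Finset.sum_mul, Finset.mul_sum]
  exact Finset.sum_congr rfl fun i _ ↦ by ring

theorem normalFormNorm_le (ε : ℝ) {w : Space d → ℝ≥0} (hw : Measurable w) {N : ℝ≥0}
    (hN : ∀ k, w k ≤ N) {a : ℤ → L1 d (Vec n)} {X : ℝ} (hX : 0 ≤ X)
    (ha : ∀ j, wnorm w (nonlin T j a) ≤ ENNReal.ofReal X) :
    normalFormNorm S ω κ T w ε a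
      ≤ noncriticalNorm S κ w ε a + ε ^ 2 * (lamInvSum S ω κ * X) := by
  rw [← sum_sq_div_abs_lamJ_mul, noncriticalNorm, ← Finset.sum_add_distrib]
  exact Finset.sum_le_sum fun i _ ↦ wreal_normalForm_le S ω κ hw hN _ hX (ha i.1)

theorem noncriticalNorm_le (ε : ℝ) {w : Space d → ℝ≥0} (hw : Measurable w) {N : ℝ≥0}
    (hN : ∀ k, w k ≤ N) {a : ℤ → L1 d (Vec n)} {X : ℝ} (hX : 0 ≤ X)
    (ha : ∀ j, wnorm w (nonlin T j a) ≤ ENNReal.ofReal X) :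
    noncriticalNorm S κ w ε a
      ≤ normalFormNorm S ω κ T w ε a + ε ^ 2 * (lamInvSum S ω κ * X) := by
  rw [← sum_sq_div_abs_lamJ_mul, normalFormNorm, ← Finset.sum_add_distrib]
  exact Finset.sum_le_sum fun i _ ↦ wreal_component_le S ω κ hw hN _ hX (ha i.1)

theorem noncriticalNorm_le_card_mul {ε : ℝ} {w : Space d → ℝ≥0} {a : ℤ → L1 d (Vec n)} {X : ℝ}
    (hX : 0 ≤ X)
    (h : ∀ i ∈ modes n, wnorm w (component S κ ε i.1 i.2 (a i.1)) ≤ ENNReal.ofReal X) :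
    noncriticalNorm S κ w ε a ≤ (modes n).card * X := by
  rw [← nsmul_eq_mul]
  exact Finset.sum_le_card_nsmul _ _ _ fun i hi ↦ wreal_le_of_wnorm_le hX (h i hi)

variable {S ω κ T} {ε τ : ℝ} {a : ℤ → ℝ → L1 d (Vec n)} {w W : Space d → ℝ≥0} {B : ℝ}

theorem Evolution.continuousOn_normalFormNorm (ha : Evolution A Em T ω κ ε τ a)
    (hw : Measurable w) {N : ℝ≥0} (hN : ∀ k, w k ≤ N) :
    ContinuousOn (fun s ↦ normalFormNorm S ω κ T w ε fun j ↦ a j s) (Icc 0 τ) := by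
  refine continuousOn_finsetSum _ fun i hi ↦ (continuous_wreal hw hN).comp_continuousOn
    (continuousOn_normalForm S ω κ ε i.1 i.2 (ha.continuousOn (fst_mem_of_mem_modes hi))
      (continuousOn_nonlin T i.1 fun m hm ↦ ?_))
  obtain ⟨j, hj, rfl | rfl⟩ := eq_or_eq_neg_of_mem_harmonics hm
  · exact ha.continuousOn hj
  · exact (conjRefl.continuous.comp_continuousOn (ha.continuousOn hj)).congr (ha.conj j hj)

theorem Evolution.rightSlopeLE_normalFormNorm (hA : ∀ l, (A l).IsSymm) (hE : Em.transpose = -Em)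
    (hS : lamJ S ω κ 1 0 0 = 0) (hμ : ∀ i ∈ modes n, lamJ S ω κ i.1 i.2 0 ≠ 0) (hε : 0 < ε)
    (hε_le : ε ≤ 1) (ha : Evolution A Em T ω κ ε τ a) (hwW : IsWeightPair w W) (hB : 0 ≤ B)
    {t : ℝ} (ht : t ∈ Ico 0 τ)
    (hWB : ∀ j ∈ ({1, 3} : Finset ℤ), wnorm W (a j t) ≤ ENNReal.ofReal B) :
    RightSlopeLE (fun s ↦ normalFormNorm S ω κ T w ε fun j ↦ a j s)
      (ε * (lamInvSum S ω κ * (nonlinConst T d * (3 * B ^ 2 * lamSum S ω κ))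
          * noncriticalNorm S κ w ε fun i ↦ a i t)
        + ε ^ 2 * (lamInvSum S ω κ * (lamLip S * (nonlinConst T d * B ^ 3)
          + nonlinConst T d * (3 * B ^ 2 * (n * lamLip S * B + nonlinConst T d * B ^ 3))))) t := by
  have ht' := Ico_subset_Icc_self ht
  have c_nonneg := nonlinConst_nonneg (d := d) T
  have q_nonneg := mul_nonneg (lamSum_nonneg S ω κ)
    (noncriticalNorm_nonneg S κ w ε fun i ↦ a i t)
  suffices bound : RightSlopeLE (fun s ↦ normalFormNorm S ω κ T w ε fun j ↦ a j s)
      (ε ^ 2 * (lamInvSum S ω κ * (lamLip S * (nonlinConst T d * B ^ 3) + nonlinConst T d *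
        (3 * B ^ 2 * (lamSum S ω κ * noncriticalNorm S κ w ε (fun i ↦ a i t) / ε
          + n * lamLip S * B + nonlinConst T d * B ^ 3))))) t from
    bound.mono (le_of_eq (by field_simp; ring))
  rw [← sum_sq_div_abs_lamJ_mul]
  refine RightSlopeLE.sum (modes n) fun i hi ↦ ?_
  have hj := fst_mem_of_mem_modes hi
  obtain ⟨β, hβ, a_deriv⟩ := ha.deriv i.1 hj t ht'
  obtain ⟨F', nonlin_deriv, hF'⟩ :=
    ha.exists_hasDerivWithinAt_nonlin S hA hE hS hε hε_le hwW hB ht' hWB i.1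
  exact rightSlopeLE_normalForm S ω κ hA hE hε hj (hμ i hi)
    (F := fun x ↦ nonlin T i.1 fun m ↦ a m x) hβ (hasDerivWithinAt_Ici_of_Icc a_deriv ht)
    (hasDerivWithinAt_Ici_of_Icc nonlin_deriv ht) hwW (by positivity) (by positivity)
    (wnorm_nonlin_le_mul T hwW.measurable_right hwW.right_add_le i.1 hB
      (ha.wnorm_le hwW.right_neg ht' hWB)) hF'

theorem exists_component_bound (hA : ∀ l, (A l).IsSymm) (hE : Em.transpose = -Em)
    (hS : lamJ S ω κ 1 0 0 = 0) (hμ : ∀ i ∈ modes n, lamJ S ω κ i.1 i.2 0 ≠ 0) (tend : ℝ)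
    {q₀ : ℝ} (hB : 0 ≤ B) (hq₀ : 0 ≤ q₀) :
    ∃ C : ℝ, 0 ≤ C ∧ ∀ ε : ℝ, 0 < ε → ε ≤ 1 → ∀ τ, ε * τ ≤ tend → ∀ a : ℤ → ℝ → L1 d (Vec n),
      Evolution A Em T ω κ ε τ a → ∀ w W : Space d → ℝ≥0, IsWeightPair w W →
      (∀ t ∈ Icc 0 τ, ∀ j ∈ ({1, 3} : Finset ℤ), wnorm W (a j t) ≤ ENNReal.ofReal B) →
      (∀ i ∈ modes n, wnorm w (component S κ ε i.1 i.2 (a i.1 0)) ≤ ENNReal.ofReal (q₀ * ε)) →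
      ∀ t ∈ Icc 0 τ, ∀ i ∈ modes n,
        wnorm w (component S κ ε i.1 i.2 (a i.1 t)) ≤ ENNReal.ofReal (C * ε) := by
  let X := nonlinConst T d * B ^ 3
  let R := lamInvSum S ω κ
  let K := R * (nonlinConst T d * (3 * B ^ 2 * lamSum S ω κ)) + 1
  let L := R * (lamLip S * X + nonlinConst T d * (3 * B ^ 2 * (n * lamLip S * B + X)))
  let δ := (modes n).card * q₀ + R * X
  have c_nonneg : 0 ≤ nonlinConst T d := nonlinConst_nonneg T
  have X_nonneg : 0 ≤ X := by positivity
  have R_nonneg : 0 ≤ R := lamInvSum_nonneg S ω κ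
  have lamSum_nonneg := lamSum_nonneg S ω κ
  have K_pos : 0 < K := by positivity
  have L_nonneg : 0 ≤ L := by positivity
  have δ_nonneg : 0 ≤ δ := by positivity
  refine ⟨(δ + (L + K * (R * X)) / K) * Real.exp (K * tend) + R * X, by positivity, ?_⟩
  intro ε hε hε_le τ hτ a ha w W hwW hWB hinit t ht i hi
  obtain ⟨N, hN⟩ := hwW.bounded
  let q (s : ℝ) := noncriticalNorm S κ w ε fun j ↦ a j s
  have nonlin_le (s) (hs : s ∈ Icc 0 τ) := ha.wnorm_nonlin_le hwW hB hs (hWB s hs)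
  have sq_le : ε ^ 2 * (R * X) ≤ ε * (R * X) := by
    gcongr
    exact pow_le_of_le_one hε.le hε_le two_ne_zero
  have slope (s) (hs : s ∈ Ico 0 τ) : RightSlopeLE
      (fun s ↦ normalFormNorm S ω κ T w ε fun j ↦ a j s) (ε * (K * q s) + ε ^ 2 * L) s := by
    refine (ha.rightSlopeLE_normalFormNorm hA hE hS hμ hε hε_le hwW hB hs
      (hWB s (Ico_subset_Icc_self hs))).mono ?_
    gcongr
    exacts [noncriticalNorm_nonneg .., le_add_of_nonneg_right zero_le_one]
  have initial : normalFormNorm S ω κ T w ε (fun j ↦ a j 0) ≤ ε * δ := by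
    have comparison := normalFormNorm_le S ω κ T ε hwW.measurable_left hN X_nonneg
      (nonlin_le 0 ⟨le_rfl, ht.1.trans ht.2⟩)
    have q_zero_le := noncriticalNorm_le_card_mul S κ (a := fun j ↦ a j 0)
      (mul_nonneg hq₀ hε.le) hinit
    simp only [δ]
    linarith
  refine wnorm_le_of_wreal_le hN ((wreal_component_le_noncriticalNorm S κ w ε
    (fun j ↦ a j t) hi).trans ?_)
  refine le_mul_of_rightSlopeLE_scaled hε hτ K_pos L_nonneg δ_nonneg (mul_nonneg R_nonneg X_nonneg)
    (ha.continuousOn_normalFormNorm hwW.measurable_left hN) slope (fun s hs ↦ ?_) initial t ht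
  exact (noncriticalNorm_le S ω κ T ε hwW.measurable_left hN X_nonneg (nonlin_le s hs)).trans
    (add_le_add_right sq_le _)

end ComponentBound

section MultipliedTransforms

variable {d n : ℕ}

theorem contDiff_pderiv {r : ℕ} {f : Space d → Vec n} (hf : ContDiff ℝ (r + 1 : ℕ) f) (l : Fin d) :
    ContDiff ℝ r (pderiv l f) := by
  unfold pderiv
  exact (hf.fderiv_right (m := r) (by norm_cast)).clm_apply contDiff_const

theorem contDiff_iterate_pderiv (l : Fin d) (m : ℕ) {r : ℕ} {f : Space d → Vec n}
    (hf : ContDiff ℝ (r + m : ℕ) f) : ContDiff ℝ r ((pderiv l)^[m] f) := by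
  induction m generalizing f with
  | zero => exact hf
  | succ m ih =>
    rw [Function.iterate_succ_apply]
    exact ih (contDiff_pderiv (r := r + m) hf l)

theorem MemWs.hat_iterate_pderiv {s : ℕ} {f : Space d → Vec n} (h : MemWs s f) (l : Fin d) {m : ℕ}
    (hm : m ≤ s) :
    hat ((pderiv l)^[m] f) =ᵐ[volume] fun k ↦ (Complex.I * ((k l : ℝ) : ℂ)) ^ m • hat f k := by
  induction m with
  | zero => simp
  | succ m ih =>
    have smooth : ContDiff ℝ (1 + m : ℕ) f := h.1.of_le (by
      rw [add_comm]
      exact_mod_cast hm)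
    have smooth_iterate : ContDiff ℝ 1 ((pderiv l)^[m] f) := by
      exact_mod_cast contDiff_iterate_pderiv l m smooth
    have memW_succ := h.memW_iterate_pderiv hm l
    rw [Function.iterate_succ_apply'] at memW_succ ⊢
    filter_upwards [ih (by omega),
      hat_pderiv smooth_iterate (h.memW_iterate_pderiv (by omega) l) l memW_succ] with k hk hk_succ
    rw [hk_succ, hk, smul_smul, pow_succ']

theorem MemWs.norm_hat_iterate_pderiv {s : ℕ} {f : Space d → Vec n} (h : MemWs s f) (l : Fin d) :
    ∀ᵐ k, ‖hat ((pderiv l)^[s] f) k‖ = |k l| ^ s * ‖hat f k‖ := by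
  filter_upwards [h.hat_iterate_pderiv l le_rfl] with k hk
  rw [hk, norm_smul, norm_pow, norm_mul, Complex.norm_I, one_mul, Complex.norm_real,
    Real.norm_eq_abs]

theorem MemW.normL1_hat {f : Space d → Vec n} (h : MemW f) : normL1 (hat f) = normW f := by
  rw [normW, if_pos h]

theorem wnorm_one_hatL1 (f : Space d → Vec n) : wnorm 1 (hatL1 f) = normL1 (hat f) := by
  rw [wnorm_congr_ae (w := 1) (g := hat f) ((coeFn_hatL1 f).mono fun k hk ↦ by rw [hk])]
  simp [wnorm, normL1]

theorem hatL1_eq_zero {f : Space d → Vec n} (h : MemW f) (h0 : ∀ x, f x = 0) : hatL1 f = 0 :=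
  eq_of_invFourierL_eq fun x ↦ by rw [invFourierL_hatL1 h, h0, map_zero]

theorem ae_apply_hatL1_eq_zero {f : Space d → Vec n} (h : MemW f) {B : Vec n →L[ℂ] Vec n}
    (h0 : ∀ x, B (f x) = 0) : ∀ᵐ k, B (hatL1 f k) = 0 := by
  have mapL_eq_zero : mapL B (hatL1 f) = 0 := eq_of_invFourierL_eq fun x ↦ by
    rw [invFourierL_mapL, invFourierL_hatL1 h, h0, map_zero]
  filter_upwards [coeFn_mapL B (hatL1 f), Lp.coeFn_zero (Vec n) 1 (volume : Measure (Space d))]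
    with k hk hk_zero
  rw [← hk, mapL_eq_zero, hk_zero]
  rfl

end MultipliedTransforms

section Moments

variable {d n : ℕ}

theorem norm_le_sum_norm_apply {𝕜 ι : Type*} [RCLike 𝕜] [Fintype ι] (v : EuclideanSpace 𝕜 ι) :
    ‖v‖ ≤ ∑ i, ‖v i‖ := by
  classical
  have eq_sum : v = ∑ i, EuclideanSpace.single i (v i) := by
    ext i
    simp
  calc ‖v‖ = ‖∑ i, EuclideanSpace.single i (v i)‖ := by rw [← eq_sum]
    _ ≤ ∑ i, ‖EuclideanSpace.single i (v i)‖ := norm_sum_le _ _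
    _ = ∑ i, ‖v i‖ := by simp

theorem one_add_norm_pow_le (s : ℕ) (k : Space d) :
    (1 + ‖k‖) ^ s ≤ (d + 1) ^ s * (1 + ∑ l, |k l| ^ s) := by
  rcases s with - | m
  · simp
  have power_mean := pow_sum_le_card_mul_sum_pow (s := (Finset.univ : Finset (Option (Fin d))))
    (f := fun o ↦ o.elim 1 fun l ↦ |k l|) (fun o _ ↦ by cases o <;> simp) m
  simp only [Fintype.sum_option, Option.elim_none, Option.elim_some, one_pow, Finset.card_univ,
    Fintype.card_option, Fintype.card_fin, Nat.cast_add, Nat.cast_one] at power_mean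
  calc (1 + ‖k‖) ^ (m + 1) ≤ (1 + ∑ l, |k l|) ^ (m + 1) := by
        gcongr
        exact norm_le_sum_norm_apply k
    _ ≤ (d + 1) ^ m * (1 + ∑ l, |k l| ^ (m + 1)) := power_mean
    _ ≤ (d + 1) ^ (m + 1) * (1 + ∑ l, |k l| ^ (m + 1)) := by
        gcongr
        exacts [by simp, m.le_succ]

theorem normW_mderiv_le_normWs {s : ℕ} (f : Space d → Vec n) {α : Fin d → ℕ} (h : ∑ l, α l ≤ s) :
    normW (mderiv α f) ≤ normWs s f := by
  unfold normWs
  refine le_trans ?_ (Finset.single_le_sum (fun m _ ↦ zero_le)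
    (Finset.mem_range.mpr (Nat.lt_succ_of_le h)))
  exact Finset.single_le_sum (f := fun α ↦ normW (mderiv α f)) (fun m _ ↦ zero_le)
    (Finset.mem_piAntidiag.mpr ⟨rfl, fun _ _ ↦ Finset.mem_univ _⟩)

theorem MemWs.normL1_hat_le {s : ℕ} {f : Space d → Vec n} (h : MemWs s f) :
    normL1 (hat f) ≤ normWs s f := by
  rw [h.memW.normL1_hat]
  simpa [mderiv_zero] using normW_mderiv_le_normWs (s := s) f (α := 0) (by simp)

theorem MemWs.normL1_hat_iterate_pderiv_le {s : ℕ} {f : Space d → Vec n} (h : MemWs s f)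
    (l : Fin d) : normL1 (hat ((pderiv l)^[s] f)) ≤ normWs s f := by
  rw [(h.memW_iterate_pderiv le_rfl l).normL1_hat, ← mderiv_single]
  exact normW_mderiv_le_normWs f (by simp)

theorem MemWs.wnorm_polyWeight_le_sum {s : ℕ} {f : Space d → Vec n} (h : MemWs s f) :
    wnorm (polyWeight d s) (hatL1 f) ≤ ENNReal.ofReal ((d + 1) ^ s)
      * (normL1 (hat f) + ∑ l, normL1 (hat ((pderiv l)^[s] f))) := by
  unfold wnorm normL1
  rw [← lintegral_finsetSum' _ fun l _ ↦ (integrable_hat _).1.enorm,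
    ← lintegral_add_left' (integrable_hat f).1.enorm,
    ← lintegral_const_mul' _ _ ENNReal.ofReal_ne_top]
  apply lintegral_mono_ae
  filter_upwards [coeFn_hatL1 f, ae_all_iff.mpr h.norm_hat_iterate_pderiv] with k h_hat h_pderiv
  simp only [h_hat, ← ofReal_norm, ← ENNReal.ofReal_coe_nnreal, h_pderiv]
  rw [← ENNReal.ofReal_sum_of_nonneg fun l _ ↦ by positivity,
    ← ENNReal.ofReal_add (by positivity) (by positivity),
    ← ENNReal.ofReal_mul (by positivity), ← ENNReal.ofReal_mul (by positivity)]
  apply ENNReal.ofReal_le_ofReal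
  rw [← Finset.sum_mul, ← one_add_mul, ← mul_assoc]
  gcongr
  simpa [polyWeight] using one_add_norm_pow_le s k

theorem MemWs.wnorm_polyWeight_le {s : ℕ} {f : Space d → Vec n} (h : MemWs s f) :
    wnorm (polyWeight d s) (hatL1 f) ≤ ENNReal.ofReal ((d + 1) ^ (s + 1)) * normWs s f := by
  calc wnorm (polyWeight d s) (hatL1 f)
      ≤ ENNReal.ofReal ((d + 1) ^ s) * (normWs s f + ∑ _l : Fin d, normWs s f) := by
        refine h.wnorm_polyWeight_le_sum.trans ?_
        gcongr with l
        exacts [h.normL1_hat_le, h.normL1_hat_iterate_pderiv_le l]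
    _ = ENNReal.ofReal ((d + 1) ^ s) * ENNReal.ofReal (d + 1) * normWs s f := by
        rw [Finset.sum_const, Finset.card_univ, Fintype.card_fin, nsmul_eq_mul, mul_assoc,
          ENNReal.ofReal_add (by positivity) (by positivity), ENNReal.ofReal_natCast,
          ENNReal.ofReal_one]
        ring
    _ = ENNReal.ofReal ((d + 1) ^ (s + 1)) * normWs s f := by
        rw [← ENNReal.ofReal_mul (by positivity), pow_succ]

end Moments

section PolarizedData

variable {d n : ℕ} {A : Fin d → Matrix (Fin n) (Fin n) ℝ} {Em : Matrix (Fin n) (Fin n) ℝ}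
  (S : ℤ → SmoothEigen A Em) (ω : ℝ) (κ : Space d)

/-- The constant in the Lipschitz bound for `β ↦ L(α, β)` in the operator norm. -/
def symbolLip (A : Fin d → Matrix (Fin n) (Fin n) ℝ) : ℝ := ∑ l, ‖matL (A l)‖

theorem symbolLip_nonneg : 0 ≤ symbolLip A := Finset.sum_nonneg fun _ _ ↦ norm_nonneg _

theorem norm_symL_add_sub_le (α : ℝ) (β θ : Space d) (v : Vec n) :
    ‖symL A Em α (β + θ) v - symL A Em α β v‖ ≤ symbolLip A * ‖θ‖ * ‖v‖ := by
  rw [symL_add, add_sub_cancel_left, symbolLip, Finset.sum_mul, Finset.sum_mul]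
  refine (norm_sum_le _ _).trans (Finset.sum_le_sum fun l _ ↦ ?_)
  rw [norm_smul, Complex.norm_real]
  calc ‖θ l‖ * ‖matL (A l) v‖ ≤ ‖θ‖ * (‖matL (A l)‖ * ‖v‖) := by
        gcongr
        exacts [PiLp.norm_apply_le θ l, (matL (A l)).le_opNorm v]
    _ = ‖matL (A l)‖ * ‖θ‖ * ‖v‖ := by ring

theorem abs_lamJ_mul_norm_inner_psiJ_le (hA : ∀ l, (A l).IsSymm) (hE : Em.transpose = -Em)
    {j : ℤ} (l : Fin n) (θ : Space d) {v : Vec n}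
    (hv : symL A Em ((j : ℝ) * ω) ((j : ℝ) • κ) v = 0) :
    |lamJ S ω κ j l θ| * ‖inner ℂ (psiJ S κ j l θ) v‖ ≤ symbolLip A * ‖θ‖ * ‖v‖ := by
  calc |lamJ S ω κ j l θ| * ‖inner ℂ (psiJ S κ j l θ) v‖
      = ‖inner ℂ (psiJ S κ j l θ) (symL A Em ((j : ℝ) * ω) ((j : ℝ) • κ + θ) v)‖ := by
        rw [inner_psiJ_symL S ω κ hA hE j l θ v, norm_mul, Complex.norm_real, Real.norm_eq_abs]
    _ ≤ ‖symL A Em ((j : ℝ) * ω) ((j : ℝ) • κ + θ) v‖ := norm_inner_psiJ_le S κ j l θ _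
    _ ≤ symbolLip A * ‖θ‖ * ‖v‖ := by
        rw [← sub_zero (symL A Em ((j : ℝ) * ω) ((j : ℝ) • κ + θ) v), ← hv]
        exact norm_symL_add_sub_le _ _ θ v

theorem abs_lamJ_zero_mul_norm_inner_psiJ_le (hA : ∀ l, (A l).IsSymm) (hE : Em.transpose = -Em)
    {ε : ℝ} (hε : 0 ≤ ε) {j : ℤ} (hj : j ∈ ({1, 3} : Finset ℤ)) (l : Fin n) (k : Space d)
    {v : Vec n} (hv : symL A Em ((j : ℝ) * ω) ((j : ℝ) • κ) v = 0) :
    |lamJ S ω κ j l 0| * ‖inner ℂ (psiJ S κ j l (ε • k)) v‖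
      ≤ (symbolLip A + lamLip S) * ε * (‖k‖ * ‖v‖) := by
  have moved_le := abs_lamJ_mul_norm_inner_psiJ_le S ω κ hA hE l (ε • k) hv
  rw [norm_smul, Real.norm_of_nonneg hε] at moved_le
  have lam_zero_le : |lamJ S ω κ j l 0| ≤ |lamJ S ω κ j l (ε • k)| + lamLip S * ε * ‖k‖ := by
    have abs_diff_le := abs_lamJ_smul_sub_le S ω κ hε hj l k
    rw [abs_sub_comm] at abs_diff_le
    linarith [abs_sub_abs_le_abs_sub (lamJ S ω κ j l 0) (lamJ S ω κ j l (ε • k))]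
  calc |lamJ S ω κ j l 0| * ‖inner ℂ (psiJ S κ j l (ε • k)) v‖
      ≤ |lamJ S ω κ j l (ε • k)| * ‖inner ℂ (psiJ S κ j l (ε • k)) v‖
          + lamLip S * ε * ‖k‖ * ‖inner ℂ (psiJ S κ j l (ε • k)) v‖ := by
        rw [← add_mul]
        gcongr
    _ ≤ symbolLip A * (ε * ‖k‖) * ‖v‖ + lamLip S * ε * ‖k‖ * ‖v‖ := by
        gcongr
        exact norm_inner_psiJ_le S κ j l _ v
    _ = (symbolLip A + lamLip S) * ε * (‖k‖ * ‖v‖) := by ring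

variable [NeZero n]

/-- A bound, relative to `ε`, for the noncritical components of polarized data. -/
def polarizedConst : ℝ := lamInvSum S ω κ * (symbolLip A + lamLip S)

theorem polarizedConst_nonneg : 0 ≤ polarizedConst S ω κ :=
  mul_nonneg (lamInvSum_nonneg S ω κ) (add_nonneg symbolLip_nonneg NNReal.zero_le_coe)

theorem norm_inner_psiJ_le_of_symL_eq_zero (hA : ∀ l, (A l).IsSymm) (hE : Em.transpose = -Em)
    {ε : ℝ} (hε : 0 ≤ ε) {i : ℤ × Fin n} (hi : i ∈ modes n) (hμ : lamJ S ω κ i.1 i.2 0 ≠ 0)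
    (k : Space d) {v : Vec n} (hv : symL A Em ((i.1 : ℝ) * ω) ((i.1 : ℝ) • κ) v = 0) :
    ‖inner ℂ (psiJ S κ i.1 i.2 (ε • k)) v‖ ≤ polarizedConst S ω κ * ε * (‖k‖ * ‖v‖) := by
  have lam_inv_le : 1 / |lamJ S ω κ i.1 i.2 0| ≤ lamInvSum S ω κ :=
    Finset.single_le_sum (f := fun i : ℤ × Fin n ↦ 1 / |lamJ S ω κ i.1 i.2 0|)
      (fun _ _ ↦ by positivity) hi
  calc ‖inner ℂ (psiJ S κ i.1 i.2 (ε • k)) v‖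
      = 1 / |lamJ S ω κ i.1 i.2 0|
          * (|lamJ S ω κ i.1 i.2 0| * ‖inner ℂ (psiJ S κ i.1 i.2 (ε • k)) v‖) := by
        rw [← mul_assoc, one_div_mul_cancel (abs_ne_zero.mpr hμ), one_mul]
    _ ≤ lamInvSum S ω κ * ((symbolLip A + lamLip S) * ε * (‖k‖ * ‖v‖)) := by
        exact mul_le_mul lam_inv_le (abs_lamJ_zero_mul_norm_inner_psiJ_le S ω κ hA hE hε
          (fst_mem_of_mem_modes hi) i.2 k hv) (by positivity) (lamInvSum_nonneg S ω κ)
    _ = polarizedConst S ω κ * ε * (‖k‖ * ‖v‖) := by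
        rw [polarizedConst]
        ring

theorem wnorm_component_le_of_symL_eq_zero (hA : ∀ l, (A l).IsSymm) (hE : Em.transpose = -Em)
    {ε : ℝ} (hε : 0 ≤ ε) {i : ℤ × Fin n} (hi : i ∈ modes n) (hμ : lamJ S ω κ i.1 i.2 0 ≠ 0)
    {v : L1 d (Vec n)} (hv : ∀ᵐ k, symL A Em ((i.1 : ℝ) * ω) ((i.1 : ℝ) • κ) (v k) = 0)
    {w W : Space d → ℝ≥0} (hwW : ∀ k, w k * ‖k‖ ≤ W k) :
    wnorm w (component S κ ε i.1 i.2 v)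
      ≤ ENNReal.ofReal (polarizedConst S ω κ * ε) * wnorm W v := by
  have const_nonneg : 0 ≤ polarizedConst S ω κ * ε := mul_nonneg (polarizedConst_nonneg S ω κ) hε
  refine wnorm_le_of_ae _ ?_
  filter_upwards [coeFn_component S κ ε i.1 i.2 v, hv] with k hk hvk
  rw [hk, Real.coe_toNNReal _ const_nonneg]
  calc (w k : ℝ) * ‖inner ℂ (psiJ S κ i.1 i.2 (ε • k)) (v k)‖
      ≤ w k * (polarizedConst S ω κ * ε * (‖k‖ * ‖v k‖)) := by
        gcongr
        exact norm_inner_psiJ_le_of_symL_eq_zero S ω κ hA hE hε hi hμ k hvk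
    _ = polarizedConst S ω κ * ε * (w k * ‖k‖ * ‖v k‖) := by ring
    _ ≤ polarizedConst S ω κ * ε * (W k * ‖v k‖) := by
        gcongr
        exact hwW k

end PolarizedData

section ScaledNorm

variable {d n : ℕ}

theorem normL1_smul_le {m : Space d → ℂ} {w : Space d → ℝ≥0} (h : ∀ k, ‖m k‖₊ ≤ w k)
    (f : Space d → Vec n) : normL1 (fun k ↦ m k • f k) ≤ wnorm w f := by
  unfold normL1 wnorm
  gcongr with k
  rw [enorm_smul]
  gcongr
  exact ENNReal.coe_le_coe.mpr (h k)

theorem nnnorm_I_mul_apply_le (μ : Fin d) (k : Space d) : ‖Complex.I * (k μ : ℂ)‖₊ ≤ ‖k‖₊ := by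
  rw [← NNReal.coe_le_coe, coe_nnnorm, coe_nnnorm, norm_mul, Complex.norm_I, one_mul,
    Complex.norm_real]
  exact PiLp.norm_apply_le k μ

theorem normL1_mulD_le (μ : Fin d) (f : Space d → Vec n) :
    normL1 (mulD μ f) ≤ wnorm (‖·‖₊) f :=
  normL1_smul_le (nnnorm_I_mul_apply_le μ) f

variable [NeZero n]

theorem norm_projP (v : Vec n) : ‖projP v‖ = ‖v 0‖ := by
  rw [projP, PiLp.norm_single]

theorem projP_smul (c : ℂ) (v : Vec n) : projP (c • v) = c • projP v := by
  ext i
  by_cases hi : i = 0 <;> simp [projP, hi]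

theorem norm_sub_projP_le (v : Vec n) :
    ‖v - projP v‖ ≤ ∑ l ∈ Finset.univ.erase 0, ‖v l‖ := by
  refine (norm_le_sum_norm_apply _).trans_eq ?_
  rw [← Finset.add_sum_erase _ _ (Finset.mem_univ (0 : Fin n))]
  have zero_apply : ‖(v - projP v) 0‖ = 0 := by simp [projP]
  rw [zero_apply, zero_add]
  exact Finset.sum_congr rfl fun l hl ↦ by simp [projP, Finset.ne_of_mem_erase hl]

theorem scaledNorm_le_of_normL1_le {ε : ℝ} (hε : 0 < ε) {y₁ y₃ : Space d → Vec n} {X C : ℝ}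
    (hX : 0 ≤ X) (hC : 0 ≤ C) (critical : normL1 (fun k ↦ projP (y₁ k)) ≤ ENNReal.ofReal X)
    (noncritical : normL1 (fun k ↦ y₁ k - projP (y₁ k)) + normL1 y₃ ≤ ENNReal.ofReal (C * ε)) :
    scaledNorm ε y₁ y₃ ≤ ENNReal.ofReal (2 * X + 2 * C) := by
  unfold scaledNorm
  rw [add_assoc, ← mul_add, ENNReal.ofReal_add (by positivity) (by positivity)]
  refine add_le_add ?_ ?_
  · rw [ENNReal.ofReal_mul zero_le_two, ENNReal.ofReal_ofNat]
    gcongr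
  · calc _ ≤ ENNReal.ofReal (2 / ε) * ENNReal.ofReal (C * ε) := by gcongr
      _ = ENNReal.ofReal (2 * C) := by
        rw [← ENNReal.ofReal_mul (by positivity)]
        congr 1
        field_simp

theorem one_le_ofReal_two_div {ε : ℝ} (hε : ε ∈ Ioc (0 : ℝ) 1) :
    1 ≤ ENNReal.ofReal (2 / ε) := by
  rw [ENNReal.one_le_ofReal, le_div_iff₀ hε.1]
  linarith [hε.2]

theorem normL1_fst_le_scaledNorm {ε : ℝ} (hε : ε ∈ Ioc (0 : ℝ) 1) {y₁ : Space d → Vec n}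
    (hy : AEMeasurable fun k ↦ ‖projP (y₁ k)‖ₑ) (y₃ : Space d → Vec n) :
    normL1 y₁ ≤ scaledNorm ε y₁ y₃ := by
  calc normL1 y₁
      ≤ normL1 (fun k ↦ projP (y₁ k)) + normL1 fun k ↦ y₁ k - projP (y₁ k) := by
        unfold normL1
        rw [← lintegral_add_left' hy]
        gcongr with k
        simpa using enorm_add_le (projP (y₁ k)) (y₁ k - projP (y₁ k))
    _ ≤ 2 * normL1 (fun k ↦ projP (y₁ k))
          + ENNReal.ofReal (2 / ε) * normL1 fun k ↦ y₁ k - projP (y₁ k) := by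
        gcongr
        exacts [le_mul_of_one_le_left zero_le one_le_two,
          le_mul_of_one_le_left zero_le (one_le_ofReal_two_div hε)]
    _ ≤ scaledNorm ε y₁ y₃ := le_self_add

theorem normL1_snd_le_scaledNorm {ε : ℝ} (hε : ε ∈ Ioc (0 : ℝ) 1) (y₁ y₃ : Space d → Vec n) :
    normL1 y₃ ≤ scaledNorm ε y₁ y₃ :=
  (le_mul_of_one_le_left zero_le (one_le_ofReal_two_div hε)).trans le_add_self

end ScaledNorm

section TransformedVariables

variable {d n : ℕ} {A : Fin d → Matrix (Fin n) (Fin n) ℝ} {Em : Matrix (Fin n) (Fin n) ℝ}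
  (S : ℤ → SmoothEigen A Em) (ω : ℝ) (κ : Space d) (ε : ℝ) (u : ℤ → ℝ → Space d → Vec n)

theorem zVar_apply (j : ℤ) (t : ℝ) (k : Space d) (l : Fin n) :
    zVar S ω κ ε u j t k l
      = Complex.exp (Complex.I * (t : ℂ) / (ε : ℂ) * (lamJ S ω κ j l (ε • k) : ℂ))
        * inner ℂ (psiJ S κ j l (ε • k)) (hat (u j t) k) := by
  simp only [zVar, SMat, Matrix.toLpLin_apply, ← Matrix.mulVec_mulVec, Matrix.mulVec_diagonal]
  congr 1
  simp only [Matrix.mulVec, dotProduct, Matrix.conjTranspose_apply, PsiJ, Matrix.of_apply,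
    PiLp.inner_apply, RCLike.inner_apply]
  exact Finset.sum_congr rfl fun i _ ↦ mul_comm _ _

theorem norm_zVar_apply (j : ℤ) (t : ℝ) (k : Space d) (l : Fin n) :
    ‖zVar S ω κ ε u j t k l‖ = ‖inner ℂ (psiJ S κ j l (ε • k)) (hat (u j t) k)‖ := by
  have phase_eq : Complex.I * (t : ℂ) / (ε : ℂ) * (lamJ S ω κ j l (ε • k) : ℂ)
      = ((t / ε * lamJ S ω κ j l (ε • k) : ℝ) : ℂ) * Complex.I := by
    push_cast
    ring
  rw [zVar_apply, norm_mul, phase_eq, Complex.norm_exp_ofReal_mul_I, one_mul]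

theorem norm_zVar (j : ℤ) (t : ℝ) (k : Space d) :
    ‖zVar S ω κ ε u j t k‖ = ‖hat (u j t) k‖ := by
  rw [← sq_eq_sq₀ (norm_nonneg _) (norm_nonneg _), EuclideanSpace.norm_sq_eq,
    ← sum_norm_sq_inner_psiJ S κ j (ε • k) (hat (u j t) k)]
  simp only [norm_zVar_apply]

theorem normL1_zVar (j : ℤ) (t : ℝ) : normL1 (zVar S ω κ ε u j t) = wnorm 1 (hatL1 (u j t)) := by
  rw [wnorm_one_hatL1]
  unfold normL1
  simp only [← ofReal_norm, norm_zVar]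

theorem norm_le_sum_norm_inner_psiJ (j : ℤ) (θ : Space d) (v : Vec n) :
    ‖v‖ ≤ ∑ l, ‖inner ℂ (psiJ S κ j l θ) v‖ := by
  calc ‖v‖ = ‖∑ l, inner ℂ (psiJ S κ j l θ) v • psiJ S κ j l θ‖ := by rw [sum_inner_psiJ_smul]
    _ ≤ ∑ l, ‖inner ℂ (psiJ S κ j l θ) v • psiJ S κ j l θ‖ := norm_sum_le _ _
    _ = ∑ l, ‖inner ℂ (psiJ S κ j l θ) v‖ := by simp only [norm_smul, norm_psiJ, mul_one]

theorem wnorm_le_sum_component {E : Type*} [NormedAddCommGroup E] {w : Space d → ℝ≥0}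
    (hw : Measurable w) (s : Finset (Fin n)) (j : ℤ) {f : Space d → Vec n} {g : Space d → E}
    (h : ∀ k, ‖g k‖ ≤ ∑ l ∈ s, ‖inner ℂ (psiJ S κ j l (ε • k)) (hat f k)‖) :
    wnorm w g ≤ ∑ l ∈ s, wnorm w (component S κ ε j l (hatL1 f)) := by
  unfold wnorm
  rw [← lintegral_finsetSum' _ fun i _ ↦
    aemeasurable_weight_mul_enorm hw (L1.integrable_coeFn _).1]
  apply lintegral_mono_ae
  filter_upwards [coeFn_hatL1 f, ae_all_iff.mpr fun l ↦ coeFn_component S κ ε j l (hatL1 f)]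
    with k hk_hat hk_component
  rw [← Finset.mul_sum]
  gcongr
  simp only [hk_component, hk_hat, ← ofReal_norm]
  rw [← ENNReal.ofReal_sum_of_nonneg fun l _ ↦ norm_nonneg _]
  exact ENNReal.ofReal_le_ofReal (h k)

variable [NeZero n]

theorem norm_sub_projEps_le (k : Space d) (v : Vec n) :
    ‖v - projEps S κ ε k v‖
      ≤ ∑ l ∈ Finset.univ.erase 0, ‖inner ℂ (psiJ S κ 1 l (ε • k)) v‖ := by
  have eq_sum : v - projEps S κ ε k v = ∑ l ∈ Finset.univ.erase 0,
      inner ℂ (psiJ S κ 1 l (ε • k)) v • psiJ S κ 1 l (ε • k) := by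
    rw [sub_eq_iff_eq_add', projEps, Finset.add_sum_erase _ (fun l : Fin n ↦
      inner ℂ (psiJ S κ 1 l (ε • k)) v • psiJ S κ 1 l (ε • k)) (Finset.mem_univ 0),
      sum_inner_psiJ_smul]
  rw [eq_sum]
  refine (norm_sum_le _ _).trans_eq (Finset.sum_congr rfl fun l _ ↦ ?_)
  rw [norm_smul, norm_psiJ, mul_one]

theorem sum_modes (f : ℤ × Fin n → ℝ≥0∞) :
    ∑ i ∈ modes n, f i = ∑ l ∈ Finset.univ.erase 0, f (1, l) + ∑ l, f (3, l) := by
  unfold modes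
  rw [← Finset.filter_ne', ← Finset.filter_ne', Finset.sum_filter, Finset.sum_filter,
    Finset.sum_product, Finset.sum_pair (by norm_num)]
  simp

theorem sum_modes_le {C : ℝ} {f : ℤ × Fin n → ℝ≥0∞}
    (h : ∀ i ∈ modes n, f i ≤ ENNReal.ofReal (C * ε)) :
    ∑ i ∈ modes n, f i ≤ ENNReal.ofReal ((modes n).card * C * ε) := by
  refine (Finset.sum_le_card_nsmul _ _ _ h).trans_eq ?_
  rw [nsmul_eq_mul, mul_assoc, ENNReal.ofReal_mul (p := ((modes n).card : ℝ)) (by positivity),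
    ENNReal.ofReal_natCast]

theorem aemeasurable_enorm_projP_zVar (t : ℝ) :
    AEMeasurable fun k ↦ ‖projP (zVar S ω κ ε u 1 t k)‖ₑ := by
  refine (L1.integrable_coeFn (component S κ ε 1 0 (hatL1 (u 1 t)))).1.enorm.congr ?_
  filter_upwards [coeFn_hatL1 (u 1 t), coeFn_component S κ ε 1 0 (hatL1 (u 1 t))]
    with k hk_hat hk_component
  rw [hk_component, hk_hat, ← ofReal_norm, ← ofReal_norm, norm_projP, norm_zVar_apply]

theorem wnorm_one_hatL1_le_scaledNorm_zVar (hε : ε ∈ Ioc (0 : ℝ) 1) (t : ℝ) {j : ℤ}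
    (hj : j ∈ ({1, 3} : Finset ℤ)) :
    wnorm 1 (hatL1 (u j t)) ≤ scaledNorm ε (zVar S ω κ ε u 1 t) (zVar S ω κ ε u 3 t) := by
  rw [← normL1_zVar S ω κ ε]
  obtain rfl | rfl : j = 1 ∨ j = 3 := by simpa using hj
  · exact normL1_fst_le_scaledNorm hε (aemeasurable_enorm_projP_zVar S ω κ ε u t) _
  · exact normL1_snd_le_scaledNorm hε _ _

variable {m : Space d → ℂ} {w : Space d → ℝ≥0}

theorem normL1_projP_smul_zVar_le (hm : ∀ k, ‖m k‖₊ ≤ w k) (t : ℝ) :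
    normL1 (fun k ↦ projP (m k • zVar S ω κ ε u 1 t k)) ≤ wnorm w (hatL1 (u 1 t)) := by
  simp only [projP_smul]
  refine (normL1_smul_le hm _).trans (wnorm_mono_ae ?_)
  filter_upwards [coeFn_hatL1 (u 1 t)] with k hk
  rw [hk, norm_projP, norm_zVar_apply]
  gcongr
  exact norm_inner_psiJ_le S κ 1 0 _ _

theorem normL1_noncritical_smul_zVar_le (hw : Measurable w) (hm : ∀ k, ‖m k‖₊ ≤ w k) (t : ℝ) :
    normL1 (fun k ↦ m k • zVar S ω κ ε u 1 t k - projP (m k • zVar S ω κ ε u 1 t k))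
        + normL1 (fun k ↦ m k • zVar S ω κ ε u 3 t k)
      ≤ ∑ i ∈ modes n, wnorm w (component S κ ε i.1 i.2 (hatL1 (u i.1 t))) := by
  simp only [projP_smul, ← smul_sub]
  rw [sum_modes]
  refine add_le_add ((normL1_smul_le hm _).trans ?_) ((normL1_smul_le hm _).trans ?_)
  · refine wnorm_le_sum_component S κ ε hw (Finset.univ.erase 0) 1 (f := u 1 t) fun k ↦ ?_
    simpa only [norm_zVar_apply] using norm_sub_projP_le (zVar S ω κ ε u 1 t k)
  · refine wnorm_le_sum_component S κ ε hw Finset.univ 3 (f := u 3 t) fun k ↦ ?_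
    simpa only [norm_zVar_apply] using norm_le_sum_norm_apply (zVar S ω κ ε u 3 t k)

theorem scaledNorm_smul_zVar_le (hw : Measurable w) (hm : ∀ k, ‖m k‖₊ ≤ w k) (t : ℝ)
    (hε : 0 < ε) {X C : ℝ} (hX : 0 ≤ X) (hC : 0 ≤ C)
    (hu : wnorm w (hatL1 (u 1 t)) ≤ ENNReal.ofReal X)
    (hcomp : ∀ i ∈ modes n, wnorm w (component S κ ε i.1 i.2 (hatL1 (u i.1 t)))
      ≤ ENNReal.ofReal (C * ε)) :
    scaledNorm ε (fun k ↦ m k • zVar S ω κ ε u 1 t k) (fun k ↦ m k • zVar S ω κ ε u 3 t k)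
      ≤ ENNReal.ofReal (2 * X + 2 * ((modes n).card * C)) :=
  scaledNorm_le_of_normL1_le hε hX (by positivity)
    ((normL1_projP_smul_zVar_le S ω κ ε u hm t).trans hu)
    ((normL1_noncritical_smul_zVar_le S ω κ ε u hw hm t).trans (sum_modes_le ε hcomp))

theorem normL1_mulD_sub_projEps_le (μ : Fin d) (t : ℝ) :
    normL1 (mulD μ fun k ↦ hat (u 1 t) k - projEps S κ ε k (hat (u 1 t) k))
      ≤ ∑ i ∈ modes n, wnorm (‖·‖₊) (component S κ ε i.1 i.2 (hatL1 (u i.1 t))) := by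
  rw [sum_modes]
  exact ((normL1_mulD_le μ _).trans (wnorm_le_sum_component S κ ε measurable_nnnorm _ 1
    fun k ↦ norm_sub_projEps_le S κ ε k _)).trans le_self_add

theorem normW_pderiv_three_le (μ : Fin d) {t : ℝ} (hu : MemWs 1 (u 3 t)) :
    normW (pderiv μ (u 3 t))
      ≤ ∑ i ∈ modes n, wnorm (‖·‖₊) (component S κ ε i.1 i.2 (hatL1 (u i.1 t))) := by
  have memW_pderiv := hu.memW_pderiv μ
  have eq_mulD : normL1 (hat (pderiv μ (u 3 t))) = normL1 (mulD μ (hat (u 3 t))) := by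
    refine lintegral_congr_ae ?_
    filter_upwards [hat_pderiv (mod_cast hu.1) hu.memW μ memW_pderiv] with k hk
    rw [hk]
    rfl
  rw [← memW_pderiv.normL1_hat, eq_mulD, sum_modes]
  exact ((normL1_mulD_le μ _).trans (wnorm_le_sum_component S κ ε measurable_nnnorm _ 3
    fun k ↦ norm_le_sum_norm_inner_psiJ S κ 3 _ _)).trans le_add_self

end TransformedVariables

section PolarizedSolutions

variable {d n : ℕ} {A : Fin d → Matrix (Fin n) (Fin n) ℝ} {Em : Matrix (Fin n) (Fin n) ℝ}
  {T : (Fin n → ℝ) →ₗ[ℝ] (Fin n → ℝ) →ₗ[ℝ] (Fin n → ℝ) →ₗ[ℝ] (Fin n → ℝ)} {ω : ℝ} {κ : Space d}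

/-- A classical solution whose initial function `p` is polarized and has `W^s` norm at most `M`:
the class of solutions over which the constants of the estimates have to be uniform. -/
structure IsPolarizedSolution (A : Fin d → Matrix (Fin n) (Fin n) ℝ)
    (Em : Matrix (Fin n) (Fin n) ℝ)
    (T : (Fin n → ℝ) →ₗ[ℝ] (Fin n → ℝ) →ₗ[ℝ] (Fin n → ℝ) →ₗ[ℝ] (Fin n → ℝ)) (ω : ℝ) (κ : Space d)
    (ε τ : ℝ) (s : ℕ) (M : ℝ) (p : Space d → Vec n) (u : ℤ → ℝ → Space d → Vec n) : Prop where
  isClassicalSolution : IsClassicalSolution A Em T ω κ ε τ p u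
  memWs : MemWs s p
  normWs_le : normWs s p ≤ ENNReal.ofReal M
  polarized : ∀ x, Matrix.toEuclideanLin (symbolL A Em ω κ) (p x) = 0

/-- A bound for the moments of order `s` up to time `tend / ε` of polarized solutions that are
bounded by `B` in `W`. -/
def momentBound (T : (Fin n → ℝ) →ₗ[ℝ] (Fin n → ℝ) →ₗ[ℝ] (Fin n → ℝ) →ₗ[ℝ] (Fin n → ℝ)) (d s : ℕ)
    (M B tend : ℝ) : ℝ :=
  (d + 1) ^ (s + 1) * max M 0 * growthFactor T d (2 ^ s) B tend

theorem momentBound_nonneg (s : ℕ) (M B tend : ℝ) : 0 ≤ momentBound T d s M B tend := by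
  unfold momentBound growthFactor
  positivity

namespace IsPolarizedSolution

variable {ε τ : ℝ} {s : ℕ} {M : ℝ} {p : Space d → Vec n} {u : ℤ → ℝ → Space d → Vec n}

theorem hatL1_three_zero (hu : IsPolarizedSolution A Em T ω κ ε τ s M p u) (hτ : 0 ≤ τ) :
    hatL1 (u 3 0) = 0 :=
  hatL1_eq_zero (hu.isClassicalSolution.memW1 3 (by simp) 0 ⟨le_rfl, hτ⟩).memW
    hu.isClassicalSolution.initial_three

theorem wnorm_polyWeight_zero_le (hu : IsPolarizedSolution A Em T ω κ ε τ s M p u) :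
    wnorm (polyWeight d s) (hatL1 (u 1 0)) ≤ ENNReal.ofReal ((d + 1) ^ (s + 1) * max M 0) := by
  rw [funext hu.isClassicalSolution.initial_one, ENNReal.ofReal_mul (by positivity)]
  refine hu.memWs.wnorm_polyWeight_le.trans ?_
  gcongr
  exact hu.normWs_le.trans (ENNReal.ofReal_le_ofReal (le_max_left _ _))

theorem wnorm_one_zero_le (hu : IsPolarizedSolution A Em T ω κ ε τ s M p u) :
    wnorm 1 (hatL1 (u 1 0)) ≤ ENNReal.ofReal M := by
  rw [funext hu.isClassicalSolution.initial_one, wnorm_one_hatL1]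
  exact hu.memWs.normL1_hat_le.trans hu.normWs_le

theorem ae_symL_hatL1_zero (hu : IsPolarizedSolution A Em T ω κ ε τ s M p u) (hτ : 0 ≤ τ) {j : ℤ}
    (hj : j ∈ ({1, 3} : Finset ℤ)) :
    ∀ᵐ k, symL A Em ((j : ℝ) * ω) ((j : ℝ) • κ) (hatL1 (u j 0) k) = 0 := by
  refine ae_apply_hatL1_eq_zero (hu.isClassicalSolution.memW1 j hj 0 ⟨le_rfl, hτ⟩).memW fun x ↦ ?_
  obtain rfl | rfl : j = 1 ∨ j = 3 := by simpa using hj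
  · rw [hu.isClassicalSolution.initial_one, Int.cast_one, one_mul, one_smul]
    exact hu.polarized x
  · rw [hu.isClassicalSolution.initial_three, map_zero]

variable {tend tstar : ℝ}

theorem evolution (hu : IsPolarizedSolution A Em T ω κ ε (tend / ε) s M p u) (hε : 0 < ε)
    (htend : 0 < tend) (htstar : tstar ≤ tend) :
    Evolution A Em T ω κ ε (tstar / ε) fun j t ↦ hatL1 (u j t) :=
  (hu.isClassicalSolution.evolution hε.ne' (by positivity)).mono (by gcongr)

theorem wnorm_polyWeight_le (hu : IsPolarizedSolution A Em T ω κ ε (tend / ε) s M p u)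
    (hA : ∀ l, (A l).IsSymm) (hE : Em.transpose = -Em) (hε : 0 < ε) (htend : 0 < tend)
    (htstar : tstar ≤ tend) {B : ℝ} (hB : 0 ≤ B)
    (hBu : ∀ t ∈ Icc 0 (tstar / ε), ∀ j ∈ ({1, 3} : Finset ℤ),
      wnorm 1 (hatL1 (u j t)) ≤ ENNReal.ofReal B) :
    ∀ t ∈ Icc 0 (tstar / ε), ∀ j ∈ ({1, 3} : Finset ℤ),
      wnorm (polyWeight d s) (hatL1 (u j t)) ≤ ENNReal.ofReal (momentBound T d s M B tend) :=
  (hu.evolution hε htend htstar).wnorm_growth hA hE hε.le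
    (by rwa [mul_div_cancel₀ _ hε.ne']) (measurable_polyWeight s) (polyWeight_neg s)
    (one_le_pow₀ one_le_two) (polyWeight_add_le_add s) hB (by positivity) hBu
    hu.wnorm_polyWeight_zero_le (hu.hatL1_three_zero (by positivity))

end IsPolarizedSolution

variable [NeZero n] {S : ℤ → SmoothEigen A Em} {tend B : ℝ}

theorem exists_polarizedSolution_component_bound (hA : ∀ l, (A l).IsSymm)
    (hE : Em.transpose = -Em) (hS : lamJ S ω κ 1 0 0 = 0)
    (hμ : ∀ i ∈ modes n, lamJ S ω κ i.1 i.2 0 ≠ 0) (htend : 0 < tend) (hB : 0 ≤ B)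
    (s : ℕ) (M : ℝ) :
    ∃ C : ℝ, 0 ≤ C ∧ ∀ ε ∈ Ioc (0 : ℝ) 1, ∀ tstar ≤ tend, ∀ p u,
      IsPolarizedSolution A Em T ω κ ε (tend / ε) s M p u → ∀ w W, IsWeightPair w W →
      (∀ t ∈ Icc 0 (tstar / ε), ∀ j ∈ ({1, 3} : Finset ℤ),
        wnorm W (hatL1 (u j t)) ≤ ENNReal.ofReal B) →
      ∀ t ∈ Icc 0 (tstar / ε), ∀ i ∈ modes n,
        wnorm w (component S κ ε i.1 i.2 (hatL1 (u i.1 t))) ≤ ENNReal.ofReal (C * ε) := by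
  have const_nonneg := polarizedConst_nonneg S ω κ
  obtain ⟨C, hC, bound⟩ := exists_component_bound (T := T) hA hE hS hμ tend hB
    (q₀ := polarizedConst S ω κ * B) (by positivity)
  refine ⟨C, hC, fun ε ⟨hε, hε_le⟩ tstar htstar p u hu w W hwW hWB t ht ↦ ?_⟩
  refine bound ε hε hε_le (tstar / ε) (by rwa [mul_div_cancel₀ _ hε.ne']) _
    (hu.evolution hε htend htstar) w W hwW hWB (fun i hi ↦ ?_) t ht
  have hj := fst_mem_of_mem_modes hi
  refine (wnorm_component_le_of_symL_eq_zero S ω κ hA hE hε.le hi (hμ i hi)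
    (hu.ae_symL_hatL1_zero (by positivity) hj) hwW.mul_norm_le).trans ?_
  rw [mul_right_comm, ENNReal.ofReal_mul (p := polarizedConst S ω κ * ε) (by positivity)]
  gcongr
  exact hWB 0 ⟨le_rfl, ht.1.trans ht.2⟩ i.1 hj

end PolarizedSolutions

section ExamplesOfWeightPairs

theorem one_add_min_add_le_mul (N x y : ℝ≥0) :
    1 + min (x + y) N ≤ (1 + min x N) * (1 + min y N) := by
  have min_add_le : min (x + y) N ≤ min x N + min y N := by
    rcases le_total x N with hx | hx
    · rcases le_total y N with hy | hy
      · rw [min_eq_left hx, min_eq_left hy]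
        exact min_le_left _ _
      · rw [min_eq_right hy]
        exact (min_le_right _ _).trans le_add_self
    · rw [min_eq_right hx]
      exact (min_le_right _ _).trans le_self_add
  calc 1 + min (x + y) N ≤ 1 + (min x N + min y N) := by gcongr
    _ ≤ 1 + (min x N + min y N) + min x N * min y N := le_self_add
    _ = _ := by ring

variable {d : ℕ}

theorem isWeightPair_one_polyWeight : IsWeightPair (1 : Space d → ℝ≥0) (polyWeight d 1) where
  measurable_left := measurable_one
  measurable_right := measurable_polyWeight 1
  left_neg _ := rfl
  right_neg := polyWeight_neg 1
  left_add_le _ _ := (mul_one _).ge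
  right_add_le := polyWeight_add_le_mul 1
  bounded := ⟨1, fun _ ↦ le_rfl⟩
  one_le_left _ := le_rfl
  mul_one_add_le k := by rw [polyWeight, pow_one, Pi.one_apply, one_mul]

theorem isWeightPair_one_add_min_polyWeight (N : ℝ≥0) :
    IsWeightPair (fun k : Space d ↦ 1 + min ‖k‖₊ N) (polyWeight d 2) where
  measurable_left := by fun_prop
  measurable_right := measurable_polyWeight 2
  left_neg k := by rw [nnnorm_neg]
  right_neg := polyWeight_neg 2
  left_add_le x y := by
    refine le_trans ?_ (one_add_min_add_le_mul N ‖x‖₊ ‖y‖₊)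
    gcongr
    exact nnnorm_add_le x y
  right_add_le := polyWeight_add_le_mul 2
  bounded := ⟨1 + N, fun k ↦ by gcongr; exact min_le_right _ _⟩
  one_le_left _ := le_self_add
  mul_one_add_le k := by
    rw [polyWeight, sq]
    gcongr
    exact min_le_left _ _

theorem nnnorm_le_polyWeight_two (k : Space d) : ‖k‖₊ ≤ polyWeight d 2 k :=
  le_add_self.trans (le_self_pow₀ le_self_add two_ne_zero)

end ExamplesOfWeightPairs

section UniformBounds

variable {d n : ℕ} [NeZero n] {A : Fin d → Matrix (Fin n) (Fin n) ℝ}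
  {Em : Matrix (Fin n) (Fin n) ℝ} {S : ℤ → SmoothEigen A Em}
  {T : (Fin n → ℝ) →ₗ[ℝ] (Fin n → ℝ) →ₗ[ℝ] (Fin n → ℝ) →ₗ[ℝ] (Fin n → ℝ)} {ω : ℝ} {κ : Space d}
  {tend B : ℝ}

theorem exists_scaledNorm_zVar_le (hA : ∀ l, (A l).IsSymm) (hE : Em.transpose = -Em)
    (hS : lamJ S ω κ 1 0 0 = 0) (hμ : ∀ i ∈ modes n, lamJ S ω κ i.1 i.2 0 ≠ 0) (htend : 0 < tend)
    (M : ℝ) :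
    ∃ r : ℝ, 0 < r ∧ ∃ tstar ∈ Ioc 0 tend, ∀ ε ∈ Ioc (0 : ℝ) 1, ∀ p u,
      IsPolarizedSolution A Em T ω κ ε (tend / ε) 1 M p u → ∀ t ∈ Icc 0 (tstar / ε),
        scaledNorm ε (zVar S ω κ ε u 1 t) (zVar S ω κ ε u 3 t) ≤ ENNReal.ofReal r := by
  have B_pos : 0 < max M 1 := by positivity
  obtain ⟨tstar, htstar, wnorm_one_le⟩ := exists_time_wnorm_le hA hE T ω κ htend B_pos
  obtain ⟨C, hC, component_le⟩ := exists_polarizedSolution_component_bound (T := T) hA hE hS hμ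
    htend (momentBound_nonneg 1 M (2 * max M 1) tend) 1 M
  refine ⟨2 * (2 * max M 1) + 2 * ((modes n).card * C), by positivity, tstar, htstar, ?_⟩
  intro ε hε p u hu t ht
  have bounded := wnorm_one_le ε hε.1 _ (hu.evolution hε.1 htend htstar.2)
    (hu.wnorm_one_zero_le.trans (ENNReal.ofReal_le_ofReal (le_max_left _ _)))
    (hu.hatL1_three_zero (div_pos htend hε.1).le)
  have moments := hu.wnorm_polyWeight_le hA hE hε.1 htend htstar.2 (by positivity) bounded
  have scaled := scaledNorm_smul_zVar_le S ω κ ε u (m := 1) (w := 1) measurable_one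
    (fun _ ↦ nnnorm_one.le) t hε.1 (by positivity) hC (bounded t ht 1 (by simp))
    (component_le ε hε tstar htstar.2 p u hu 1 _ isWeightPair_one_polyWeight moments t ht)
  simpa only [Pi.one_apply, one_smul] using scaled

theorem exists_polarizedSolution_grad_component_bound (hA : ∀ l, (A l).IsSymm)
    (hE : Em.transpose = -Em) (hS : lamJ S ω κ 1 0 0 = 0)
    (hμ : ∀ i ∈ modes n, lamJ S ω κ i.1 i.2 0 ≠ 0) (htend : 0 < tend) (hB : 0 ≤ B)
    (s : ℕ) (M : ℝ) :
    ∃ C : ℝ, 0 ≤ C ∧ ∀ ε ∈ Ioc (0 : ℝ) 1, ∀ tstar ≤ tend, ∀ p u,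
      IsPolarizedSolution A Em T ω κ ε (tend / ε) s M p u →
      (∀ t ∈ Icc 0 (tstar / ε), ∀ j ∈ ({1, 3} : Finset ℤ),
        wnorm (polyWeight d 2) (hatL1 (u j t)) ≤ ENNReal.ofReal B) →
      ∀ t ∈ Icc 0 (tstar / ε), ∀ i ∈ modes n,
        wnorm (‖·‖₊) (component S κ ε i.1 i.2 (hatL1 (u i.1 t))) ≤ ENNReal.ofReal (C * ε) := by
  obtain ⟨C, hC, bound⟩ :=
    exists_polarizedSolution_component_bound (T := T) hA hE hS hμ htend hB s M
  refine ⟨C, hC, fun ε hε tstar htstar p u hu moments t ht i hi ↦ ?_⟩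
  refine wnorm_le_of_forall_min measurable_nnnorm (L1.integrable_coeFn _).1 fun N ↦ ?_
  exact (wnorm_mono_weight _ fun k ↦ le_add_self).trans
    (bound ε hε tstar htstar p u hu _ _ (isWeightPair_one_add_min_polyWeight N) moments t ht i hi)

theorem exists_grad_le (hA : ∀ l, (A l).IsSymm) (hE : Em.transpose = -Em)
    (hS : lamJ S ω κ 1 0 0 = 0) (hμ : ∀ i ∈ modes n, lamJ S ω κ i.1 i.2 0 ≠ 0) (htend : 0 < tend)
    (M r : ℝ) :
    ∃ C : ℝ, ∀ tstar ≤ tend, ∀ ε ∈ Ioc (0 : ℝ) 1, ∀ p u,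
      IsPolarizedSolution A Em T ω κ ε (tend / ε) 2 M p u →
      (∀ t ∈ Icc 0 (tstar / ε),
        scaledNorm ε (zVar S ω κ ε u 1 t) (zVar S ω κ ε u 3 t) ≤ ENNReal.ofReal r) →
      ∀ (μ : Fin d), ∀ t ∈ Icc 0 (tstar / ε),
        scaledNorm ε (mulD μ (zVar S ω κ ε u 1 t)) (mulD μ (zVar S ω κ ε u 3 t))
            ≤ ENNReal.ofReal C ∧
        normL1 (mulD μ fun k ↦ hat (u 1 t) k - projEps S κ ε k (hat (u 1 t) k))
            ≤ ENNReal.ofReal (C * ε) ∧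
        normW (pderiv μ (u 3 t)) ≤ ENNReal.ofReal (C * ε) := by
  set X := momentBound T d 2 M (max r 0) tend
  have X_nonneg : 0 ≤ X := momentBound_nonneg ..
  obtain ⟨C, hC, component_le⟩ :=
    exists_polarizedSolution_grad_component_bound (T := T) hA hE hS hμ htend X_nonneg 2 M
  refine ⟨2 * X + 2 * ((modes n).card * C), fun tstar htstar ε hε p u hu scaled_le μ t ht ↦ ?_⟩
  have hε_pos := hε.1
  have bounded (t : ℝ) (ht : t ∈ Icc 0 (tstar / ε)) (j : ℤ) (hj : j ∈ ({1, 3} : Finset ℤ)) :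
      wnorm 1 (hatL1 (u j t)) ≤ ENNReal.ofReal (max r 0) :=
    (wnorm_one_hatL1_le_scaledNorm_zVar S ω κ ε u hε t hj).trans
      ((scaled_le t ht).trans (ENNReal.ofReal_le_ofReal (le_max_left _ _)))
  have moments := hu.wnorm_polyWeight_le hA hE hε.1 htend htstar (le_max_right r 0) bounded
  have components := component_le ε hε tstar htstar p u hu moments t ht
  have noncritical : ∑ i ∈ modes n, wnorm (‖·‖₊) (component S κ ε i.1 i.2 (hatL1 (u i.1 t)))
      ≤ ENNReal.ofReal ((2 * X + 2 * ((modes n).card * C)) * ε) := by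
    refine (sum_modes_le ε components).trans (ENNReal.ofReal_le_ofReal ?_)
    gcongr
    have card_mul_nonneg : 0 ≤ (modes n).card * C := by positivity
    linarith
  have memWs_three : MemWs 1 (u 3 t) :=
    hu.isClassicalSolution.memW1 3 (by simp) t ⟨ht.1, ht.2.trans (by gcongr)⟩
  exact ⟨scaledNorm_smul_zVar_le S ω κ ε u measurable_nnnorm (nnnorm_I_mul_apply_le μ) t hε.1
      X_nonneg hC ((wnorm_mono_weight _ nnnorm_le_polyWeight_two).trans (moments t ht 1 (by simp)))
      components,
    (normL1_mulD_sub_projEps_le S κ ε u μ t).trans noncritical,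
    (normW_pderiv_three_le S κ ε u μ memWs_three).trans noncritical⟩

end UniformBounds

end Envelope

end

open Envelope in
theorem proposition2_general {d n : ℕ} [NeZero n]
    (A : Fin d → Matrix (Fin n) (Fin n) ℝ) (hA : ∀ l, (A l).IsSymm)
    (Em : Matrix (Fin n) (Fin n) ℝ) (hE : Em.transpose = -Em)
    (T : (Fin n → ℝ) →ₗ[ℝ] (Fin n → ℝ) →ₗ[ℝ] (Fin n → ℝ) →ₗ[ℝ] (Fin n → ℝ))
    (κ : Space d) (ω : ℝ)
    (hker : Module.finrank ℂ (LinearMap.ker (Matrix.toEuclideanLin (symbolL A Em ω κ))) = 1)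
    (hinv : IsUnit (symbolL A Em (((3 : ℤ) : ℝ) * ω) (((3 : ℤ) : ℝ) • κ)))
    (S : ℤ → SmoothEigen A Em) (hS : lamJ S ω κ 1 0 0 = 0)
    (tend : ℝ) (htend : 0 < tend) (M : ℝ) :
    (∃ r₀ : ℝ, 0 < r₀ ∧ ∀ r ≥ r₀, ∃ tstar ∈ Ioc 0 tend,
      ∀ p : Space d → Vec n, MemWs 1 p → normWs 1 p ≤ ENNReal.ofReal M →
      (∀ x, Matrix.toEuclideanLin (symbolL A Em ω κ) (p x) = 0) →
      ∀ ε ∈ Ioc (0 : ℝ) 1, ∀ u : ℤ → ℝ → Space d → Vec n,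
      IsClassicalSolution A Em T ω κ ε (tend / ε) p u →
      ∀ t ∈ Icc 0 (tstar / ε),
        scaledNorm ε (zVar S ω κ ε u 1 t) (zVar S ω κ ε u 3 t) ≤ ENNReal.ofReal r) ∧
    (∀ r : ℝ, ∃ C : ℝ, ∀ tstar ∈ Ioc 0 tend,
      ∀ p : Space d → Vec n, MemWs 2 p → normWs 2 p ≤ ENNReal.ofReal M →
      (∀ x, Matrix.toEuclideanLin (symbolL A Em ω κ) (p x) = 0) →
      ∀ ε ∈ Ioc (0 : ℝ) 1, ∀ u : ℤ → ℝ → Space d → Vec n,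
      IsClassicalSolution A Em T ω κ ε (tend / ε) p u →
      (∀ t ∈ Icc 0 (tstar / ε),
        scaledNorm ε (zVar S ω κ ε u 1 t) (zVar S ω κ ε u 3 t) ≤ ENNReal.ofReal r) →
      ∀ (μ : Fin d), ∀ t ∈ Icc 0 (tstar / ε),
        scaledNorm ε (mulD μ (zVar S ω κ ε u 1 t)) (mulD μ (zVar S ω κ ε u 3 t))
            ≤ ENNReal.ofReal C ∧
        normL1 (mulD μ fun k ↦ hat (u 1 t) k - projEps S κ ε k (hat (u 1 t) k))
            ≤ ENNReal.ofReal (C * ε) ∧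
        normW (pderiv μ (u 3 t)) ≤ ENNReal.ofReal (C * ε)) := by
  have hμ (i) (hi : i ∈ modes n) : lamJ S ω κ i.1 i.2 0 ≠ 0 :=
    lamJ_ne_zero_of_mem_modes S ω κ hker hinv hS hi
  constructor
  · obtain ⟨r₀, hr₀, tstar, htstar, bound⟩ := exists_scaledNorm_zVar_le (T := T) hA hE hS hμ htend M
    exact ⟨r₀, hr₀, fun r hr ↦ ⟨tstar, htstar, fun p hp hpM hpol ε hε u hu t ht ↦
      (bound ε hε p u ⟨hu, hp, hpM, hpol⟩ t ht).trans (ENNReal.ofReal_le_ofReal hr)⟩⟩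
  · intro r
    obtain ⟨C, bound⟩ := exists_grad_le (T := T) hA hE hS hμ htend M r
    exact ⟨C, fun tstar htstar p hp hpM hpol ε hε u hu scaled_le ↦
      bound tstar htstar.2 ε hε p u ⟨hu, hp, hpM, hpol⟩ scaled_le⟩

open Envelope in
theorem proposition2 {d n : ℕ} [NeZero n]
    (A : Fin d → Matrix (Fin n) (Fin n) ℝ) (hA : ∀ l, (A l).IsSymm)
    (Em : Matrix (Fin n) (Fin n) ℝ) (hE : Em.transpose = -Em)
    (T : (Fin n → ℝ) →ₗ[ℝ] (Fin n → ℝ) →ₗ[ℝ] (Fin n → ℝ) →ₗ[ℝ] (Fin n → ℝ))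
    (κ : Space d) (hκ : κ ≠ 0) (ω : ℝ)
    (hker : Module.finrank ℂ (LinearMap.ker (Matrix.toEuclideanLin (symbolL A Em ω κ))) = 1)
    (hinv : ∀ j ∈ ({3, 5} : Finset ℤ), IsUnit (symbolL A Em ((j : ℝ) * ω) ((j : ℝ) • κ)))
    (S : ℤ → SmoothEigen A Em) (hS : lamJ S ω κ 1 0 0 = 0)
    (tend : ℝ) (htend : 0 < tend) (M : ℝ) :
    (∃ r₀ : ℝ, 0 < r₀ ∧ ∀ r ≥ r₀, ∃ tstar ∈ Set.Ioc 0 tend,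
      ∀ p : Space d → Vec n, MemWs 1 p → normWs 1 p ≤ ENNReal.ofReal M →
      (∀ x, Matrix.toEuclideanLin (symbolL A Em ω κ) (p x) = 0) →
      ∀ ε ∈ Set.Ioc (0 : ℝ) 1, ∀ u : ℤ → ℝ → Space d → Vec n,
      IsClassicalSolution A Em T ω κ ε (tend / ε) p u →
      ∀ t ∈ Set.Icc 0 (tstar / ε),
        scaledNorm ε (zVar S ω κ ε u 1 t) (zVar S ω κ ε u 3 t) ≤ ENNReal.ofReal r) ∧
    (∀ r : ℝ, ∃ C : ℝ, ∀ tstar ∈ Set.Ioc 0 tend,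
      ∀ p : Space d → Vec n, MemWs 2 p → normWs 2 p ≤ ENNReal.ofReal M →
      (∀ x, Matrix.toEuclideanLin (symbolL A Em ω κ) (p x) = 0) →
      ∀ ε ∈ Set.Ioc (0 : ℝ) 1, ∀ u : ℤ → ℝ → Space d → Vec n,
      IsClassicalSolution A Em T ω κ ε (tend / ε) p u →
      (∀ t ∈ Set.Icc 0 (tstar / ε),
        scaledNorm ε (zVar S ω κ ε u 1 t) (zVar S ω κ ε u 3 t) ≤ ENNReal.ofReal r) →
      ∀ (μ : Fin d), ∀ t ∈ Set.Icc 0 (tstar / ε),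
        scaledNorm ε (mulD μ (zVar S ω κ ε u 1 t)) (mulD μ (zVar S ω κ ε u 3 t))
            ≤ ENNReal.ofReal C ∧
        normL1 (mulD μ fun k => hat (u 1 t) k - projEps S κ ε k (hat (u 1 t) k))
            ≤ ENNReal.ofReal (C * ε) ∧
        normW (pderiv μ (u 3 t)) ≤ ENNReal.ofReal (C * ε)) :=
  proposition2_general A hA Em hE T κ ω hker (hinv 3 (by simp)) S hS tend htend M
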